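/- **Model.** Fix a finite alphabet $\Sigma$. An enumeration problem assigns to each instance $x\in\Sigma^*$ a set $A(x)\subseteq\Sigma^*$ of solutions. Machines are random access machines with a read-only, randomly accessible input, registers holding natural numbers (initially $0$), loading of constants, copying, indirect addressing, addition, truncated subtraction, multiplication, comparison jumps, and an instruction $\mathtt{Output}(i,j)$ that outputs the concatenation of the registers $R_i,\dots,R_j$. Every instruction, including $\mathtt{Output}$, takes one unit of time. A machine uses polynomial space if, for some polynomial $s$, at every moment of its computation on an input of size $n$, the sum of the bit lengths of all registers up to the last accessed one is at most $s(n)$ and every register holds a number at most $s(n)$ (words of $O(\log n)$ bits). It solves the problem if on every $x$ it halts, having output every element of $A(x)$ exactly once and nothing else. $T(x,i)$ is the time of the $i$-th output and $T(x)$ the time at which the machine halts. A *partial solution* fixes some positions of a solution, each to a letter or to "past the end of the word". A *flashlight search* on an instance $x$ with $A(x)\neq\emptyset$ is a depth-first exploration of a tree of partial solutions whose root fixes nothing: at an inner vertex, one free position is fixed in all possible ways, and exactly the children that extend to an element of $A(x)$ are explored, in some order; a leaf is a partial solution with exactly one extension in $A(x)$; the subtree of each vertex is explored in one uninterrupted time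 interval, during which exactly the solutions extending that vertex are output. Its *path time* is the maximum, over root-to-leaf paths, of the total time spent at the vertices of the path, excluding the time spent in the subtrees of their children (if $A(x)=\emptyset$, it is the running time). It has *average delay* $d$ if the time spent in the subtree of each vertex (that is, on the whole problem and on each of its subproblems) is at most $d$ times the number of solutions in that subtree. **Theorem.** Let $A$ be an enumeration problem, let $k(x)$ be a bound on the length of the solutions of $x$, and let $a:\mathbb N^2\to\mathbb N$ be such that $x\mapsto a(|x|,k(x))$ is computable in polynomial time and space. Suppose that $A$ is solved, in polynomial space, by a machine performing a flashlight search with path time at most $p(|x|)$ for a polynomial $p$, and with average delay $a(|x|,k(x))$. Then there are a machine solving $A$ in polynomial space, a polynomial $q$ and a constant $C$ such that, for every $x$, with $n=|x|$, $k=k(x)$ and $N=|A(x)|$, this machine satisfies the following. If $N=0$, it halts within time $q(n)$. If $N\ge 1$, then: * (polynomial preprocessing) $T(x,1)\le q(n)$; * (delay) $T(x,i+1)-T(x,i)\le C\,a(n,k)\log_2 N$ for all $1\le i<N$, and $T(x)-T(x,N)\le C\,a(n,k)\log_2(N+1)$; * (average delay) $T(x)-T(x,1)\le C\,a(n,k)\,N$,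 and, counting the preprocessing as well, $T(x)\le C\max(a(n,k),k)\,N$. In particular, if $k\le a(n,k)$, then the average delay $T(x,N)/N$ is $O(a(n,k))$. -/

import Mathlib

open Finset

namespace EnumRAM

/-! ## Words and enumeration problems -/

/-- Words over the alphabet with `σ` letters. -/
abbrev Word (σ : ℕ) := List (Fin σ)

/-- An enumeration problem: `A x` is the set of solutions of the instance `x`. -/
abbrev EnumProblem (σ : ℕ) := Word σ → Set (Word σ)

/-- The register contents that represent a word, one letter per register. -/
def encode {σ : ℕ} (y : Word σ) : List ℕ := y.map Fin.val

/-! ## Random access machines with an output instruction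

The input is read-only and randomly accessible; all registers are initially zero. Every instruction
takes one unit of time, on words of `O(log n)` bits (see `UsesSpace`). -/

/-- Instructions. Register `i` is written `R i`. -/
inductive Instr
  /-- `R d := v` -/
  | const (d v : ℕ)
  /-- `R d := R s` -/
  | copy (d s : ℕ)
  /-- `R d := R (R s)` -/
  | load (d s : ℕ)
  /-- `R (R d) := R s` -/
  | store (d s : ℕ)
  /-- `R d :=` length of the input -/
  | inputLength (d : ℕ)
  /-- `R d :=` letter of the input at position `R s` (counted from `0`; `0` past the end) -/
  | input (d s : ℕ)
  /-- `R d := R s + R t` -/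
  | add (d s t : ℕ)
  /-- `R d := R s - R t`, truncated at zero -/
  | sub (d s t : ℕ)
  /-- `R d := R s * R t` -/
  | mul (d s t : ℕ)
  /-- go to instruction `l` -/
  | jump (l : ℕ)
  /-- go to instruction `l` if `R s < R t` -/
  | jumpLt (s t l : ℕ)
  /-- go to instruction `l` if `R s = R t` -/
  | jumpEq (s t l : ℕ)
  /-- output the concatenation of `R i, R (i+1), …, R j` for `i = R s`, `j = R t` -/
  | output (s t : ℕ)

namespace Instr

/-- One more than the largest index of a register that the instruction accesses. -/
def accessed (r : ℕ → ℕ) : Instr → ℕ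
  | const d _ => d + 1
  | copy d s => max d s + 1
  | load d s => max (max d s) (r s) + 1
  | store d s => max (max d s) (r d) + 1
  | inputLength d => d + 1
  | input d s => max d s + 1
  | add d s t => max d (max s t) + 1
  | sub d s t => max d (max s t) + 1
  | mul d s t => max d (max s t) + 1
  | jump _ => 0
  | jumpLt s t _ => max s t + 1
  | jumpEq s t _ => max s t + 1
  | output s t => max (max s t + 1) (if r s ≤ r t then r t + 1 else 0)

/-- Register contents after the instruction. -/
def nextReg {σ : ℕ} (x : Word σ) (r : ℕ → ℕ) : Instr → ℕ → ℕ
  | const d v => Function.update r d v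
  | copy d s => Function.update r d (r s)
  | load d s => Function.update r d (r (r s))
  | store d s => Function.update r (r d) (r s)
  | inputLength d => Function.update r d x.length
  | input d s => Function.update r d ((encode x).getD (r s) 0)
  | add d s t => Function.update r d (r s + r t)
  | sub d s t => Function.update r d (r s - r t)
  | mul d s t => Function.update r d (r s * r t)
  | jump _ => r
  | jumpLt _ _ _ => r
  | jumpEq _ _ _ => r
  | output _ _ => r

/-- Program counter after the instruction. -/
def nextPc (r : ℕ → ℕ) (pc : ℕ) : Instr → ℕ
  | jump l => l
  | jumpLt s t l => if r s < r t then l else pc + 1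
  | jumpEq s t l => if r s = r t then l else pc + 1
  | _ => pc + 1

/-- The words output by the instruction (at most one). -/
def emitted (r : ℕ → ℕ) : Instr → List (List ℕ)
  | output s t => [(List.range' (r s) (r t + 1 - r s)).map r]
  | _ => []

end Instr

/-- A program is a finite list of instructions. -/
abbrev Program := List Instr

/-- A configuration, together with a record of the past of the computation. -/
structure Config where
  /-- number of the next instruction -/
  pc : ℕ
  /-- contents of the registers -/
  reg : ℕ → ℕ
  /-- all registers accessed so far have index less than `top` -/
  top : ℕ
  /-- time elapsed -/
  time : ℕ
  /-- words output so far, in order, each with the time of its output -/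
  out : List (List ℕ × ℕ)

namespace Config

/-- The initial configuration. -/
def init : Config := ⟨0, fun _ => 0, 0, 0, []⟩

/-- Space: the sum of the lengths of the integers in the registers up to the last accessed one;
the integer `0` has length `1`. -/
def space (c : Config) : ℕ := ∑ i ∈ range c.top, max 1 (Nat.size (c.reg i))

/-- The words output so far. -/
def words (c : Config) : List (List ℕ) := c.out.map Prod.fst

/-- The time of the `i`-th output, for `1 ≤ i ≤ c.out.length`. -/
def outputTime (c : Config) (i : ℕ) : ℕ := (c.out.map Prod.snd).getD (i - 1) 0

end Config

/-- A machine halts when its program counter leaves the program. -/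
def Halted (P : Program) (c : Config) : Prop := P.length ≤ c.pc

/-- One step of computation; a halted configuration does not change any more. -/
def step {σ : ℕ} (P : Program) (x : Word σ) (c : Config) : Config :=
  match P[c.pc]? with
  | none => c
  | some I =>
    { pc := I.nextPc c.reg c.pc
      reg := I.nextReg x c.reg
      top := max c.top (I.accessed c.reg)
      time := c.time + 1
      out := c.out ++ (I.emitted c.reg).map fun z => (z, c.time + 1) }

/-- The configuration after `t` steps on input `x`. -/
def run {σ : ℕ} (P : Program) (x : Word σ) (t : ℕ) : Config :=
  (step P x)^[t] Config.init

/-- The computation on `x` halts, with final configuration `c`. -/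
def HaltsWith {σ : ℕ} (P : Program) (x : Word σ) (c : Config) : Prop :=
  ∃ t, run P x t = c ∧ Halted P c

/-- The machine solves the enumeration problem: on every input it halts, having output each
solution exactly once and nothing else. -/
def Solves {σ : ℕ} (P : Program) (A : EnumProblem σ) : Prop :=
  ∀ x, ∃ c, HaltsWith P x c ∧ c.words.Nodup ∧ {z | z ∈ c.words} = encode '' A x

/-- Polynomial space with words of `O(log n)` bits: at every point of the computation on an input
of size `n`, the space is at most `s n` and all registers contain integers at most `s n`. -/
def UsesSpace (σ : ℕ) (P : Program) (s : Polynomial ℕ) : Prop :=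
  ∀ (x : Word σ) (t : ℕ), (run P x t).space ≤ s.eval x.length ∧
    ∀ i, (run P x t).reg i ≤ s.eval x.length

/-- The number-valued function `f` of a word is computed in polynomial time and space: the machine
outputs the binary digits of `f x`, least significant first. -/
def PolyComputable {σ : ℕ} (f : Word σ → ℕ) : Prop :=
  ∃ (P : Program) (q : Polynomial ℕ), UsesSpace σ P q ∧
    ∀ x, ∃ c, HaltsWith P x c ∧ c.time ≤ q.eval x.length ∧ c.words = [Nat.digits 2 (f x)]

/-! ## Flashlight search -/

/-- A partial solution fixes some positions of the solution: `v i = some (some b)` says that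
the letter at position `i` is `b`, `v i = some none` that the solution ends before position `i`,
and `v i = none` that position `i` is still free. -/
abbrev PartialSolution (σ : ℕ) := ℕ → Option (Option (Fin σ))

/-- The partial solution in which nothing is fixed. -/
def emptyPartial (σ : ℕ) : PartialSolution σ := fun _ => none

/-- The solutions in `S` that extend the partial solution `v`. -/
def extensions {σ : ℕ} (S : Set (Word σ)) (v : PartialSolution σ) : Set (Word σ) :=
  {y | y ∈ S ∧ ∀ i b, v i = some b → y[i]? = b}

/-- The tree of partial solutions, with the interval `start, …, fin - 1` of machine steps during
which the subtree below each vertex is explored. At an inner vertex the position `pos` is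
fixed in all possible ways; a child without solution is `pruned`, that is, not explored. -/
inductive SearchTree (σ : ℕ)
  | pruned
  | leaf (start fin : ℕ)
  | node (start fin pos : ℕ) (child : Option (Fin σ) → SearchTree σ)

/-- The words output during the steps `start, …, fin - 1` of the computation `r`. -/
def outputsBetween (r : ℕ → Config) (start fin : ℕ) : Set (List ℕ) :=
  {z | z ∈ (r fin).words.drop (r start).words.length}

namespace SearchTree

variable {σ : ℕ}

/-- The steps during which the subtree is explored. -/
def steps : SearchTree σ → Finset ℕ
  | pruned => ∅
  | leaf s e => Ico s e
  | node s e _ _ => Ico s e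

/-- The number of leaves, that is, of solutions. -/
def numLeaves : SearchTree σ → ℕ
  | pruned => 0
  | leaf _ _ => 1
  | node _ _ _ child => ∑ b, (child b).numLeaves

/-- The computation `r` explores the tree below the partial solution `v` of the solution set
`S` depth first: a subtree is explored in one block of steps, in which exactly the solutions below
it are output; the blocks of the children (in any order) are disjoint parts of the block of their
parent; precisely the children that cannot be extended to a solution are not explored. -/
def IsTraversal (r : ℕ → Config) (S : Set (Word σ)) : PartialSolution σ → SearchTree σ → Prop
  | v, pruned => extensions S v = ∅
  | v, leaf s e => (∃ y, extensions S v = {y}) ∧ outputsBetween r s e = encode '' extensions S v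
  | v, node s e i child =>
      (extensions S v).Nonempty ∧ outputsBetween r s e = encode '' extensions S v ∧
      v i = none ∧
      (∀ b, IsTraversal r S (Function.update v i (some b)) (child b)) ∧
      (∀ b, (child b).steps ⊆ Ico s e) ∧
      (∀ b b', b ≠ b' → Disjoint (child b).steps (child b').steps)

/-- The path time: the maximum, over the paths from the root to a leaf, of the time spent at the
vertices of the path, not counting the time spent inside the subtrees below their children. -/
def pathTime : SearchTree σ → ℕ
  | pruned => 0
  | leaf s e => (Ico s e).card
  | node s e _ child =>
      (Ico s e \ univ.biUnion fun b => (child b).steps).card +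
        univ.sup fun b => (child b).pathTime

/-- The average delay is at most `d` on the whole problem and on all its subproblems: the time
spent in each subtree is at most `d` times the number of its solutions. -/
def AverageDelayLE (d : ℕ) : SearchTree σ → Prop
  | pruned => True
  | leaf s e => (Ico s e).card ≤ d
  | node s e i child =>
      (Ico s e).card ≤ d * (node s e i child).numLeaves ∧ ∀ b, (child b).AverageDelayLE d

end SearchTree

/-- The machine solves the problem `A` by a flashlight search with path time at most `p n` on
inputs of size `n`, and average delay at most `d x` on the input `x`. Here `h` is the number of
steps until the machine halts. If there is no solution, the tree is reduced to its root and the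
path time is the running time. -/
def SolvesByFlashlight {σ : ℕ} (P : Program) (A : EnumProblem σ)
    (p : Polynomial ℕ) (d : Word σ → ℕ) : Prop :=
  Solves P A ∧ ∀ x, ∃ h, Halted P (run P x h) ∧ (∀ t < h, ¬ Halted P (run P x t)) ∧
    (A x = ∅ → h ≤ p.eval x.length) ∧
    ((A x).Nonempty → ∃ T : SearchTree σ, T.steps = Ico 0 h ∧
      T.IsTraversal (run P x) (A x) (emptyPartial σ) ∧
      T.pathTime ≤ p.eval x.length ∧ T.AverageDelayLE (d x))

end EnumRAM

/-! Let `V` be a polynomial bound that dominates the path time, the space of the given machine, and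
the time and space for computing a. Put b = 24V and a' = min(a, V). Flashlight search enters through
density (`SolvesByFlashlight.density`): if there are solutions and the search halts after h steps,
then its first t steps yield at least (t - V)/a' solutions for every t ≤ h, and h ≤ a'N. At step t
the search stands on one root-to-leaf path. The time spent at the vertices of this path is at most
the path time; all other elapsed steps lie in completed subtrees, which are paid for by their own
solutions (`SearchTree.card_filter_steps_le`). Charging each step to the leaves below its vertex
shows that the path time also bounds the average delay, so a may be replaced by a'
(`SearchTree.averageDelayLE_min`) and all quantities fit into registers.

Density forbids late solutions but not long gaps, and the space does not allow the solutions of a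
long burst to be queued. The remedy is geometric amortization. The solutions of the first b steps
are put on a stack. After that, several processes each run the search again from its beginning, and
process z outputs only what it finds in its zone, the steps from 2^z b to 2^(z+1) b. Process z+1 is
started when process z enters its zone. The scheduler works in rounds: from the last process down to
process 0, each gets D = 24a' ticks, and then one word is popped from the stack. Every output starts
a new round. Thus every output found below 2^z b by a lower process or by the stack has given D
ticks to process z. Once all solutions below 2^z b are out, density makes this more than process z
needs for its zone. Hence an empty stack already implies that everything has been output
(`MInv.complete`).

A round has at most num + 1 blocks of at most D + 2 ticks. Since process z exists only if the search
is about 2^z b steps long, h ≤ a'N gives 2^(num+2) ≤ N (`MInv.bounds`), hence the delay O(a log N).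
The zones form a geometric series, so all processes together take O(h) = O(a'N) ticks
(`MInv.now_le`). Filling the stack costs one tick per letter, which is why k appears only when the
preprocessing is counted.

The step number of a process may be exponential, too large for a register. A process stores it
modulo b, together with a binary counter for the quotient, one bit per register. Incrementing costs
amortized constant time (`Proc.Inv.prog_le_three_mul`), and the zone is read off from the length of
the counter.

This abstract machine (`Tick`, with invariants `SInv`) is realized by a loop whose body `Code.body`
is loop-free and performs one tick in a number of steps independent of the input.
`Code.reaches_of_wp` reduces correctness and the space bound to weakest preconditions, which
culminate in `wp_body`. `LoopInv.times` translates ticks into machine steps. -/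

namespace EnumRAM

/-! ## Basic facts on computations -/

section Basics

variable {σ : ℕ} {P : Program} {x : Word σ}

theorem run_succ (t : ℕ) : run P x (t + 1) = step P x (run P x t) :=
  Function.iterate_succ_apply' _ _ _

theorem step_of_halted {c : Config} (h : Halted P c) : step P x c = c := by
  unfold step
  rw [List.getElem?_eq_none h]

theorem run_of_halted {t t' : ℕ} (h : Halted P (run P x t)) (htt : t ≤ t') :
    run P x t' = run P x t := by
  induction t', htt using Nat.le_induction with
  | base => rfl
  | succ n _ ih => rw [run_succ, ih, step_of_halted h]

theorem HaltsWith.unique {c c' : Config} (h : HaltsWith P x c) (h' : HaltsWith P x c') : c = c' := by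
  obtain ⟨t, rfl, ht⟩ := h
  obtain ⟨t', rfl, ht'⟩ := h'
  rcases le_total t t' with hle | hle
  · exact (run_of_halted ht hle).symm
  · exact run_of_halted ht' hle

theorem getElem?_of_not_halted {c : Config} (h : ¬ Halted P c) :
    ∃ I, P[c.pc]? = some I :=
  ⟨P[c.pc]'(not_le.mp h), List.getElem?_eq_getElem _⟩

theorem not_halted_of_getElem? {c : Config} {I : Instr} (h : P[c.pc]? = some I) : ¬ Halted P c := by
  intro hh
  rw [List.getElem?_eq_none hh] at h
  cases h

theorem run_time {t : ℕ} (h : ∀ u < t, ¬ Halted P (run P x u)) : (run P x t).time = t := by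
  induction t with
  | zero => rfl
  | succ t ih =>
    obtain ⟨I, hI⟩ := getElem?_of_not_halted (h t (Nat.lt_succ_self t))
    rw [run_succ]
    simp only [step, hI]
    rw [ih fun u hu => h u (by omega)]

/-- The word output by `P` in the configuration `c`, if any. -/
def outputOf (P : Program) (c : Config) : Option (List ℕ) :=
  match P[c.pc]? with
  | some I => (I.emitted c.reg).head?
  | none => none

theorem words_step (c : Config) : (step P x c).words = c.words ++ (outputOf P c).toList := by
  unfold step outputOf Config.words
  cases h : P[c.pc]? with
  | none => simp
  | some I => cases I <;> simp [Instr.emitted]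

/-- The word output by the computation on `x` at step `u`, if any. -/
def emits (P : Program) (x : Word σ) (u : ℕ) : Option (List ℕ) := outputOf P (run P x u)

theorem words_run (t : ℕ) : (run P x t).words = (List.range t).filterMap (emits P x) := by
  induction t with
  | zero => rfl
  | succ t ih =>
    rw [run_succ, words_step, ih, List.range_succ, List.filterMap_append]
    change _ ++ (emits P x t).toList = _
    cases h : emits P x t <;> simp [h]

/-- The word output at step `u`, or the empty word. -/
def wordAt (P : Program) (x : Word σ) (u : ℕ) : List ℕ := (emits P x u).getD []

theorem emits_of_isSome {u : ℕ} (h : (emits P x u).isSome) :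
    emits P x u = some (wordAt P x u) := by
  obtain ⟨w, hw⟩ := Option.isSome_iff_exists.mp h
  simp [wordAt, hw]

theorem mem_words_run {t : ℕ} {z : List ℕ} :
    z ∈ (run P x t).words ↔ ∃ u < t, emits P x u = some z := by
  simp [words_run]

theorem not_halted_of_emits {u : ℕ} (h : (emits P x u).isSome) : ¬ Halted P (run P x u) := by
  intro hh
  simp [emits, outputOf, List.getElem?_eq_none hh] at h

theorem length_words_run (t : ℕ) :
    (run P x t).words.length = #{u ∈ range t | (emits P x u).isSome} := by
  induction t with
  | zero => rfl
  | succ t ih =>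
    rw [run_succ, words_step, List.length_append, ih, Finset.range_add_one, Finset.filter_insert]
    change _ + (emits P x t).toList.length = _
    cases h : emits P x t <;> simp

/-- A second occurrence of a word would destroy `Nodup` for the list of words output up to that
moment. Solutions can therefore be identified with the steps that output them, and the scheduler
only deals with step numbers. -/
theorem wordAt_injOn {t : ℕ} (h : (run P x t).words.Nodup) {u v : ℕ} (hu : u < t) (hv : v < t)
    (hue : (emits P x u).isSome) (hve : (emits P x v).isSome) (he : wordAt P x u = wordAt P x v) :
    u = v := by
  wlog huv : u < v generalizing u v
  · rcases lt_trichotomy u v with h1 | h1 | h1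
    · exact this hu hv hue hve he h1
    · exact h1
    · exact (this hv hu hve hue he.symm h1).symm
  exfalso
  have h1 : (run P x (v + 1)).words.Nodup := by
    have : (run P x (v + 1)).words.Sublist (run P x t).words := by
      rw [words_run, words_run]
      exact (List.range_sublist.mpr (by omega)).filterMap _
    exact h.sublist this
  rw [run_succ, words_step] at h1
  change ((run P x v).words ++ (emits P x v).toList).Nodup at h1
  rw [emits_of_isSome hve] at h1
  have h2 : wordAt P x v ∈ (run P x v).words :=
    mem_words_run.mpr ⟨u, huv, he ▸ emits_of_isSome hue⟩
  simp [List.nodup_append] at h1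
  exact h1.2 _ h2 rfl

theorem accessed_le_top {t : ℕ} {I : Instr} (h : P[(run P x t).pc]? = some I) :
    I.accessed (run P x t).reg ≤ (run P x (t + 1)).top := by
  rw [run_succ]
  simp only [step, h]
  exact le_max_right _ _

theorem top_le_space (c : Config) : c.top ≤ c.space := by
  calc c.top = ∑ i ∈ range c.top, 1 := by simp
    _ ≤ c.space := Finset.sum_le_sum fun i _ => le_max_left _ _

/-- Each register below `top` contributes at least 1 to the space, so a space bound also bounds the
addresses. A simulated machine therefore fits into a row of fixed length. -/
theorem UsesSpace.accessed_le {s : Polynomial ℕ} (hs : UsesSpace σ P s) {t : ℕ} {I : Instr}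
    (h : P[(run P x t).pc]? = some I) : I.accessed (run P x t).reg ≤ s.eval x.length :=
  (accessed_le_top h).trans ((top_le_space _).trans (hs x (t + 1)).1)

/-- A bound on the values that the program counter can take. -/
def pcBound : Program → ℕ
  | [] => 0
  | .jump l :: P => l + pcBound P + 1
  | .jumpLt _ _ l :: P => l + pcBound P + 1
  | .jumpEq _ _ l :: P => l + pcBound P + 1
  | _ :: P => pcBound P + 1

theorem length_le_pcBound (P : Program) : P.length ≤ pcBound P := by
  induction P with
  | nil => simp [pcBound]
  | cons I P ih => cases I <;> simp [pcBound] <;> omega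

/-- The program counter of a simulated machine is kept in a register. A jump may lead far beyond the
program, so the length of the program is not a bound and the jump targets are added. -/
theorem nextPc_le_pcBound {P : Program} {I : Instr} {i : ℕ} (h : P[i]? = some I) (r : ℕ → ℕ) :
    I.nextPc r i ≤ pcBound P := by
  have key : ∀ I ∈ P, (∀ s t l, I = .jumpLt s t l → l ≤ pcBound P) ∧
      (∀ s t l, I = .jumpEq s t l → l ≤ pcBound P) ∧ (∀ l, I = .jump l → l ≤ pcBound P) := by
    clear h
    induction P with
    | nil => simp
    | cons J P ih =>
      intro I hI
      have hmono : pcBound P ≤ pcBound (J :: P) := by cases J <;> simp [pcBound] <;> omega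
      rcases List.mem_cons.mp hI with rfl | hI
      · refine ⟨fun s t l e => ?_, fun s t l e => ?_, fun l e => ?_⟩ <;> subst e <;>
          simp [pcBound] <;> omega
      · obtain ⟨h1, h2, h3⟩ := ih I hI
        exact ⟨fun s t l e => (h1 s t l e).trans hmono, fun s t l e => (h2 s t l e).trans hmono,
          fun l e => (h3 l e).trans hmono⟩
  have hi : i + 1 ≤ pcBound P := by
    have : i < P.length := by
      by_contra hc
      rw [List.getElem?_eq_none (by omega)] at h
      cases h
    exact le_trans this (length_le_pcBound P)
  obtain ⟨h1, h2, h3⟩ := key I (List.mem_of_getElem? h)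
  cases I <;> simp only [Instr.nextPc] <;> try exact hi
  · exact h3 _ rfl
  · split
    · exact h1 _ _ _ rfl
    · exact hi
  · split
    · exact h2 _ _ _ rfl
    · exact hi

theorem run_pc_le (t : ℕ) : (run P x t).pc ≤ pcBound P := by
  induction t with
  | zero => exact Nat.zero_le _
  | succ t ih =>
    rw [run_succ]
    unfold step
    cases h : P[(run P x t).pc]? with
    | none => exact ih
    | some I => exact nextPc_le_pcBound h _

/-- A bound of this form can be computed by loop-free code: a fixed number of multiplications by n +
1. -/
theorem exists_monomial_bound (P : Polynomial ℕ) :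
    ∃ e : ℕ, ∀ n : ℕ, P.eval n ≤ P.eval 1 * (n + 1) ^ e := by
  refine ⟨P.natDegree, fun n => ?_⟩
  rw [Polynomial.eval_eq_sum_range, Polynomial.eval_eq_sum_range, Finset.sum_mul]
  refine Finset.sum_le_sum fun i hi => ?_
  rw [one_pow, mul_one]
  refine Nat.mul_le_mul_left _ ?_
  calc n ^ i ≤ (n + 1) ^ i := Nat.pow_le_pow_left (Nat.le_succ n) i
    _ ≤ (n + 1) ^ P.natDegree :=
      Nat.pow_le_pow_right (Nat.succ_pos n) (Nat.lt_succ_iff.mp (Finset.mem_range.mp hi))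

end Basics

/-! ## Loop-free code -/

/-- Loop-free code: a decision tree of instructions, whose branches end by going to the exit
`done` or to the exit `halt`. -/
inductive Code
  | done
  | halt
  | op (I : Instr) (k : Code)
  | ifLt (s t : ℕ) (k₁ k₂ : Code)
  | ifEq (s t : ℕ) (k₁ k₂ : Code)

/-- Instructions that are no jumps. -/
def Instr.Straight : Instr → Prop
  | .jump _ => False
  | .jumpLt _ _ _ => False
  | .jumpEq _ _ _ => False
  | _ => True

/-- The value that an instruction writes into a register. -/
def Instr.written {σ : ℕ} (x : Word σ) (r : ℕ → ℕ) : Instr → ℕ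
  | const _ v => v
  | copy _ s => r s
  | load _ s => r (r s)
  | store _ s => r s
  | inputLength _ => x.length
  | input _ s => (encode x).getD (r s) 0
  | add _ s t => r s + r t
  | sub _ s t => r s - r t
  | mul _ s t => r s * r t
  | _ => 0

theorem Instr.nextReg_le {σ : ℕ} {x : Word σ} {r : ℕ → ℕ} {S : ℕ} (h : ∀ i, r i ≤ S) (I : Instr)
    (hI : I.written x r ≤ S) (i : ℕ) : I.nextReg x r i ≤ S := by
  cases I <;> simp only [Instr.nextReg, Instr.written, Function.update_apply] at * <;>
    first | exact h i | (split <;> first | assumption | exact h i)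

namespace Code

/-- The number of instructions of the compiled code. -/
def size : Code → ℕ
  | done => 1
  | halt => 1
  | op _ k => k.size + 1
  | ifLt _ _ k₁ k₂ => k₁.size + k₂.size + 1
  | ifEq _ _ k₁ k₂ => k₁.size + k₂.size + 1

/-- The code as a list of instructions that starts at position `o`, with the targets `d` and `e`
for the exits `done` and `halt`. -/
def compile (d e : ℕ) : Code → ℕ → List Instr
  | done, _ => [.jump d]
  | halt, _ => [.jump e]
  | op I k, o => I :: k.compile d e (o + 1)
  | ifLt s t k₁ k₂, o =>
      .jumpLt s t (o + 1 + k₂.size) :: (k₂.compile d e (o + 1) ++ k₁.compile d e (o + 1 + k₂.size))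
  | ifEq s t k₁ k₂, o =>
      .jumpEq s t (o + 1 + k₂.size) :: (k₂.compile d e (o + 1) ++ k₁.compile d e (o + 1 + k₂.size))

theorem length_compile (d e : ℕ) (k : Code) (o : ℕ) : (k.compile d e o).length = k.size := by
  induction k generalizing o with
  | done => rfl
  | halt => rfl
  | op I k ih => simp [compile, size, ih]
  | ifLt s t k₁ k₂ ih₁ ih₂ => simp [compile, size, ih₁, ih₂]; omega
  | ifEq s t k₁ k₂ ih₁ ih₂ => simp [compile, size, ih₁, ih₂]; omega

/-- Weakest precondition: the code accesses registers below `S` only, writes values that are at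
most `S` only, and ends in a state with the property `Q`. Here `Q` depends on whether the exit is
`halt`, on the registers, and on the list of the words output. -/
def wp {σ : ℕ} (x : Word σ) (S : ℕ) (Q : Prop → (ℕ → ℕ) → List (List ℕ) → Prop) :
    Code → (ℕ → ℕ) → List (List ℕ) → Prop
  | done, r, o => Q False r o
  | halt, r, o => Q True r o
  | op I k, r, o => I.Straight ∧ I.accessed r ≤ S ∧ I.written x r ≤ S ∧
      wp x S Q k (I.nextReg x r) (o ++ I.emitted r)
  | ifLt s t k₁ k₂, r, o => s < S ∧ t < S ∧ (r s < r t → wp x S Q k₁ r o) ∧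
      (¬ r s < r t → wp x S Q k₂ r o)
  | ifEq s t k₁ k₂, r, o => s < S ∧ t < S ∧ (r s = r t → wp x S Q k₁ r o) ∧
      (¬ r s = r t → wp x S Q k₂ r o)

end Code

/-- The program `P` contains the list `l` at position `o`. -/
def ContainsAt (P : Program) (l : List Instr) (o : ℕ) : Prop :=
  ∀ i < l.length, P[o + i]? = l[i]?

theorem ContainsAt.head {P : Program} {I : Instr} {l : List Instr} {o : ℕ}
    (h : ContainsAt P (I :: l) o) : P[o]? = some I := by
  simpa using h 0 (by simp)

theorem ContainsAt.tail {P : Program} {I : Instr} {l : List Instr} {o : ℕ}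
    (h : ContainsAt P (I :: l) o) : ContainsAt P l (o + 1) := by
  intro i hi
  have := h (i + 1) (by simpa using hi)
  rw [List.getElem?_cons_succ] at this
  rw [← this]
  congr 1
  omega

theorem ContainsAt.left {P : Program} {l l' : List Instr} {o : ℕ}
    (h : ContainsAt P (l ++ l') o) : ContainsAt P l o := by
  intro i hi
  rw [h i (by simp; omega), List.getElem?_append_left hi]

theorem ContainsAt.right {P : Program} {l l' : List Instr} {o : ℕ}
    (h : ContainsAt P (l ++ l') o) : ContainsAt P l' (o + l.length) := by
  intro i hi
  have := h (l.length + i) (by simp; omega)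
  rw [List.getElem?_append_right (by omega)] at this
  rw [add_assoc, this]
  congr 1
  omega

/-- The configuration respects the space bound `S`. -/
def Within (S : ℕ) (c : Config) : Prop := c.top ≤ S ∧ ∀ i, c.reg i ≤ S

/-- `c'` is reached from `c` in a positive number of at most `K` steps, within the space `S`; the
words output on the way are `w`. -/
def Reaches {σ : ℕ} (P : Program) (x : Word σ) (S K : ℕ) (c c' : Config) (w : List (List ℕ)) :
    Prop :=
  ∃ t, 0 < t ∧ t ≤ K ∧ (step P x)^[t] c = c' ∧ (∀ u ≤ t, Within S ((step P x)^[u] c)) ∧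
    c'.time ≤ c.time + K ∧ c.time < c'.time ∧
    ∃ l : List (List ℕ × ℕ), c'.out = c.out ++ l ∧ l.map Prod.fst = w ∧
      ∀ y ∈ l, c.time < y.2 ∧ y.2 ≤ c'.time

theorem Reaches.step {σ : ℕ} {P : Program} {x : Word σ} {S K : ℕ} {c c' : Config} {I : Instr}
    {w : List (List ℕ)} (hI : P[c.pc]? = some I) (hc : Within S c)
    (h : Reaches P x S K (EnumRAM.step P x c) c' w) :
    Reaches P x S (K + 1) c c' (I.emitted c.reg ++ w) := by
  obtain ⟨t, ht, htK, hrun, hw, hl1, hl2, l, hout, hlw, hl⟩ := h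
  have htime : (EnumRAM.step P x c).time = c.time + 1 := by simp [EnumRAM.step, hI]
  have hout1 : (EnumRAM.step P x c).out = c.out ++ (I.emitted c.reg).map fun z => (z, c.time + 1) := by
    simp [EnumRAM.step, hI]
  refine ⟨t + 1, by omega, by omega, by rwa [Function.iterate_succ_apply], ?_, by omega, by omega,
    (I.emitted c.reg).map (fun z => (z, c.time + 1)) ++ l, ?_, ?_, ?_⟩
  · intro u hu
    cases u with
    | zero => exact hc
    | succ u => rw [Function.iterate_succ_apply]; exact hw u (by omega)
  · rw [hout, hout1, List.append_assoc]
  · rw [List.map_append, hlw, List.map_map]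
    congr 1
    exact (List.map_congr_left fun z _ => rfl).trans (List.map_id _)
  · intro y hy
    rcases List.mem_append.mp hy with hy | hy
    · obtain ⟨z, _, rfl⟩ := List.mem_map.mp hy
      change c.time < c.time + 1 ∧ c.time + 1 ≤ c'.time
      omega
    · have := hl y hy
      omega

theorem Reaches.single {σ : ℕ} {P : Program} {x : Word σ} {S : ℕ} {c : Config} {I : Instr}
    (hI : P[c.pc]? = some I) (hc : Within S c) (hc' : Within S (EnumRAM.step P x c)) :
    Reaches P x S 1 c (EnumRAM.step P x c) (I.emitted c.reg) := by
  have htime : (EnumRAM.step P x c).time = c.time + 1 := by simp [EnumRAM.step, hI]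
  refine ⟨1, one_pos, le_rfl, rfl, ?_, by omega, by omega,
    (I.emitted c.reg).map (fun z => (z, c.time + 1)), ?_, ?_, ?_⟩
  · intro u hu
    interval_cases u
    · exact hc
    · exact hc'
  · simp [EnumRAM.step, hI]
  · rw [List.map_map]
    exact (List.map_congr_left fun z _ => rfl).trans (List.map_id _)
  · intro y hy
    obtain ⟨z, _, rfl⟩ := List.mem_map.mp hy
    change c.time < c.time + 1 ∧ c.time + 1 ≤ _
    omega

theorem Reaches.mono {σ : ℕ} {P : Program} {x : Word σ} {S K K' : ℕ} {c c' : Config}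
    {w : List (List ℕ)} (h : Reaches P x S K c c' w) (hK : K ≤ K') : Reaches P x S K' c c' w := by
  obtain ⟨t, ht, htK, hrun, hw, hl1, hl⟩ := h
  exact ⟨t, ht, by omega, hrun, hw, by omega, hl⟩

/-- Induction on the decision tree. There are no backward jumps inside the code, so each node is
executed at most once and `k.size` bounds the number of steps. The side conditions in `wp` keep
every intermediate configuration within the space `S`. -/
theorem Code.reaches_of_wp {σ : ℕ} {x : Word σ} {S : ℕ}
    {Q : Prop → (ℕ → ℕ) → List (List ℕ) → Prop} {P : Program} {d e : ℕ} (k : Code) (o : ℕ)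
    (hP : ContainsAt P (k.compile d e o) o) (c : Config) (hc : Within S c) (hpc : c.pc = o)
    (w : List (List ℕ)) (h : k.wp x S Q c.reg w) :
    ∃ c' w' b, Reaches P x S k.size c c' w' ∧ Q b c'.reg (w ++ w') ∧
      (b → c'.pc = e) ∧ (¬ b → c'.pc = d) := by
  induction k generalizing o c w with
  | done =>
    have hI : P[c.pc]? = some (.jump d) := hpc ▸ hP.head
    refine ⟨_, _, False, Reaches.single hI hc ?_, ?_, False.elim, fun _ => ?_⟩
    · simpa [step, hI, Within, Instr.nextReg, Instr.accessed] using hc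
    · simpa [step, hI, Instr.emitted, Instr.nextReg, Code.wp] using h
    · simp [step, hI, Instr.nextPc]
  | halt =>
    have hI : P[c.pc]? = some (.jump e) := hpc ▸ hP.head
    refine ⟨_, _, True, Reaches.single hI hc ?_, ?_, fun _ => ?_, fun h => (h trivial).elim⟩
    · simpa [step, hI, Within, Instr.nextReg, Instr.accessed] using hc
    · simpa [step, hI, Instr.emitted, Instr.nextReg, Code.wp] using h
    · simp [step, hI, Instr.nextPc]
  | op I k ih =>
    have hI : P[c.pc]? = some I := hpc ▸ hP.head
    obtain ⟨h1, h2, h3, h4⟩ := h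
    have hpc' : (step P x c).pc = o + 1 := by
      cases I <;> simp_all [step, Instr.nextPc, Instr.Straight]
    have hreg : (step P x c).reg = I.nextReg x c.reg := by simp [step, hI]
    obtain ⟨c', w', b, hr, hQ, hb⟩ := ih (o + 1) hP.tail (step P x c)
      ⟨by simpa [step, hI] using ⟨hc.1, h2⟩, fun i => by
        rw [hreg]; exact Instr.nextReg_le hc.2 I h3 i⟩ hpc' (w ++ I.emitted c.reg) (by rwa [hreg])
    exact ⟨c', _, b, hr.step hI hc, by rwa [← List.append_assoc], hb⟩
  | ifLt s t k₁ k₂ ih₁ ih₂ =>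
    have hI : P[c.pc]? = some (.jumpLt s t (o + 1 + k₂.size)) := hpc ▸ hP.head
    obtain ⟨h1, h2, h3, h4⟩ := h
    have hreg : (step P x c).reg = c.reg := by simp [step, hI, Instr.nextReg]
    have hc' : Within S (step P x c) :=
      ⟨by simpa [step, hI, Instr.accessed] using ⟨hc.1, h1, h2⟩, fun i => by rw [hreg]; exact hc.2 i⟩
    have hR := hP.tail.right
    rw [Code.length_compile] at hR
    by_cases hlt : c.reg s < c.reg t
    · obtain ⟨c', w', b, hr, hQ, hb⟩ := ih₁ _ hR (step P x c) hc'
        (by simp [step, hI, Instr.nextPc, hlt]) w (by rw [hreg]; exact h3 hlt)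
      exact ⟨c', _, b, (hr.step hI hc).mono (by simp only [Code.size]; omega), by
        simpa [Instr.emitted] using hQ, hb⟩
    · obtain ⟨c', w', b, hr, hQ, hb⟩ := ih₂ _ hP.tail.left (step P x c) hc'
        (by rw [step, hI]; simp [Instr.nextPc, hlt, hpc]) w (by rw [hreg]; exact h4 hlt)
      exact ⟨c', _, b, (hr.step hI hc).mono (by simp only [Code.size]; omega), by
        simpa [Instr.emitted] using hQ, hb⟩
  | ifEq s t k₁ k₂ ih₁ ih₂ =>
    have hI : P[c.pc]? = some (.jumpEq s t (o + 1 + k₂.size)) := hpc ▸ hP.head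
    obtain ⟨h1, h2, h3, h4⟩ := h
    have hreg : (step P x c).reg = c.reg := by simp [step, hI, Instr.nextReg]
    have hc' : Within S (step P x c) :=
      ⟨by simpa [step, hI, Instr.accessed] using ⟨hc.1, h1, h2⟩, fun i => by rw [hreg]; exact hc.2 i⟩
    have hR := hP.tail.right
    rw [Code.length_compile] at hR
    by_cases hlt : c.reg s = c.reg t
    · obtain ⟨c', w', b, hr, hQ, hb⟩ := ih₁ _ hR (step P x c) hc'
        (by simp [step, hI, Instr.nextPc, hlt]) w (by rw [hreg]; exact h3 hlt)
      exact ⟨c', _, b, (hr.step hI hc).mono (by simp only [Code.size]; omega), by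
        simpa [Instr.emitted] using hQ, hb⟩
    · obtain ⟨c', w', b, hr, hQ, hb⟩ := ih₂ _ hP.tail.left (step P x c) hc'
        (by rw [step, hI]; simp [Instr.nextPc, hlt, hpc]) w (by rw [hreg]; exact h4 hlt)
      exact ⟨c', _, b, (hr.step hI hc).mono (by simp only [Code.size]; omega), by
        simpa [Instr.emitted] using hQ, hb⟩

/-! ## Simulation of one step of a program

The simulated machine is stored in a block of registers, called a row. The address of the row is in
register `15`; the cell `0` of the row contains the program counter and the cells `4, 5, …` the
simulated registers. Registers `9, 10` and `19, …, 22` are temporary. -/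

namespace Code

/-- Load the simulated register `s` into the register `u`. -/
def read (s u : ℕ) (k : Code) : Code :=
  op (.const u (4 + s)) (op (.add u u 15) (op (.load u u) k))

/-- Write register `20` into the simulated register `d`. -/
def write (d : ℕ) (k : Code) : Code :=
  op (.const 19 (4 + d)) (op (.add 19 19 15) (op (.store 19 20) k))

/-- Set the simulated program counter. -/
def setPc (l : ℕ) (k : Code) : Code := op (.const 20 l) (op (.store 15 20) k)

/-- Turn the register `u` from the index of a simulated register into its address. -/
def locate (u : ℕ) (k : Code) : Code :=
  op (.const 19 4) (op (.add u u 19) (op (.add u u 15) k))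

/-- Simulate the instruction at position `j`. After an output instruction, the code continues with
`kO`, and the registers `9` and `10` contain the address of the first letter of the word that is
output and the address after its last letter. -/
def simInstr (kN kO : Code) (j : ℕ) : Instr → Code
  | .const d v => op (.const 20 v) (write d (setPc (j + 1) kN))
  | .copy d s => read s 20 (write d (setPc (j + 1) kN))
  | .load d s => read s 20 (locate 20 (op (.load 20 20) (write d (setPc (j + 1) kN))))
  | .store d s => read d 21 (locate 21 (read s 20 (op (.store 21 20) (setPc (j + 1) kN))))
  | .inputLength d => op (.inputLength 20) (write d (setPc (j + 1) kN))
  | .input d s => read s 20 (op (.input 20 20) (write d (setPc (j + 1) kN)))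
  | .add d s t => read s 20 (read t 21 (op (.add 20 20 21) (write d (setPc (j + 1) kN))))
  | .sub d s t => read s 20 (read t 21 (op (.sub 20 20 21) (write d (setPc (j + 1) kN))))
  | .mul d s t => read s 20 (read t 21 (op (.mul 20 20 21) (write d (setPc (j + 1) kN))))
  | .jump l => setPc l kN
  | .jumpLt s t l => read s 20 (read t 21 (ifLt 20 21 (setPc l kN) (setPc (j + 1) kN)))
  | .jumpEq s t l => read s 20 (read t 21 (ifEq 20 21 (setPc l kN) (setPc (j + 1) kN)))
  | .output s t => read s 9 (read t 10 (locate 9 (locate 10 (op (.add 10 10 1)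
      (setPc (j + 1) kO)))))

/-- Simulate the instruction whose position is in register `22`, for a program whose instructions
from position `j` on are listed. -/
def dispatch (kN kO kH : Code) : ℕ → List Instr → Code
  | _, [] => kH
  | j, I :: l => op (.const 19 j) (ifEq 22 19 (simInstr kN kO j I) (dispatch kN kO kH (j + 1) l))

/-- Simulate one step of the program `P`. The code continues with `kH` if the simulated machine has
halted, with `kO` after an output instruction, and with `kN` otherwise. -/
def sim (P : Program) (kN kO kH : Code) : Code :=
  op (.load 22 15) (dispatch kN kO kH 0 P)

end Code

/-- Temporary registers of the simulation. -/
def IsTemp (i : ℕ) : Prop := i = 9 ∨ i = 10 ∨ (19 ≤ i ∧ i ≤ 22)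

/-- The row at address `p` contains the simulated configuration `c`, restricted to the registers
below `V`. -/
def Holds (V p : ℕ) (c : Config) (r : ℕ → ℕ) : Prop :=
  r p = c.pc ∧ ∀ d < V, r (p + 4 + d) = c.reg d

/-- Only temporary registers and the simulated machine in the row at address `p` may differ. -/
def Agree (V p : ℕ) (r r' : ℕ → ℕ) : Prop :=
  ∀ i, ¬ IsTemp i → i ≠ p → ¬ (p + 4 ≤ i ∧ i < p + 4 + V) → r' i = r i

/-- The word `w` is stored in the registers from address `a` on. -/
def Stored (r : ℕ → ℕ) (a : ℕ) (w : List ℕ) : Prop := ∀ i (h : i < w.length), r (a + i) = w[i]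

section Sim

variable {σ : ℕ} {x : Word σ} {S V p : ℕ} {Q : Prop → (ℕ → ℕ) → List (List ℕ) → Prop}
  {r r₁ : ℕ → ℕ} {o : List (List ℕ)} {k : Code}

theorem wp_read {s u : ℕ} (hp : r 15 = p) (hp' : 32 ≤ p) (hu : u < 32) (hu' : u ≠ 15)
    (hs : p + 4 + s < S) (hr : r (p + 4 + s) ≤ S)
    (h : k.wp x S Q (Function.update r u (r (p + 4 + s))) o) :
    (Code.read s u k).wp x S Q r o := by
  have e1 : 4 + s + r 15 = p + 4 + s := by omega
  have e2 : p + 4 + s ≠ u := by omega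
  simp only [Code.read, Code.wp, Instr.Straight, Instr.accessed, Instr.written, Instr.nextReg,
    Instr.emitted, List.append_nil, Function.update_self, Function.update_of_ne hu'.symm,
    Function.update_idem, e1, true_and, Function.update_of_ne e2]
  exact ⟨by omega, by omega, by omega, by omega, by omega, hr, h⟩

theorem wp_locate {u : ℕ} (hp : r 15 = p) (hp' : 32 ≤ p) (hu : u < 32) (hu' : u ≠ 15)
    (hu'' : u ≠ 19) (hs : p + 4 + r u < S)
    (h : k.wp x S Q (Function.update (Function.update r 19 4) u (p + 4 + r u)) o) :
    (Code.locate u k).wp x S Q r o := by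
  have e1 : r u + 4 + p = p + 4 + r u := by omega
  simp only [Code.locate, Code.wp, Instr.Straight, Instr.accessed, Instr.written, Instr.nextReg,
    Instr.emitted, List.append_nil, Function.update_self, Function.update_of_ne hu'.symm,
    Function.update_idem, true_and, Function.update_of_ne hu'',
    Function.update_of_ne (show (15 : ℕ) ≠ 19 by decide), hp, e1]
  exact ⟨by omega, by omega, by omega, by omega, by omega, by omega, h⟩

theorem wp_setPc {l : ℕ} (hp : r 15 = p) (hp' : 32 ≤ p) (hS : p < S) (hl : l ≤ S)
    (h : k.wp x S Q (Function.update (Function.update r 20 l) p l) o) :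
    (Code.setPc l k).wp x S Q r o := by
  simp only [Code.setPc, Code.wp, Instr.Straight, Instr.accessed, Instr.written, Instr.nextReg,
    Instr.emitted, List.append_nil, Function.update_self, true_and,
    Function.update_of_ne (show (15 : ℕ) ≠ 20 by decide), hp]
  exact ⟨by omega, by omega, by omega, by omega, h⟩

theorem wp_write_setPc {d l : ℕ} {f : ℕ → ℕ} (hp : r₁ 15 = p) (hp' : 32 ≤ p)
    (hS : p + 4 + V < S) (hd : d < V) (hv : r₁ 20 ≤ S) (hl : l ≤ S)
    (hr₁ : ∀ i, ¬ IsTemp i → r₁ i = r i) (hf : ∀ e < V, r (p + 4 + e) = f e)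
    (h : ∀ r', Agree V p r r' →
      (r' p = l ∧ ∀ e < V, r' (p + 4 + e) = Function.update f d (r₁ 20) e) → k.wp x S Q r' o) :
    (Code.write d (Code.setPc l k)).wp x S Q r₁ o := by
  have e1 : 4 + d + p = p + 4 + d := by omega
  simp only [Code.write, Code.wp, Instr.Straight, Instr.accessed, Instr.written, Instr.nextReg,
    Instr.emitted, List.append_nil, Function.update_self, true_and, Function.update_idem,
    Function.update_of_ne (show (15 : ℕ) ≠ 19 by decide),
    Function.update_of_ne (show (20 : ℕ) ≠ 19 by decide), hp, e1]
  refine ⟨by omega, by omega, by omega, by omega, by omega, hv, ?_⟩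
  refine wp_setPc (p := p) ?_ hp' (by omega) hl (h _ ?_ ⟨by simp, fun e he => ?_⟩)
  · rw [Function.update_of_ne (by omega), Function.update_of_ne (by omega), hp]
  · intro i h1 h2 h3
    have h4 : i ≠ 19 ∧ i ≠ 20 := by unfold IsTemp at h1; omega
    rw [Function.update_of_ne h2, Function.update_of_ne h4.2, Function.update_of_ne (by omega),
      Function.update_of_ne h4.1, hr₁ i h1]
  · rw [Function.update_of_ne (by omega), Function.update_of_ne (by omega), Function.update_apply]
    by_cases hed : e = d
    · simp [hed]
    · rw [if_neg (by omega), Function.update_of_ne hed, Function.update_of_ne (by omega),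
        hr₁ _ (by unfold IsTemp; omega), hf e he]

theorem wp_jump {l : ℕ} {f : ℕ → ℕ} (hp : r₁ 15 = p) (hp' : 32 ≤ p) (hS : p + 4 + V < S)
    (hl : l ≤ S) (hr₁ : ∀ i, ¬ IsTemp i → r₁ i = r i) (hf : ∀ e < V, r (p + 4 + e) = f e)
    (h : ∀ r', Agree V p r r' → r' 9 = r₁ 9 → r' 10 = r₁ 10 →
      (r' p = l ∧ ∀ e < V, r' (p + 4 + e) = f e) → k.wp x S Q r' o) :
    (Code.setPc l k).wp x S Q r₁ o := by
  refine wp_setPc (p := p) hp hp' (by omega) hl (h _ ?_ ?_ ?_ ⟨by simp, fun e he => ?_⟩)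
  · intro i h1 h2 h3
    have h4 : i ≠ 20 := by unfold IsTemp at h1; omega
    rw [Function.update_of_ne h2, Function.update_of_ne h4, hr₁ i h1]
  · rw [Function.update_of_ne (by omega), Function.update_of_ne (by omega)]
  · rw [Function.update_of_ne (by omega), Function.update_of_ne (by omega)]
  · rw [Function.update_of_ne (by omega), Function.update_of_ne (by omega),
        hr₁ _ (by unfold IsTemp; omega), hf e he]

theorem update_temp {u v : ℕ} (hu : IsTemp u) (h : ∀ i, ¬ IsTemp i → r₁ i = r i) :
    ∀ i, ¬ IsTemp i → Function.update r₁ u v i = r i := by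
  intro i hi
  rw [Function.update_of_ne (by rintro rfl; exact hi hu), h i hi]

theorem wp_op_temp {u : ℕ} {I : Instr} (hI : I.Straight) (he : I.emitted r = [])
    (hn : I.nextReg x r = Function.update r u (I.written x r))
    (ha : I.accessed r ≤ S) (hw : I.written x r ≤ S)
    (h : k.wp x S Q (Function.update r u (I.written x r)) o) :
    (Code.op I k).wp x S Q r o := by
  refine ⟨hI, ha, hw, ?_⟩
  rw [he, List.append_nil, hn]
  exact h

/-- Hypotheses of the simulation: the row at address `p` contains the configuration `c`. -/
structure SimReady (P : Program) (x : Word σ) (S V p : ℕ) (c : Config) (r : ℕ → ℕ) : Prop where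
  row : r 15 = p
  one : r 1 = 1
  le_row : 32 ≤ p
  row_le : p + 4 + V + V + 2 < S
  bound : pcBound P ≤ S
  reg_le : ∀ i, c.reg i ≤ V
  next_le : ∀ i, (step P x c).reg i ≤ V
  pc_le : c.pc ≤ pcBound P
  accessed : ∀ I, P[c.pc]? = some I → I.accessed c.reg ≤ V
  holds : Holds V p c r

theorem isTemp_of {u : ℕ} (h : u = 9 ∨ u = 10 ∨ u = 19 ∨ u = 20 ∨ u = 21 ∨ u = 22) :
    IsTemp u := by unfold IsTemp; omega

/-- Simulated register d is the cell p + 4 + d of the row. The bound on accessed registers keeps the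
used cells inside the row, and `next_le` bounds the result of arithmetic before it is written. The
registers `r₁` may differ from `r` in temporaries, since the dispatcher has already run. -/
theorem wp_simInstr {P : Program} {c : Config} {kN kO : Code} {I : Instr}
    (hR : SimReady P x S V p c r) (hI : P[c.pc]? = some I) (hr₁ : ∀ i, ¬ IsTemp i → r₁ i = r i)
    (hN : ∀ r', outputOf P c = none → Agree V p r r' → Holds V p (step P x c) r' →
      kN.wp x S Q r' o)
    (hO : ∀ r' w, outputOf P c = some w → Agree V p r r' → Holds V p (step P x c) r' →
      w.length = r' 10 - r' 9 → Stored r' (r' 9) w → p + 4 ≤ r' 9 → 1 ≤ r' 10 → r' 10 < S →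
      kO.wp x S Q r' o) :
    (Code.simInstr kN kO c.pc I).wp x S Q r₁ o := by
  have hstep : step P x c = ⟨I.nextPc c.reg c.pc, I.nextReg x c.reg, max c.top (I.accessed c.reg),
      c.time + 1, c.out ++ (I.emitted c.reg).map fun z => (z, c.time + 1)⟩ := by
    simp [step, hI]
  have hpcI : I.nextPc c.reg c.pc ≤ S := (nextPc_le_pcBound hI _).trans hR.bound
  have hacc := hR.accessed I hI
  have hnext := hR.next_le
  rw [hstep] at hN hO hnext
  simp only [Holds] at hN hO
  have hreg := hR.reg_le
  have hrow := hR.row_le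
  have hrow' := hR.le_row
  have hp : r 15 = p := hR.row
  have hp₁ : r₁ 15 = p := by rw [hr₁ 15 (by unfold IsTemp; omega), hp]
  have ho₁ : r₁ 1 = 1 := by rw [hr₁ 1 (by unfold IsTemp; omega), hR.one]
  have hH : ∀ d < V, r₁ (p + 4 + d) = c.reg d := fun d hd => by
    rw [hr₁ _ (by unfold IsTemp; omega), hR.holds.2 d hd]
  have hf := hR.holds.2
  have hout : outputOf P c = (I.emitted c.reg).head? := by simp [outputOf, hI]
  rw [hout] at hN hO
  cases I with
  | const d v =>
    simp only [Instr.accessed, Instr.nextPc, Instr.nextReg, Instr.emitted] at *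
    have := hnext d
    rw [Function.update_self] at this
    refine wp_op_temp (u := 20) trivial rfl rfl (by simp [Instr.accessed]; omega)
      (by simp [Instr.written]; omega) ?_
    refine wp_write_setPc (V := V) (r := r) (f := c.reg) ?_ hrow' (by omega) (by omega) ?_ hpcI
      (update_temp (isTemp_of (by simp)) hr₁) hf fun r' h1 h2 => hN r' rfl h1 ?_
    · simpa using hp₁
    · simp [Instr.written]; omega
    · simpa [Instr.written] using h2
  | copy d s =>
    simp only [Instr.accessed, Instr.nextPc, Instr.nextReg, Instr.emitted] at *
    have h3 := hreg s
    have h4 := hH s (by omega)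
    refine wp_read hp₁ hrow' (by omega) (by omega) (by omega) (by omega) ?_
    refine wp_write_setPc (V := V) (r := r) (f := c.reg) ?_ hrow' (by omega) (by omega) ?_ hpcI
      (update_temp (isTemp_of (by simp)) hr₁) hf fun r' h1 h2 => hN r' rfl h1 ?_
    · simpa using hp₁
    · simp; omega
    · simpa [h4] using h2
  | load d s =>
    simp only [Instr.accessed, Instr.nextPc, Instr.nextReg, Instr.emitted] at *
    have h3 := hreg s
    have h4 := hH s (by omega)
    have h5 := hH (c.reg s) (by omega)
    have h6 := hreg (c.reg s)
    refine wp_read hp₁ hrow' (by omega) (by omega) (by omega) (by omega) ?_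
    refine wp_locate (p := p) (by simpa using hp₁) hrow' (by omega) (by omega) (by omega)
      (by simp; omega) ?_
    have h7 : ∀ u, Function.update (Function.update (Function.update r₁ 20 (r₁ (p + 4 + s))) 19 4)
      20 u (p + 4 + c.reg s) = c.reg (c.reg s) := fun u => by
        rw [Function.update_of_ne (by omega), Function.update_of_ne (by omega),
          Function.update_of_ne (by omega), h5]
    refine wp_op_temp (u := 20) trivial rfl rfl ?_ ?_ ?_
    · simp [Instr.accessed, h4]; omega
    · simp [Instr.written, h4, -Function.update_idem] at h7 ⊢; rw [h7]; omega
    refine wp_write_setPc (V := V) (r := r) (f := c.reg) ?_ hrow' (by omega) (by omega) ?_ hpcI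
      (update_temp (isTemp_of (by simp)) (update_temp (isTemp_of (by simp))
        (update_temp (isTemp_of (by simp)) (update_temp (isTemp_of (by simp)) hr₁)))) hf
      fun r' h1 h2 => hN r' rfl h1 ?_
    · simpa using hp₁
    · simp [Instr.written, h4] at h7 ⊢; rw [h7]; omega
    · simp [Instr.written, h4] at h2 h7 ⊢; rw [h7] at h2; exact h2
  | store d s =>
    simp only [Instr.accessed, Instr.nextPc, Instr.nextReg, Instr.emitted] at *
    have h3 := hreg s
    have h4 := hH s (by omega)
    have h5 := hH d (by omega)
    have h6 := hreg d
    refine wp_read hp₁ hrow' (by omega) (by omega) (by omega) (by omega) ?_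
    refine wp_locate (p := p) (by simpa using hp₁) hrow' (by omega) (by omega) (by omega)
      (by simp; omega) ?_
    have h7 : ∀ u v w, Function.update (Function.update (Function.update r₁ 21 u) 19 v) 21 w
        (p + 4 + s) = c.reg s := fun u v w => by
      rw [Function.update_of_ne (by omega), Function.update_of_ne (by omega),
          Function.update_of_ne (by omega), h4]
    refine wp_read (p := p) (by simpa using hp₁) hrow' (by omega) (by omega) (by omega)
      (by rw [h7]; omega) ?_
    rw [h7, Function.update_self, h5]
    refine ⟨trivial, ?_, ?_, ?_⟩
    · simp [Instr.accessed]; omega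
    · simp [Instr.written]; omega
    simp only [Instr.nextReg, Instr.emitted, List.append_nil]
    rw [Function.update_of_ne (show 21 ≠ 20 by decide), Function.update_self, Function.update_self]
    refine wp_setPc (p := p) ?_ hrow' (by omega) hpcI (hN _ rfl ?_ ⟨?_, ?_⟩)
    · rw [Function.update_of_ne (by omega)]; simpa using hp₁
    · intro i h1 h2 h3
      have h8 : i ≠ 19 ∧ i ≠ 20 ∧ i ≠ 21 := by unfold IsTemp at h1; omega
      rw [Function.update_of_ne h2, Function.update_of_ne h8.2.1, Function.update_of_ne (by omega),
        Function.update_of_ne h8.2.1, Function.update_of_ne h8.2.2, Function.update_of_ne h8.1,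
        Function.update_of_ne h8.2.2, hr₁ i h1]
    · simp
    · intro e he
      rw [Function.update_of_ne (by omega), Function.update_of_ne (by omega), Function.update_apply]
      by_cases hed : e = c.reg d
      · simp [hed]
      · rw [if_neg (by omega), Function.update_of_ne hed, Function.update_of_ne (by omega),
          Function.update_of_ne (by omega), Function.update_of_ne (by omega),
          Function.update_of_ne (by omega), hH e he]
  | inputLength d =>
    simp only [Instr.accessed, Instr.nextPc, Instr.nextReg, Instr.emitted] at *
    have := hnext d
    rw [Function.update_self] at this
    refine wp_op_temp (u := 20) trivial rfl rfl (by simp [Instr.accessed]; omega)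
      (by simp [Instr.written]; omega) ?_
    refine wp_write_setPc (V := V) (r := r) (f := c.reg) ?_ hrow' (by omega) (by omega) ?_ hpcI
      (update_temp (isTemp_of (by simp)) hr₁) hf fun r' h1 h2 => hN r' rfl h1 ?_
    · simpa using hp₁
    · simp [Instr.written]; omega
    · simpa [Instr.written] using h2
  | input d s =>
    simp only [Instr.accessed, Instr.nextPc, Instr.nextReg, Instr.emitted] at *
    have h3 := hreg s
    have h4 := hH s (by omega)
    have := hnext d
    rw [Function.update_self] at this
    refine wp_read hp₁ hrow' (by omega) (by omega) (by omega) (by omega) ?_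
    rw [h4]
    refine wp_op_temp (u := 20) trivial rfl rfl (by simp [Instr.accessed]; omega)
      (by simpa [Instr.written] using this.trans (by omega)) ?_
    refine wp_write_setPc (V := V) (r := r) (f := c.reg) ?_ hrow' (by omega) (by omega) ?_ hpcI
      (update_temp (isTemp_of (by simp)) (update_temp (isTemp_of (by simp)) hr₁)) hf
      fun r' h1 h2 => hN r' rfl h1 ?_
    · simpa using hp₁
    · simpa [Instr.written] using this.trans (by omega)
    · simpa [Instr.written] using h2
  | add d s t =>
    simp only [Instr.accessed, Instr.nextPc, Instr.nextReg, Instr.emitted] at *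
    have h3 := hreg s
    have h4 := hH s (by omega)
    have h5 := hreg t
    have h6 := hH t (by omega)
    have h7 : ∀ u, Function.update r₁ 20 u (p + 4 + t) = c.reg t := fun u => by
      rw [Function.update_of_ne (by omega), h6]
    have := hnext d
    rw [Function.update_self] at this
    refine wp_read hp₁ hrow' (by omega) (by omega) (by omega) (by omega) ?_
    refine wp_read (p := p) (by simpa using hp₁) hrow' (by omega) (by omega) (by omega)
      (by rw [h7]; omega) ?_
    rw [h4, h7]
    refine wp_op_temp (u := 20) trivial rfl rfl (by simp [Instr.accessed]; omega)
      (by simpa [Instr.written] using this.trans (by omega)) ?_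
    refine wp_write_setPc (V := V) (r := r) (f := c.reg) ?_ hrow' (by omega) (by omega) ?_ hpcI
      (update_temp (isTemp_of (by simp)) (update_temp (isTemp_of (by simp))
        (update_temp (isTemp_of (by simp)) hr₁))) hf
      fun r' h1 h2 => hN r' rfl h1 ?_
    · simpa using hp₁
    · simpa [Instr.written] using this.trans (by omega)
    · simpa [Instr.written] using h2
  | sub d s t =>
    simp only [Instr.accessed, Instr.nextPc, Instr.nextReg, Instr.emitted] at *
    have h3 := hreg s
    have h4 := hH s (by omega)
    have h5 := hreg t
    have h6 := hH t (by omega)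
    have h7 : ∀ u, Function.update r₁ 20 u (p + 4 + t) = c.reg t := fun u => by
      rw [Function.update_of_ne (by omega), h6]
    have := hnext d
    rw [Function.update_self] at this
    have := this.trans (show V ≤ S by omega)
    refine wp_read hp₁ hrow' (by omega) (by omega) (by omega) (by omega) ?_
    refine wp_read (p := p) (by simpa using hp₁) hrow' (by omega) (by omega) (by omega)
      (by rw [h7]; omega) ?_
    rw [h4, h7]
    refine wp_op_temp (u := 20) trivial rfl rfl (by simp [Instr.accessed]; omega)
      (by simp [Instr.written]; omega) ?_
    refine wp_write_setPc (V := V) (r := r) (f := c.reg) ?_ hrow' (by omega) (by omega) ?_ hpcI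
      (update_temp (isTemp_of (by simp)) (update_temp (isTemp_of (by simp))
        (update_temp (isTemp_of (by simp)) hr₁))) hf
      fun r' h1 h2 => hN r' rfl h1 ?_
    · simpa using hp₁
    · simp [Instr.written]; omega
    · simpa [Instr.written] using h2
  | mul d s t =>
    simp only [Instr.accessed, Instr.nextPc, Instr.nextReg, Instr.emitted] at *
    have h3 := hreg s
    have h4 := hH s (by omega)
    have h5 := hreg t
    have h6 := hH t (by omega)
    have h7 : ∀ u, Function.update r₁ 20 u (p + 4 + t) = c.reg t := fun u => by
      rw [Function.update_of_ne (by omega), h6]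
    have := hnext d
    rw [Function.update_self] at this
    refine wp_read hp₁ hrow' (by omega) (by omega) (by omega) (by omega) ?_
    refine wp_read (p := p) (by simpa using hp₁) hrow' (by omega) (by omega) (by omega)
      (by rw [h7]; omega) ?_
    rw [h4, h7]
    refine wp_op_temp (u := 20) trivial rfl rfl (by simp [Instr.accessed]; omega)
      (by simpa [Instr.written] using this.trans (by omega)) ?_
    refine wp_write_setPc (V := V) (r := r) (f := c.reg) ?_ hrow' (by omega) (by omega) ?_ hpcI
      (update_temp (isTemp_of (by simp)) (update_temp (isTemp_of (by simp))
        (update_temp (isTemp_of (by simp)) hr₁))) hf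
      fun r' h1 h2 => hN r' rfl h1 ?_
    · simpa using hp₁
    · simpa [Instr.written] using this.trans (by omega)
    · simpa [Instr.written] using h2
  | jump l =>
    simp only [Instr.accessed, Instr.nextPc, Instr.nextReg, Instr.emitted] at *
    exact wp_jump (V := V) hp₁ hrow' (by omega) hpcI hr₁ hf fun r' h1 _ _ h2 => hN r' rfl h1 h2
  | jumpLt s t l =>
    simp only [Instr.accessed, Instr.nextPc, Instr.nextReg, Instr.emitted] at *
    have h3 := hreg s
    have h4 := hH s (by omega)
    have h5 := hreg t
    have h6 := hH t (by omega)
    have h7 : ∀ u, Function.update r₁ 20 u (p + 4 + t) = c.reg t := fun u => by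
      rw [Function.update_of_ne (by omega), h6]
    refine wp_read hp₁ hrow' (by omega) (by omega) (by omega) (by omega) ?_
    refine wp_read (p := p) (by simpa using hp₁) hrow' (by omega) (by omega) (by omega)
      (by rw [h7]; omega) ?_
    rw [h4, h7]
    have h8 := update_temp (u := 21) (v := c.reg t) (isTemp_of (by simp))
      (update_temp (u := 20) (v := c.reg s) (isTemp_of (by simp)) hr₁)
    refine ⟨by omega, by omega, fun hlt => ?_, fun hlt => ?_⟩
    · simp at hlt
      rw [if_pos hlt] at hpcI hN
      exact wp_jump (V := V) (by simpa using hp₁) hrow' (by omega) hpcI h8 hf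
        fun r' h1 _ _ h2 => hN r' rfl h1 h2
    · simp at hlt
      rw [if_neg (not_lt.mpr hlt)] at hpcI hN
      exact wp_jump (V := V) (by simpa using hp₁) hrow' (by omega) hpcI h8 hf
        fun r' h1 _ _ h2 => hN r' rfl h1 h2
  | jumpEq s t l =>
    simp only [Instr.accessed, Instr.nextPc, Instr.nextReg, Instr.emitted] at *
    have h3 := hreg s
    have h4 := hH s (by omega)
    have h5 := hreg t
    have h6 := hH t (by omega)
    have h7 : ∀ u, Function.update r₁ 20 u (p + 4 + t) = c.reg t := fun u => by
      rw [Function.update_of_ne (by omega), h6]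
    refine wp_read hp₁ hrow' (by omega) (by omega) (by omega) (by omega) ?_
    refine wp_read (p := p) (by simpa using hp₁) hrow' (by omega) (by omega) (by omega)
      (by rw [h7]; omega) ?_
    rw [h4, h7]
    have h8 := update_temp (u := 21) (v := c.reg t) (isTemp_of (by simp))
      (update_temp (u := 20) (v := c.reg s) (isTemp_of (by simp)) hr₁)
    refine ⟨by omega, by omega, fun hlt => ?_, fun hlt => ?_⟩
    · simp at hlt
      rw [if_pos hlt] at hpcI hN
      exact wp_jump (V := V) (by simpa using hp₁) hrow' (by omega) hpcI h8 hf
        fun r' h1 _ _ h2 => hN r' rfl h1 h2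
    · simp at hlt
      rw [if_neg hlt] at hpcI hN
      exact wp_jump (V := V) (by simpa using hp₁) hrow' (by omega) hpcI h8 hf
        fun r' h1 _ _ h2 => hN r' rfl h1 h2
  | output s t =>
    simp only [Instr.accessed, Instr.nextPc, Instr.nextReg, Instr.emitted] at *
    have h3 := hreg s
    have h4 := hH s (by omega)
    have h5 := hreg t
    have h6 := hH t (by omega)
    have h7 : ∀ u, Function.update r₁ 9 u (p + 4 + t) = c.reg t := fun u => by
      rw [Function.update_of_ne (by omega), h6]
    refine wp_read hp₁ hrow' (by omega) (by omega) (by omega) (by omega) ?_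
    refine wp_read (p := p) (by simpa using hp₁) hrow' (by omega) (by omega) (by omega)
      (by rw [h7]; omega) ?_
    rw [h4, h7]
    refine wp_locate (p := p) (by simpa using hp₁) hrow' (by omega) (by omega) (by omega)
      (by simp; omega) ?_
    refine wp_locate (p := p) (by simpa using hp₁) hrow' (by omega) (by omega) (by omega)
      (by simp; omega) ?_
    refine wp_op_temp (u := 10) trivial rfl rfl (by simp [Instr.accessed]; omega)
      (by simp [Instr.written, ho₁]; omega) ?_
    refine wp_jump (V := V) (r := r) (f := c.reg) (by simpa using hp₁) hrow' (by omega) hpcI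
      (update_temp (isTemp_of (by simp)) (update_temp (isTemp_of (by simp))
        (update_temp (isTemp_of (by simp)) (update_temp (isTemp_of (by simp))
        (update_temp (isTemp_of (by simp)) (update_temp (isTemp_of (by simp))
        (update_temp (isTemp_of (by simp)) hr₁))))))) hf
      fun r' h1 e9 e10 h2 => ?_
    simp [Instr.written, ho₁] at e9 e10
    refine hO r' _ rfl h1 h2 ?_ ?_ (by omega) (by omega) (by omega)
    · rw [e9, e10]; simp; omega
    · intro i hi
      simp at hi ⊢
      -- For an empty output interval `accessed` says nothing about its ends; the existence of the
      -- index `i` excludes this case.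
      rw [e9, add_assoc (p + 4), h2.2 _ (by split at hacc <;> omega)]

/-- The program counter is compared with the positions one after the other; the cost depends on the
program only. When the list is exhausted, the counter lies beyond the program, which is the
definition of having halted. -/
theorem wp_dispatch {P : Program} {c : Config} {kN kO kH : Code}
    (hR : SimReady P x S V p c r) (h22 : ∀ i, ¬ IsTemp i → r₁ i = r i) (hpc : r₁ 22 = c.pc)
    (hH : Halted P c → ∀ r', (∀ i, ¬ IsTemp i → r' i = r i) → kH.wp x S Q r' o)
    (hN : ∀ r', outputOf P c = none → ¬ Halted P c → Agree V p r r' → Holds V p (step P x c) r' →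
      kN.wp x S Q r' o)
    (hO : ∀ r' w, outputOf P c = some w → Agree V p r r' → Holds V p (step P x c) r' →
      w.length = r' 10 - r' 9 → Stored r' (r' 9) w → p + 4 ≤ r' 9 → 1 ≤ r' 10 → r' 10 < S →
      kO.wp x S Q r' o)
    (l : List Instr) (j : ℕ) (hl : P.drop j = l) (hj : j ≤ c.pc) :
    (Code.dispatch kN kO kH j l).wp x S Q r₁ o := by
  induction l generalizing j r₁ with
  | nil =>
    have : P.length ≤ j := List.drop_eq_nil_iff.mp hl
    exact hH (this.trans hj) _ h22
  | cons I l ih =>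
    have hI : P[j]? = some I := by
      rw [← Nat.add_zero j, ← List.getElem?_drop, hl]
      rfl
    have hrow := hR.row_le
    have hrow' := hR.le_row
    have hjS : j ≤ S := hj.trans (hR.pc_le.trans hR.bound)
    refine wp_op_temp (u := 19) trivial rfl rfl (by simp [Instr.accessed]; omega)
      (by simpa [Instr.written] using hjS) ?_
    have h1 := update_temp (u := 19) (v := Instr.written x r₁ (.const 19 j))
      (isTemp_of (by simp)) h22
    refine ⟨by omega, by omega, fun h => ?_, fun h => ?_⟩
    · simp [Instr.written] at h
      obtain rfl : c.pc = j := hpc.symm.trans h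
      exact wp_simInstr hR hI h1 (fun r' h2 => hN r' h2 (not_halted_of_getElem? hI)) hO
    · simp [Instr.written] at h
      refine ih h1 (by simpa using hpc) (j + 1) ?_ (by omega)
      rw [← List.drop_drop, hl]
      rfl

theorem wp_sim {P : Program} {c : Config} {kN kO kH : Code}
    (hR : SimReady P x S V p c r)
    (hH : Halted P c → ∀ r', (∀ i, ¬ IsTemp i → r' i = r i) → kH.wp x S Q r' o)
    (hN : ∀ r', outputOf P c = none → ¬ Halted P c → Agree V p r r' → Holds V p (step P x c) r' →
      kN.wp x S Q r' o)
    (hO : ∀ r' w, outputOf P c = some w → Agree V p r r' → Holds V p (step P x c) r' →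
      w.length = r' 10 - r' 9 → Stored r' (r' 9) w → p + 4 ≤ r' 9 → 1 ≤ r' 10 → r' 10 < S →
      kO.wp x S Q r' o) :
    (Code.sim P kN kO kH).wp x S Q r o := by
  have hrow := hR.row_le
  have hrow' := hR.le_row
  have hpc : r p = c.pc := hR.holds.1
  refine wp_op_temp (u := 22) trivial rfl rfl ?_ ?_ ?_
  · simp [Instr.accessed, hR.row]; omega
  · have := hR.pc_le.trans hR.bound
    simpa [Instr.written, hR.row, hpc] using this
  · exact wp_dispatch hR (update_temp (isTemp_of (by simp)) fun _ _ => rfl)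
      (by simp [Instr.written, hR.row, hpc]) hH hN hO P 0 rfl (Nat.zero_le _)

end Sim

/-! ## Density of the outputs of a flashlight search -/

section Flashlight

variable {σ : ℕ} {P : Program} {x : Word σ} {S : Set (Word σ)}

/-- The number of outputs during the given steps. -/
def countOutputs (P : Program) (x : Word σ) (F : Finset ℕ) : ℕ := #{u ∈ F | (emits P x u).isSome}

theorem countOutputs_mono {F G : Finset ℕ} (h : F ⊆ G) : countOutputs P x F ≤ countOutputs P x G :=
  Finset.card_le_card (Finset.filter_subset_filter _ h)

theorem countOutputs_biUnion {ι : Type*} [DecidableEq ι] {s : Finset ι} {F : ι → Finset ℕ}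
    (h : ∀ b b', b ≠ b' → Disjoint (F b) (F b')) :
    countOutputs P x (s.biUnion F) = ∑ b ∈ s, countOutputs P x (F b) := by
  unfold countOutputs
  rw [Finset.filter_biUnion, Finset.card_biUnion]
  intro b _ b' _ hb
  exact Finset.disjoint_filter_filter (h b b' hb)

theorem one_le_countOutputs {s e : ℕ} (h : (outputsBetween (run P x) s e).Nonempty) :
    1 ≤ countOutputs P x (Ico s e) := by
  obtain ⟨z, hz⟩ := h
  have h1 : (run P x s).words.length < (run P x e).words.length := by
    by_contra hc
    simp only [outputsBetween, Set.mem_ofPred_eq] at hz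
    rw [List.drop_eq_nil_of_le (not_lt.mp hc)] at hz
    cases hz
  rw [length_words_run, length_words_run] at h1
  have h2 : range e ⊆ range s ∪ Ico s e := by
    intro u hu
    simp only [mem_union, Finset.mem_range, mem_Ico] at *
    omega
  have h3 : countOutputs P x (range e) ≤ countOutputs P x (range s) + countOutputs P x (Ico s e) := by
    refine (countOutputs_mono h2).trans ?_
    unfold countOutputs
    rw [Finset.filter_union]
    exact Finset.card_union_le _ _
  unfold countOutputs at *
  omega

/-! ### Time and outputs in the subtrees of a search -/

namespace SearchTree

/-- A solution y extending `v` selects a child at every inner vertex, namely the one fixing position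
i to `y[i]?`; following these children leads to a leaf. -/
theorem one_le_numLeaves {T : SearchTree σ} {v : PartialSolution σ}
    (h : T.IsTraversal (run P x) S v) (hne : (extensions S v).Nonempty) : 1 ≤ T.numLeaves := by
  induction T generalizing v with
  | pruned => exact absurd (show extensions S v = ∅ from h) hne.ne_empty
  | leaf s e => exact le_rfl
  | node s e i child ih =>
    obtain ⟨_, _, _, hchild, _⟩ := h
    obtain ⟨y, hyS, hy⟩ := hne
    have h1 : (extensions S (Function.update v i (some (y[i]?)))).Nonempty := by
      refine ⟨y, hyS, fun j b hj => ?_⟩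
      rcases eq_or_ne j i with rfl | hji
      · rw [Function.update_self] at hj
        exact Option.some.inj hj
      · rw [Function.update_of_ne hji] at hj
        exact hy j b hj
    exact (ih _ (hchild _) h1).trans
      (Finset.single_le_sum (f := fun b => (child b).numLeaves) (fun _ _ => Nat.zero_le _)
        (Finset.mem_univ _))

theorem numLeaves_le_countOutputs {T : SearchTree σ} {v : PartialSolution σ}
    (h : T.IsTraversal (run P x) S v) : T.numLeaves ≤ countOutputs P x T.steps := by
  induction T generalizing v with
  | pruned => exact Nat.zero_le _
  | leaf s e =>
    obtain ⟨⟨y, hy⟩, hout⟩ := h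
    refine one_le_countOutputs ?_
    rw [hout, hy]
    exact (Set.singleton_nonempty _).image _
  | node s e i child ih =>
    obtain ⟨_, _, _, hchild, hsub, hdisj⟩ := h
    calc ∑ b, (child b).numLeaves ≤ ∑ b, countOutputs P x (child b).steps :=
          Finset.sum_le_sum fun b _ => ih b (hchild b)
      _ = countOutputs P x (univ.biUnion fun b => (child b).steps) :=
          (countOutputs_biUnion hdisj).symm
      _ ≤ _ := countOutputs_mono (Finset.biUnion_subset.mpr fun b _ => hsub b)

theorem card_steps_le {T : SearchTree σ} {d : ℕ} (h : T.AverageDelayLE d) :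
    #T.steps ≤ d * T.numLeaves := by
  cases T with
  | pruned => simp [steps]
  | leaf s e =>
    rw [steps, numLeaves, mul_one]
    exact h
  | node s e i child => exact h.1

theorem pathTime_child_le {s e i : ℕ} {child : Option (Fin σ) → SearchTree σ} (b : Option (Fin σ)) :
    (child b).pathTime ≤ (node s e i child).pathTime :=
  (Finset.le_sup (f := fun b => (child b).pathTime) (Finset.mem_univ b)).trans
    (Nat.le_add_left _ _)

/-- Charge each step spent at a vertex to all leaves below it. There is at least one such leaf, and
no leaf is charged more than the path time. -/
theorem card_steps_le_pathTime {T : SearchTree σ} {v : PartialSolution σ}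
    (h : T.IsTraversal (run P x) S v) : #T.steps ≤ T.pathTime * T.numLeaves := by
  induction T generalizing v with
  | pruned => simp [steps]
  | leaf s e => simp [steps, pathTime, numLeaves]
  | node s e i child ih =>
    have h1 := one_le_numLeaves h h.1
    obtain ⟨_, _, _, hchild, hsub, hdisj⟩ := h
    set own := #(Ico s e \ univ.biUnion fun b => (child b).steps) with hown
    have h2 : #(Ico s e) ≤ own + ∑ b, #(child b).steps := by
      rw [hown]
      have h3 : univ.biUnion (fun b => (child b).steps) ⊆ Ico s e :=
        Finset.biUnion_subset.mpr fun b _ => hsub b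
      have := Finset.card_sdiff_add_card_eq_card h3
      have := Finset.card_biUnion_le (s := univ) (t := fun b => (child b).steps)
      omega
    have h4 : ∑ b, #(child b).steps ≤
        (univ.sup fun b => (child b).pathTime) * ∑ b, (child b).numLeaves := by
      rw [Finset.mul_sum]
      refine Finset.sum_le_sum fun b _ => (ih b (hchild b)).trans (Nat.mul_le_mul_right _ ?_)
      exact Finset.le_sup (f := fun b => (child b).pathTime) (Finset.mem_univ b)
    calc #(Ico s e) ≤ own + ∑ b, #(child b).steps := h2
      _ ≤ own * (node s e i child).numLeaves + _ :=
          Nat.add_le_add (Nat.le_mul_of_pos_right _ h1) h4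
      _ = _ := by rw [pathTime, ← hown, add_mul]; rfl

/-- The path time is polynomial while the given average delay need not be; with the minimum, the
budget of the scheduler fits into a register. -/
theorem averageDelayLE_min {T : SearchTree σ} {v : PartialSolution σ} {d m : ℕ}
    (h : T.IsTraversal (run P x) S v) (hd : T.AverageDelayLE d) (hm : T.pathTime ≤ m) :
    T.AverageDelayLE (min d m) := by
  induction T generalizing v with
  | pruned => trivial
  | leaf s e => exact le_min hd hm
  | node s e i child ih =>
    refine ⟨?_, fun b => ih b (h.2.2.2.1 b) (hd.2 b) ((pathTime_child_le b).trans hm)⟩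
    rcases min_choice d m with he | he <;> rw [he]
    · exact hd.1
    · exact (card_steps_le_pathTime h).trans (Nat.mul_le_mul_right _ hm)

theorem steps_eq (T : SearchTree σ) : ∃ s e, T.steps = Ico s e := by
  cases T with
  | pruned => exact ⟨0, 0, by simp [steps]⟩
  | leaf s e => exact ⟨s, e, rfl⟩
  | node s e i child => exact ⟨s, e, rfl⟩

/-- At time `t` at most one child of each vertex is unfinished. Finished children are paid for by
their outputs, the unfinished one is handled recursively, and the steps outside the children add up
along a single path. -/
theorem card_filter_steps_le {T : SearchTree σ} {v : PartialSolution σ} {d : ℕ}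
    (h : T.IsTraversal (run P x) S v) (hd : T.AverageDelayLE d) (t : ℕ) :
    #{u ∈ T.steps | u < t} ≤ T.pathTime + d * countOutputs P x {u ∈ T.steps | u < t} := by
  induction T generalizing v with
  | pruned => simp [steps]
  | leaf s e =>
    refine (Finset.card_filter_le _ _).trans ?_
    simp [steps, pathTime]
  | node s e i child ih =>
    obtain ⟨_, _, _, hchild, hsub, hdisj⟩ := h
    have hsub' : univ.biUnion (fun b => (child b).steps) ⊆ Ico s e :=
      Finset.biUnion_subset.mpr fun b _ => hsub b
    set F : Option (Fin σ) → Finset ℕ := fun b => {u ∈ (child b).steps | u < t} with hF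
    have h1 : #{u ∈ Ico s e | u < t} ≤
        #(Ico s e \ univ.biUnion fun b => (child b).steps) + ∑ b, #(F b) := by
      refine le_trans (Finset.card_le_card (t := (Ico s e \ univ.biUnion fun b => (child b).steps) ∪
        univ.biUnion F) ?_) ((Finset.card_union_le _ _).trans
          (Nat.add_le_add_left Finset.card_biUnion_le _))
      intro u hu
      simp only [hF, mem_union, mem_sdiff, mem_biUnion, mem_filter, Finset.mem_univ, true_and] at *
      by_cases hc : ∃ b, u ∈ (child b).steps
      · exact Or.inr (hc.imp fun b hb => ⟨hb, hu.2⟩)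
      · exact Or.inl ⟨hu.1, hc⟩
    have h2 : ∑ b, countOutputs P x (F b) ≤ countOutputs P x {u ∈ Ico s e | u < t} := by
      rw [← countOutputs_biUnion fun b b' hb => Finset.disjoint_filter_filter (hdisj b b' hb)]
      refine countOutputs_mono fun u hu => ?_
      simp only [mem_biUnion, mem_filter, Finset.mem_univ, true_and] at hu ⊢
      obtain ⟨b, hb, hut⟩ := hu
      exact ⟨hsub b hb, hut⟩
    have h3 : ∀ b, t ∉ (child b).steps → #(F b) ≤ d * countOutputs P x (F b) := by
      intro b hb
      obtain ⟨s', e', hse⟩ := (child b).steps_eq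
      -- The steps of a child form an interval. If it does not contain `t`, it lies completely
      -- before `t` or contributes nothing.
      by_cases hall : ∀ u ∈ (child b).steps, u < t
      · have : F b = (child b).steps := Finset.filter_true_of_mem hall
        rw [this]
        exact (card_steps_le (hd.2 b)).trans
          (Nat.mul_le_mul_left _ (numLeaves_le_countOutputs (hchild b)))
      · have : F b = ∅ := by
          refine Finset.filter_false_of_mem fun u hu hut => hall fun w hw => ?_
          rw [hse, mem_Ico] at hb hu hw
          omega
        simp [this]
    have h4 : ∑ b, #(F b) ≤ (univ.sup fun b => (child b).pathTime) +
        d * ∑ b, countOutputs P x (F b) := by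
      -- By disjointness at most one child contains `t`; only this one costs path time.
      by_cases hex : ∃ b, t ∈ (child b).steps
      · obtain ⟨b₀, hb₀⟩ := hex
        have h5 : ∀ b ∈ univ.erase b₀, #(F b) ≤ d * countOutputs P x (F b) := fun b hb =>
          h3 b fun hc => Finset.disjoint_left.mp (hdisj b b₀ (Finset.ne_of_mem_erase hb)) hc hb₀
        have h6 := ih b₀ (hchild b₀) (hd.2 b₀)
        have h7 : (child b₀).pathTime ≤ univ.sup fun b => (child b).pathTime :=
          Finset.le_sup (f := fun b => (child b).pathTime) (Finset.mem_univ b₀)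
        have h8 := Finset.sum_le_sum h5
        rw [← Finset.add_sum_erase univ (fun b => #(F b)) (Finset.mem_univ b₀), Finset.mul_sum,
          ← Finset.add_sum_erase univ (fun b => d * countOutputs P x (F b)) (Finset.mem_univ b₀)]
        change #(F b₀) ≤ _ + d * countOutputs P x (F b₀) at h6
        omega
      · rw [Finset.mul_sum]
        exact (Finset.sum_le_sum fun b _ => h3 b fun hc => hex ⟨b, hc⟩).trans (Nat.le_add_left _ _)
    calc #{u ∈ Ico s e | u < t} ≤ _ := h1
      _ ≤ _ := Nat.add_le_add_left h4 _
      _ ≤ _ := by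
        rw [pathTime, ← add_assoc]
        exact Nat.add_le_add_left (Nat.mul_le_mul_left _ h2) _

end SearchTree

/-- What the analysis uses about a flashlight search with at least one solution. -/
theorem SolvesByFlashlight.density {A : EnumProblem σ} {p : Polynomial ℕ} {d : Word σ → ℕ}
    (hM : SolvesByFlashlight P A p d) (x : Word σ) {V : ℕ} (hV : p.eval x.length ≤ V) :
    ∃ h, Halted P (run P x h) ∧ (∀ t < h, ¬ Halted P (run P x t)) ∧ (A x = ∅ → h ≤ V) ∧
      ((A x).Nonempty → h ≤ min (d x) V * countOutputs P x (range h) ∧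
        ∀ t ≤ h, t ≤ V + min (d x) V * countOutputs P x (range t)) := by
  obtain ⟨h, hh, hlt, hempty, hne⟩ := hM.2 x
  refine ⟨h, hh, hlt, fun he => (hempty he).trans hV, fun hA => ?_⟩
  obtain ⟨T, hsteps, htr, hpath, havg⟩ := hne hA
  have havg' := SearchTree.averageDelayLE_min htr havg (hpath.trans hV)
  have hst : T.steps = range h := by rw [hsteps, Finset.range_eq_Ico]
  constructor
  · have h1 := (SearchTree.card_steps_le havg').trans
      (Nat.mul_le_mul_left _ (SearchTree.numLeaves_le_countOutputs htr))
    rwa [hst, Finset.card_range] at h1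
  · intro t ht
    have h1 := SearchTree.card_filter_steps_le htr havg' t
    have h2 : {u ∈ T.steps | u < t} = range t := by
      ext u
      rw [hst]
      simp only [mem_filter, Finset.mem_range]
      omega
    rw [h2, Finset.card_range] at h1
    omega

theorem encode_injective : Function.Injective (encode : Word σ → List ℕ) :=
  List.map_injective_iff.mpr Fin.val_injective

theorem Solves.ncard_eq {A : EnumProblem σ} (hM : Solves P A) (x : Word σ) {h : ℕ}
    (hh : Halted P (run P x h)) :
    (run P x h).words.Nodup ∧ {z | z ∈ (run P x h).words} = encode '' A x ∧
      (A x).ncard = countOutputs P x (range h) := by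
  obtain ⟨c, hc, hnd, heq⟩ := hM x
  obtain rfl := hc.unique ⟨h, rfl, hh⟩
  refine ⟨hnd, heq, ?_⟩
  rw [← Set.ncard_image_of_injective _ encode_injective, ← heq]
  unfold countOutputs
  rw [← length_words_run, ← List.toFinset_card_of_nodup hnd, ← Set.ncard_coe_finset]
  congr 1
  ext z
  simp

end Flashlight

/-! ## The abstract scheduler

A process runs the given machine, together with a counter: `t` is the number of steps done, `cnt`
is `t` modulo `b`, and the binary counter `bits`, with `len` significant bits, contains `t / b`.
If `carry = c + 1`, then the addition of `2 ^ c` to the counter is still to be done. The zone of the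
process `z` consists of the steps from `2 ^ z * b` to `2 ^ (z + 1) * b`. -/

/-- A process; `prog` counts the ticks that it has used. -/
structure Proc where
  t : ℕ
  cnt : ℕ
  carry : ℕ
  len : ℕ
  bits : ℕ → ℕ
  prog : ℕ

namespace Proc

/-- A process that has not started yet. -/
def init : Proc := ⟨0, 0, 0, 0, fun _ => 0, 0⟩

/-- The process `z` has completed its zone or its computation. -/
def Fin (h z : ℕ) (P : Proc) : Prop := z + 2 ≤ P.len ∨ (P.carry = 0 ∧ h ≤ P.t)

/-- One tick of a process. -/
def adv (b : ℕ) (P : Proc) : Proc :=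
  if P.carry = 0 then
    if P.cnt + 1 = b then ⟨P.t + 1, 0, 1, P.len, P.bits, P.prog + 1⟩
    else ⟨P.t + 1, P.cnt + 1, 0, P.len, P.bits, P.prog + 1⟩
  else if P.carry = P.len + 1 then
    ⟨P.t, P.cnt, 0, P.len + 1, Function.update P.bits P.len 1, P.prog + 1⟩
  else if P.bits (P.carry - 1) = 1 then
    ⟨P.t, P.cnt, P.carry + 1, P.len, Function.update P.bits (P.carry - 1) 0, P.prog + 1⟩
  else ⟨P.t, P.cnt, 0, P.len, Function.update P.bits (P.carry - 1) 1, P.prog + 1⟩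

/-- The value of the binary counter, including the pending addition. -/
def val (P : Proc) : ℕ :=
  ∑ i ∈ range P.len, P.bits i * 2 ^ i + if P.carry = 0 then 0 else 2 ^ (P.carry - 1)

/-- Invariants of the process `z`. -/
structure Inv (b h z : ℕ) (P : Proc) : Prop where
  cnt_lt : P.cnt < b
  t_eq : P.t = b * P.val + P.cnt
  bits_le : ∀ i, P.bits i ≤ 1
  carry_le : P.carry ≤ P.len + 1
  t_le : P.t ≤ h
  top_bit : P.carry ≤ P.len → P.len ≠ 0 → P.bits (P.len - 1) = 1
  low_bits : ∀ i, i + 1 < P.carry → P.bits i = 0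
  -- Amortized analysis of the binary counter. The potential is the number of ones, plus 2 for a
  -- pending carry. Clearing a one pays for its own tick; the potential 2 of the carry pays for the
  -- last tick and for the new one.
  prog_le : P.prog + ∑ i ∈ range P.len, P.bits i + (if P.carry = 0 then 0 else 2) ≤ P.t + 2 * P.val
  len_le : P.len ≤ z + 2
  of_carry : P.carry ≠ 0 → P.len ≤ z + 1 ∧ P.cnt = 0
  -- The length grows exactly when the counter reaches a power of two, and the process stops there:
  -- it has reached the end of its zone and not gone beyond.
  t_of_len : P.len = z + 2 → P.t = 2 ^ (z + 1) * b
  t_le_zone : P.t ≤ 2 ^ (z + 1) * b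

theorem sum_update_mul (f g : ℕ → ℕ) {n c : ℕ} (v : ℕ) (hc : c < n) :
    ∑ i ∈ range n, Function.update f c v i * g i + f c * g c =
      ∑ i ∈ range n, f i * g i + v * g c := by
  have hc' : c ∈ range n := Finset.mem_range.mpr hc
  rw [← Finset.add_sum_erase _ _ hc', ← Finset.add_sum_erase (range n) (fun i => f i * g i) hc',
    Function.update_self]
  have : ∑ i ∈ (range n).erase c, Function.update f c v i * g i =
      ∑ i ∈ (range n).erase c, f i * g i :=
    Finset.sum_congr rfl fun i hi => by rw [Function.update_of_ne (Finset.ne_of_mem_erase hi)]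
  rw [this]
  ring

theorem sum_update (f : ℕ → ℕ) {n c : ℕ} (v : ℕ) (hc : c < n) :
    ∑ i ∈ range n, Function.update f c v i + f c = ∑ i ∈ range n, f i + v := by
  simpa using sum_update_mul f (fun _ => 1) v hc

theorem sum_update_of_le (f g : ℕ → ℕ) {n c : ℕ} (v : ℕ) (hc : n ≤ c) :
    ∑ i ∈ range n, Function.update f c v i * g i = ∑ i ∈ range n, f i * g i :=
  Finset.sum_congr rfl fun i hi => by
    rw [Function.update_of_ne]
    have := Finset.mem_range.mp hi
    omega

theorem sum_bits_lt {f : ℕ → ℕ} (hf : ∀ i, f i ≤ 1) (n : ℕ) :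
    ∑ i ∈ range n, f i * 2 ^ i < 2 ^ n := by
  induction n with
  | zero => simp
  | succ n ih =>
    rw [Finset.sum_range_succ, pow_succ]
    have := Nat.mul_le_mul_right (2 ^ n) (hf n)
    omega

theorem Inv.init {b h z : ℕ} (hb : 0 < b) : Inv b h z Proc.init :=
  ⟨hb, by simp [Proc.init, val], fun _ => Nat.zero_le _, by simp [Proc.init], Nat.zero_le _,
    fun _ h => (h rfl).elim, fun _ _ => rfl, by simp [Proc.init], by simp [Proc.init],
    fun h => (h rfl).elim, fun h => by simp [Proc.init] at h, Nat.zero_le _⟩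

section

variable {b h z : ℕ} {P : Proc}

/-- From the potential bound, since the value of the counter is at most the step number. -/
theorem Inv.prog_le_three_mul (hP : Inv b h z P) : P.prog ≤ 3 * P.t := by
  have h1 := hP.prog_le
  have h2 := hP.cnt_lt
  have h3 : P.val ≤ b * P.val := Nat.le_mul_of_pos_left _ (by omega)
  have h4 := hP.t_eq
  omega

/-- Together with `Inv.le_t` this shows that, when no carry is pending, the length of the counter
determines the zone. This is how the code recognizes zones without having the step number in a
register. -/
theorem Inv.t_lt (hP : Inv b h z P) (hc : P.carry = 0) : P.t < 2 ^ P.len * b := by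
  have h1 := hP.t_eq
  have h2 := sum_bits_lt hP.bits_le P.len
  have h3 : P.val < 2 ^ P.len := by simpa [val, hc] using h2
  have h4 : b * (P.val + 1) ≤ b * 2 ^ P.len := Nat.mul_le_mul_left b h3
  have h5 := hP.cnt_lt
  rw [mul_comm (2 ^ P.len)]
  rw [mul_add] at h4
  omega

theorem Inv.le_t (hP : Inv b h z P) {l : ℕ} (hl : l + 1 ≤ P.len) : 2 ^ l * b ≤ P.t := by
  have h1 : 2 ^ (P.len - 1) ≤ P.val := by
    unfold val
    rcases Nat.lt_or_ge P.len P.carry with hc | hc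
    · have h2 : P.carry = P.len + 1 := by have := hP.carry_le; omega
      have h3 : 2 ^ (P.len - 1) ≤ 2 ^ P.len := Nat.pow_le_pow_right (by norm_num) (by omega)
      simp only [h2, Nat.add_sub_cancel]
      simp
      omega
    · have h2 := hP.top_bit hc (by omega)
      have h3 := Finset.single_le_sum (f := fun i => P.bits i * 2 ^ i) (fun _ _ => Nat.zero_le _)
        (Finset.mem_range.mpr (show P.len - 1 < P.len by omega))
      simp only [h2, one_mul] at h3
      omega
  have h2 : 2 ^ l ≤ 2 ^ (P.len - 1) := Nat.pow_le_pow_right (by norm_num) (by omega)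
  have h3 := hP.t_eq
  have h4 : b * 2 ^ l ≤ b * P.val := Nat.mul_le_mul_left b (h2.trans h1)
  rw [mul_comm]
  omega

theorem Inv.adv (hP : Inv b h z P) (hfin : ¬ P.Fin h z) : Inv b h z (P.adv b) := by
  have hlen : P.len ≤ z + 1 := by
    by_contra hc
    exact hfin (Or.inl (by omega))
  unfold Proc.adv
  split_ifs with h1 h2 h3 h4
  -- A simulation step that completes a block of `b` steps: the value grows by one, as a pending
  -- addition of 2^0.
  · have h5 : P.t < h := by
      by_contra hc
      exact hfin (Or.inr ⟨h1, by omega⟩)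
    have h6 := hP.t_lt h1
    have h7 : 2 ^ P.len * b ≤ 2 ^ (z + 1) * b :=
      Nat.mul_le_mul_right b (Nat.pow_le_pow_right (by norm_num) hlen)
    have h8 := hP.t_eq
    have h9 := hP.prog_le
    simp only [val, h1, if_true] at h8 h9
    refine ⟨by have := hP.cnt_lt; simp only; omega, ?_, hP.bits_le, by simp, h5, fun _ => hP.top_bit (by omega),
      fun i hi => by simp at hi, ?_, hP.len_le, fun _ => ⟨hlen, rfl⟩, ?_, by simp only; omega⟩
    · simp [val, mul_add] at h8 ⊢; omega
    · simp [val] at h9 ⊢; omega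
    · simp only; omega
  -- A simulation step inside a block.
  · have h5 : P.t < h := by
      by_contra hc
      exact hfin (Or.inr ⟨h1, by omega⟩)
    have h6 := hP.t_lt h1
    have h7 : 2 ^ P.len * b ≤ 2 ^ (z + 1) * b :=
      Nat.mul_le_mul_right b (Nat.pow_le_pow_right (by norm_num) hlen)
    have h8 := hP.t_eq
    have h9 := hP.prog_le
    simp only [val, h1, if_true] at h8 h9
    refine ⟨by have := hP.cnt_lt; simp only; omega, ?_, hP.bits_le, by simp, h5, fun _ => hP.top_bit (by omega),
      fun i hi => by simp at hi, ?_, hP.len_le, fun h => (h rfl).elim, ?_, by simp only; omega⟩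
    · simp [val] at h8 ⊢; omega
    · simp [val] at h9 ⊢; omega
    · simp only; omega
  -- The carry creates a new top bit. All lower bits have been cleared, so the value is exactly
  -- 2^`len`, which gives `t_of_len`.
  · have h5 : ∑ i ∈ range P.len, P.bits i * 2 ^ i = 0 :=
      Finset.sum_eq_zero fun i hi => by
        rw [hP.low_bits i (by have := Finset.mem_range.mp hi; omega), zero_mul]
    have h6 : P.val = 2 ^ P.len := by simp [val, h5, h3]
    have h7 := hP.of_carry h1
    have h8 := hP.t_eq
    have h9 := hP.prog_le
    have h10 := sum_update_of_le P.bits (fun i => 2 ^ i) 1 le_rfl (n := P.len)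
    have h11 := sum_update_of_le P.bits (fun _ => 1) 1 le_rfl (n := P.len)
    simp only [mul_one] at h11
    simp only [h1, if_false] at h9
    have h12 : (⟨P.t, P.cnt, 0, P.len + 1, Function.update P.bits P.len 1, P.prog + 1⟩ : Proc).val =
        P.val := by
      simp [val, Finset.sum_range_succ, h10, h3]
    refine ⟨hP.cnt_lt, by rw [h12]; exact h8, fun i => ?_, Nat.zero_le _, hP.t_le, fun _ _ => by simp,
      fun i hi => by simp at hi, ?_, by simp only; omega, fun h => (h rfl).elim, fun h => ?_,
      hP.t_le_zone⟩
    · simp only [Function.update_apply]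
      split
      · exact le_rfl
      · exact hP.bits_le i
    · rw [h12]
      simp only [Finset.sum_range_succ, h11, Function.update_self, if_true]
      omega
    · simp only at h ⊢
      rw [h8, h6, h7.2, show P.len = z + 1 by omega]
      ring
  -- The carry meets a one: the bit is cleared and the carry moves up, leaving the value unchanged.
  · have hc : P.carry - 1 < P.len := by have := hP.carry_le; omega
    have h8 := hP.t_eq
    have h9 := hP.prog_le
    have h10 := sum_update_mul P.bits (fun i => 2 ^ i) 0 hc
    have h11 := sum_update P.bits 0 hc
    rw [h4] at h10 h11
    have h12 : (⟨P.t, P.cnt, P.carry + 1, P.len, Function.update P.bits (P.carry - 1) 0,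
        P.prog + 1⟩ : Proc).val = P.val := by
      have : 2 ^ P.carry = 2 * 2 ^ (P.carry - 1) := by
        rw [← pow_succ']
        congr 1
        omega
      simp [val, h1, this]
      simp at h10
      omega
    refine ⟨hP.cnt_lt, by rw [h12]; exact h8, fun i => ?_, by simp only; omega, hP.t_le, fun h5 h6 => ?_,
      fun i hi => ?_, ?_, hP.len_le, fun h => hP.of_carry h1, hP.t_of_len, hP.t_le_zone⟩
    · simp only [Function.update_apply]
      split
      · exact Nat.zero_le _
      · exact hP.bits_le i
    · simp only at h5 h6 ⊢
      rw [Function.update_of_ne (by omega)]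
      exact hP.top_bit (by omega) h6
    · simp only [Function.update_apply] at hi ⊢
      split
      · rfl
      · exact hP.low_bits i (by omega)
    · rw [h12]
      simp only [h1, if_false] at h9
      simp
      omega
  -- The carry meets a zero and is absorbed.
  · have hc : P.carry - 1 < P.len := by have := hP.carry_le; omega
    have hbit : P.bits (P.carry - 1) = 0 := by have := hP.bits_le (P.carry - 1); omega
    have h8 := hP.t_eq
    have h9 := hP.prog_le
    have h10 := sum_update_mul P.bits (fun i => 2 ^ i) 1 hc
    have h11 := sum_update P.bits 1 hc
    rw [hbit] at h10 h11
    have h12 : (⟨P.t, P.cnt, 0, P.len, Function.update P.bits (P.carry - 1) 1,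
        P.prog + 1⟩ : Proc).val = P.val := by
      simp [val, h1]
      simp at h10
      omega
    refine ⟨hP.cnt_lt, by rw [h12]; exact h8, fun i => ?_, by simp, hP.t_le, fun h5 h6 => ?_,
      fun i hi => by simp at hi, ?_, hP.len_le, fun h => (h rfl).elim, hP.t_of_len, hP.t_le_zone⟩
    · simp only [Function.update_apply]
      split
      · exact le_rfl
      · exact hP.bits_le i
    · simp only [Function.update_apply] at h5 h6 ⊢
      split
      · rfl
      · exact hP.top_bit (by omega) h6
    · rw [h12]
      simp only [h1, if_false] at h9
      simp
      omega

theorem prog_adv : (P.adv b).prog = P.prog + 1 := by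
  unfold Proc.adv
  split_ifs <;> rfl

theorem t_adv : (P.adv b).t = if P.carry = 0 then P.t + 1 else P.t := by
  unfold Proc.adv
  split_ifs <;> rfl

theorem len_adv : (P.adv b).len = if P.carry ≠ 0 ∧ P.carry = P.len + 1 then P.len + 1 else P.len := by
  unfold Proc.adv
  split_ifs <;> simp_all

end
end Proc

/-- State of the scheduler: the processes below `num` exist, `idx` is one more than the number of
the process whose turn it is, which may use `budget` more ticks. The stack contains the steps whose
outputs have been stored. -/
structure Main where
  D : ℕ
  idx : ℕ
  budget : ℕ
  num : ℕ
  procs : ℕ → Proc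
  stack : List ℕ

/-- One tick of the scheduler; the option contains the step whose output is output. -/
inductive MTick (b h : ℕ) (em : ℕ → Bool) : Main → Option ℕ → Main → Prop
  | pop (m : Main) (u : ℕ) (st : List ℕ) (hidx : m.idx = 0) (hst : m.stack = u :: st) :
      MTick b h em m (some u) ⟨m.D, m.num, m.D, m.num, m.procs, st⟩
  | move (m : Main) (i : ℕ) (hidx : m.idx = i + 1) (hb : m.budget = 0) :
      MTick b h em m none ⟨m.D, i, m.D, m.num, m.procs, m.stack⟩
  -- A finished process gives up its budget; the next tick is a `move`.
  | skip (m : Main) (i : ℕ) (hidx : m.idx = i + 1) (hb : m.budget ≠ 0) (hf : (m.procs i).Fin h i) :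
      MTick b h em m none ⟨m.D, m.idx, 0, m.num, m.procs, m.stack⟩
  -- Length i + 1 without pending carry means that the process is inside its zone. The output
  -- restarts the round at the last process.
  | out (m : Main) (i : ℕ) (hidx : m.idx = i + 1) (hb : m.budget ≠ 0) (hf : ¬ (m.procs i).Fin h i)
      (hc : (m.procs i).carry = 0) (he : em (m.procs i).t = true) (hl : (m.procs i).len = i + 1) :
      MTick b h em m (some (m.procs i).t) ⟨m.D, m.num, m.D, m.num,
        Function.update m.procs i ((m.procs i).adv b), m.stack⟩
  -- When the length changes from i to i + 1, process i has just reached step 2^i b. It enters its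
  -- zone, and process i + 1 is started.
  | micro (m : Main) (i : ℕ) (hidx : m.idx = i + 1) (hb : m.budget ≠ 0)
      (hf : ¬ (m.procs i).Fin h i)
      (hc : ¬ ((m.procs i).carry = 0 ∧ em (m.procs i).t = true ∧ (m.procs i).len = i + 1)) :
      MTick b h em m none ⟨m.D, m.idx, m.budget - 1,
        if (m.procs i).carry ≠ 0 ∧ (m.procs i).carry = (m.procs i).len + 1 ∧ (m.procs i).len = i
          then m.num + 1 else m.num,
        Function.update m.procs i ((m.procs i).adv b), m.stack⟩

/-- The number of steps below `B` in a list of steps and times. -/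
def countBelow (es : List (ℕ × ℕ)) (B : ℕ) : ℕ := es.countP fun y => y.1 < B

/-- The budget that the process `z` has got in the current round. -/
def Main.share (m : Main) (z : ℕ) : ℕ :=
  if m.idx ≤ z then m.D else if m.idx = z + 1 then m.D - m.budget else 0

/-- Invariants of the scheduler: `es` contains the steps whose outputs have been output, with the
times of these outputs, in reverse order; the scheduler was started at time `start`. -/
structure MInv (b h : ℕ) (em : ℕ → Bool) (start now : ℕ) (es : List (ℕ × ℕ)) (m : Main) : Prop where
  D_le : m.D ≤ b
  idx_le : m.idx ≤ m.num
  budget_le : m.budget ≤ m.D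
  budget_of_idx : m.idx = 0 → m.budget = m.D
  proc : ∀ z < m.num, (m.procs z).Inv b h z
  proc_init : ∀ z, m.num ≤ z → m.procs z = Proc.init
  len_of_lt : ∀ z, z + 1 < m.num → z + 1 ≤ (m.procs z).len
  len_top : ∀ z, z + 1 = m.num → (m.procs z).len ≤ z
  nodup : (es.map Prod.fst).Nodup
  nodup_stack : m.stack.Nodup
  stack_mem : ∀ u ∈ m.stack, u < b ∧ em u = true
  -- The part of zone z that is already output is exactly what process z has passed. Outputs met
  -- before the zone are suppressed, since they belong to lower processes or to the stack.
  mem : ∀ u, u ∈ es.map Prod.fst ↔ em u = true ∧ ((u < b ∧ u ∉ m.stack) ∨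
    ∃ z < m.num, 2 ^ z * b ≤ u ∧ u < (m.procs z).t)
  h_le : m.num = 0 → h ≤ b
  le_h : m.num ≠ 0 → b ≤ h
  -- The heart of the method: each output below zone z has given `D` ticks to process z. The term 4
  -- · 2^z b compensates for the outputs that precede the start of the process.
  progress : ∀ z < m.num, (m.procs z).Fin h z ∨
    m.D * countBelow es (2 ^ z * b) + m.share z ≤ (m.procs z).prog + 4 * (2 ^ z * b)
  -- The list is in reverse order, so `q` is the later time. The start of the scheduler counts as an
  -- output, so that the first output is bounded as well.
  sorted : (es.map Prod.snd ++ [start]).IsChain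
    fun q p => p ≤ q ∧ q ≤ p + (m.num + 1) * (m.D + 2)
  -- Within a round, `now` + `budget` does not grow at a `micro` or `skip` tick and grows by at most
  -- `D` + 1 at a `move`.
  age : ∀ q ∈ (es.map Prod.snd ++ [start]).head?, q ≤ now ∧
    now + m.budget ≤ q + (m.num - m.idx) * (m.D + 2) + m.D + 1
  -- Work is charged to `prog`, outputs to the length of `es`. The at most two idle ticks (`skip`,
  -- `move`) at process z in a round are charged to the output that ends the round; this output
  -- comes from a process i ≤ z or from the stack, so it lies below 2^(z+1) b.
  total : now ≤ start + ∑ z ∈ range m.num, ((m.procs z).prog + 2 * countBelow es (2 ^ (z + 1) * b)) +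
    es.length + 2 * (m.num - m.idx) + if m.budget = 0 then 1 else 0

theorem countBelow_cons (u τ : ℕ) (es : List (ℕ × ℕ)) (B : ℕ) :
    countBelow ((u, τ) :: es) B = countBelow es B + if u < B then 1 else 0 := by
  simp [countBelow, List.countP_cons]

theorem two_pow_mul_le {i z : ℕ} (b : ℕ) (h : i ≤ z) : 2 ^ i * b ≤ 2 ^ z * b :=
  Nat.mul_le_mul_right b (Nat.pow_le_pow_right (by norm_num) h)

/-! ### Preservation of the scheduler invariants by its ticks -/

section Preservation

variable {b h : ℕ} {em : ℕ → Bool} {start now : ℕ} {es : List (ℕ × ℕ)} {m : Main}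

theorem MInv.pop (hm : MInv b h em start now es m) {u : ℕ} {st : List ℕ} (hidx : m.idx = 0)
    (hst : m.stack = u :: st) :
    MInv b h em start (now + 1) ((u, now) :: es) ⟨m.D, m.num, m.D, m.num, m.procs, st⟩ := by
  have hu := hm.stack_mem u (by simp [hst])
  have hnd := hm.nodup_stack
  rw [hst, List.nodup_cons] at hnd
  have hlt : ∀ z, u < 2 ^ z * b := fun z =>
    hu.1.trans_le (Nat.le_mul_of_pos_left b (by positivity))
  refine ⟨hm.D_le, le_rfl, le_rfl, fun _ => rfl, hm.proc, hm.proc_init, hm.len_of_lt, hm.len_top, ?_, hnd.2,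
    fun v hv => hm.stack_mem v (by simp [hst, hv]), fun v => ?_, hm.h_le, hm.le_h,
    fun z hz => ?_, ?_, ?_, ?_⟩
  · rw [List.map_cons, List.nodup_cons]
    refine ⟨fun hmem => ?_, hm.nodup⟩
    rcases ((hm.mem u).mp hmem).2 with ⟨_, h1⟩ | ⟨z, _, h1, _⟩
    · exact h1 (by simp [hst])
    · exact absurd (hlt z) (by omega)
  · rw [List.map_cons, List.mem_cons, hm.mem, hst]
    simp only [List.mem_cons, not_or]
    constructor
    · rintro (rfl | ⟨h1, h2⟩)
      · exact ⟨hu.2, Or.inl ⟨hu.1, hnd.1⟩⟩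
      · exact ⟨h1, h2.imp (fun h3 => ⟨h3.1, h3.2.2⟩) id⟩
    · rintro ⟨h1, h2⟩
      by_cases hvu : v = u
      · exact Or.inl hvu
      · exact Or.inr ⟨h1, h2.imp (fun h3 => ⟨h3.1, hvu, h3.2⟩) id⟩
  -- At `idx` = 0 every process has received its full share `D`. The share is reset to 0, and the
  -- popped output, which lies below all zones, takes its place.
  · refine (hm.progress z hz).imp id fun h1 => ?_
    rw [countBelow_cons, if_pos (hlt z)]
    simp only [Main.share, hidx, Nat.zero_le, if_true] at h1 ⊢
    simp only at hz
    rw [if_neg (by omega), mul_add, mul_one]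
    split <;> omega
  · rw [List.map_cons, List.cons_append, List.isChain_cons]
    refine ⟨fun q hq => ?_, hm.sorted⟩
    have h1 := hm.age q hq
    refine ⟨h1.1, ?_⟩
    simp only
    rw [add_mul]
    simp only [hidx, Nat.sub_zero] at h1
    omega
  · intro q hq
    simp at hq
    subst hq
    simp only [Nat.sub_self, zero_mul]
    omega
  · have h1 := hm.total
    simp only [hidx, Nat.sub_zero, Nat.sub_self, List.length_cons] at h1 ⊢
    have h2 : ∑ z ∈ range m.num, ((m.procs z).prog +
        2 * countBelow ((u, now) :: es) (2 ^ (z + 1) * b)) =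
        ∑ z ∈ range m.num, ((m.procs z).prog + 2 * countBelow es (2 ^ (z + 1) * b)) +
          ∑ z ∈ range m.num, 2 := by
      rw [← Finset.sum_add_distrib]
      refine Finset.sum_congr rfl fun z _ => ?_
      rw [countBelow_cons, if_pos (hlt _)]
      ring
    rw [h2, hm.budget_of_idx hidx] at *
    rw [Finset.sum_const, Finset.card_range, smul_eq_mul]
    omega

theorem MInv.move (hm : MInv b h em start now es m) {i : ℕ} (hidx : m.idx = i + 1)
    (hb : m.budget = 0) (hD : 1 ≤ m.D) :
    MInv b h em start (now + 1) es ⟨m.D, i, m.D, m.num, m.procs, m.stack⟩ := by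
  have hi := hm.idx_le
  refine ⟨hm.D_le, by simp only; omega, le_rfl, fun _ => rfl, hm.proc, hm.proc_init, hm.len_of_lt, hm.len_top,
    hm.nodup, hm.nodup_stack, hm.stack_mem, hm.mem, hm.h_le, hm.le_h, fun z hz => ?_, hm.sorted,
    fun q hq => ?_, ?_⟩
  · refine (hm.progress z hz).imp id fun h1 => ?_
    simp only [Main.share, hidx, hb] at h1 ⊢
    split_ifs at h1 ⊢ <;> omega
  · have h1 := hm.age q hq
    simp only [hidx, hb] at h1 ⊢
    have h2 : m.num - i = m.num - (i + 1) + 1 := by omega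
    rw [h2, add_mul]
    omega
  · have h1 := hm.total
    simp only [hidx, hb, if_true] at h1 ⊢
    rw [if_neg (by omega)]
    omega

theorem MInv.skip (hm : MInv b h em start now es m) {i : ℕ} (hidx : m.idx = i + 1)
    (hb : m.budget ≠ 0) (hf : (m.procs i).Fin h i) :
    MInv b h em start (now + 1) es ⟨m.D, m.idx, 0, m.num, m.procs, m.stack⟩ := by
  have hi := hm.idx_le
  refine ⟨hm.D_le, hi, Nat.zero_le _, fun h => by simp only at h; omega, hm.proc, hm.proc_init, hm.len_of_lt, hm.len_top,
    hm.nodup, hm.nodup_stack, hm.stack_mem, hm.mem, hm.h_le, hm.le_h, fun z hz => ?_, hm.sorted,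
    fun q hq => ?_, ?_⟩
  · by_cases hzi : z = i
    · exact Or.inl (hzi ▸ hf)
    · refine (hm.progress z hz).imp id fun h1 => ?_
      simp only [Main.share, hidx] at h1 ⊢
      rw [if_neg (show ¬ i + 1 = z + 1 by omega)] at h1 ⊢
      exact h1
  · have h1 := hm.age q hq
    simp only at h1 ⊢
    omega
  · have h1 := hm.total
    simp only [if_true, hb, if_false] at h1 ⊢
    omega

theorem sum_update_proc (f : ℕ → ℕ → ℕ) {n i : ℕ} (procs : ℕ → Proc) (P : Proc) (hi : i < n) :
    ∑ z ∈ range n, ((Function.update procs i P z).prog + f n z) + (procs i).prog =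
      ∑ z ∈ range n, ((procs z).prog + f n z) + P.prog := by
  have hc' : i ∈ range n := Finset.mem_range.mpr hi
  rw [← Finset.add_sum_erase _ _ hc', ← Finset.add_sum_erase (range n)
    (fun z => (procs z).prog + f n z) hc', Function.update_self]
  have : ∑ z ∈ (range n).erase i, ((Function.update procs i P z).prog + f n z) =
      ∑ z ∈ (range n).erase i, ((procs z).prog + f n z) :=
    Finset.sum_congr rfl fun z hz => by rw [Function.update_of_ne (Finset.ne_of_mem_erase hz)]
  rw [this]
  omega

theorem MInv.out (hm : MInv b h em start now es m) {i : ℕ} (hidx : m.idx = i + 1)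
    (hb : m.budget ≠ 0) (hf : ¬ (m.procs i).Fin h i) (hc : (m.procs i).carry = 0)
    (he : em (m.procs i).t = true) (hl : (m.procs i).len = i + 1) :
    MInv b h em start (now + 1) (((m.procs i).t, now) :: es) ⟨m.D, m.num, m.D, m.num,
        Function.update m.procs i ((m.procs i).adv b), m.stack⟩ := by
  have hi : i < m.num := by have := hm.idx_le; omega
  have hP := hm.proc i hi
  have h1 := hP.t_lt hc
  rw [hl] at h1
  have h2 := hP.le_t hl.ge
  have ht : ((m.procs i).adv b).t = (m.procs i).t + 1 := by simp [Proc.t_adv, hc]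
  have hlen : ((m.procs i).adv b).len = (m.procs i).len := by simp [Proc.len_adv, hc]
  -- An output in zone i lies below zone z exactly if i < z.
  have hcount : ∀ z, countBelow (((m.procs i).t, now) :: es) (2 ^ z * b) =
      countBelow es (2 ^ z * b) + if i < z then 1 else 0 := by
    intro z
    rw [countBelow_cons]
    congr 1
    refine if_congr ⟨fun h3 => ?_, fun h3 => h1.trans_le (two_pow_mul_le b h3)⟩ rfl rfl
    by_contra h4
    exact absurd (two_pow_mul_le b (show z ≤ i by omega)) (by omega)
  refine ⟨hm.D_le, le_rfl, le_rfl, fun _ => rfl, fun z hz => ?_, fun z hz => ?_, fun z hz => ?_, fun z hz => ?_,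
    ?_, hm.nodup_stack, hm.stack_mem, fun v => ?_, hm.h_le, hm.le_h, fun z hz => ?_, ?_, ?_, ?_⟩
  · simp only [Function.update_apply]
    split_ifs with hzi
    · exact hzi ▸ hP.adv hf
    · exact hm.proc z hz
  · simp only at hz ⊢
    rw [Function.update_of_ne (by omega)]
    exact hm.proc_init z hz
  · have := hm.len_of_lt z hz
    simp only [Function.update_apply]
    split_ifs with hzi
    · rw [hlen, ← hzi]; exact this
    · exact this
  · have := hm.len_top z hz
    simp only [Function.update_apply]
    split_ifs with hzi
    · rw [hlen, ← hzi]; exact this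
    · exact this
  · rw [List.map_cons, List.nodup_cons]
    refine ⟨fun hmem => ?_, hm.nodup⟩
    -- No repetition: the zones are disjoint from each other and from the first `b` steps, and
    -- within a zone the process only advances.
    rcases ((hm.mem _).mp hmem).2 with ⟨h3, _⟩ | ⟨z, hz, h3, h4⟩
    · have : b ≤ 2 ^ i * b := Nat.le_mul_of_pos_left b (by positivity)
      simp only at h3
      omega
    · simp only at h3 h4
      rcases lt_trichotomy z i with h5 | h5 | h5
      · have := (hm.proc z hz).t_le_zone
        have := two_pow_mul_le b (show z + 1 ≤ i by omega)
        omega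
      · subst h5; omega
      · have := two_pow_mul_le b (show i + 1 ≤ z by omega)
        omega
  · rw [List.map_cons, List.mem_cons, hm.mem]
    constructor
    · rintro (rfl | ⟨h3, h4⟩)
      · exact ⟨he, Or.inr ⟨i, hi, h2, by simp [ht]⟩⟩
      · refine ⟨h3, h4.imp id ?_⟩
        rintro ⟨z, hz, h5, h6⟩
        refine ⟨z, hz, h5, ?_⟩
        simp only [Function.update_apply]
        split_ifs with hzi
        · subst hzi; omega
        · exact h6
    · rintro ⟨h3, h4 | ⟨z, hz, h5, h6⟩⟩
      · exact Or.inr ⟨h3, Or.inl h4⟩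
      · simp only [Function.update_apply] at h6
        split_ifs at h6 with hzi
        · subst hzi
          by_cases hv : v = (m.procs z).t
          · exact Or.inl hv
          · exact Or.inr ⟨h3, Or.inr ⟨z, hz, h5, by omega⟩⟩
        · exact Or.inr ⟨h3, Or.inr ⟨z, hz, h5, h6⟩⟩
  · simp only at hz
    have hsh : (⟨m.D, m.num, m.D, m.num, Function.update m.procs i ((m.procs i).adv b),
        m.stack⟩ : Main).share z = 0 := by
      simp only [Main.share]
      rw [if_neg (by omega)]
      split <;> omega
    rw [hsh]
    simp only [hcount, Function.update_apply, mul_add]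
    have h3 := hm.progress z hz
    simp only [Main.share, hidx] at h3
    -- Processes below i have not been served in this round; process i itself advances by one tick;
    -- processes above i exchange their full share `D` for the new output.
    rcases lt_trichotomy z i with h5 | h5 | h5
    · rw [if_neg (show ¬ z = i by omega), if_neg (show ¬ i < z by omega)]
      exact h3.imp id fun h4 => by omega
    · subst h5
      rw [if_pos rfl, if_neg (lt_irrefl _), Proc.prog_adv]
      right
      rcases h3 with h3 | h3
      · exact absurd h3 hf
      · omega
    · rw [if_neg (show ¬ z = i by omega), if_pos h5]
      rw [if_pos (show i + 1 ≤ z by omega)] at h3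
      exact h3.imp id fun h4 => by omega
  · rw [List.map_cons, List.cons_append, List.isChain_cons]
    refine ⟨fun q hq => ?_, hm.sorted⟩
    have h3 := hm.age q hq
    refine ⟨h3.1, ?_⟩
    have h4 : (m.num - m.idx) * (m.D + 2) ≤ m.num * (m.D + 2) :=
      Nat.mul_le_mul_right _ (Nat.sub_le _ _)
    simp only
    rw [add_mul]
    omega
  · intro q hq
    simp at hq
    subst hq
    simp only [Nat.sub_self, zero_mul]
    omega
  · have h3 := hm.total
    have h4 := sum_update_proc (fun _ z => 2 * countBelow (((m.procs i).t, now) :: es)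
      (2 ^ (z + 1) * b)) m.procs ((m.procs i).adv b) hi
    rw [Proc.prog_adv] at h4
    have h5 : ∑ z ∈ range m.num, ((m.procs z).prog +
        2 * countBelow es (2 ^ (z + 1) * b)) + 2 * (m.num - i) =
        ∑ z ∈ range m.num, ((m.procs z).prog +
        2 * countBelow (((m.procs i).t, now) :: es) (2 ^ (z + 1) * b)) := by
      have h6 : ∑ z ∈ range m.num, 2 * (if i < z + 1 then 1 else 0) = 2 * (m.num - i) := by
        rw [← Finset.mul_sum, Finset.sum_boole]
        congr 1
        have : {z ∈ range m.num | i < z + 1} = Ico i m.num := by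
          ext z
          simp only [mem_filter, Finset.mem_range, mem_Ico]
          omega
        rw [this]
        simp
      rw [← h6, ← Finset.sum_add_distrib]
      refine Finset.sum_congr rfl fun z _ => ?_
      rw [hcount]
      ring
    simp only [hidx, hb, if_false, Nat.sub_self, List.length_cons] at h3 ⊢
    omega

theorem MInv.micro (hm : MInv b h em start now es m) {i : ℕ} (hidx : m.idx = i + 1)
    (hb : m.budget ≠ 0) (hf : ¬ (m.procs i).Fin h i)
    (hc : ¬ ((m.procs i).carry = 0 ∧ em (m.procs i).t = true ∧ (m.procs i).len = i + 1)) :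
    MInv b h em start (now + 1) es ⟨m.D, m.idx, m.budget - 1,
        if (m.procs i).carry ≠ 0 ∧ (m.procs i).carry = (m.procs i).len + 1 ∧ (m.procs i).len = i
          then m.num + 1 else m.num,
        Function.update m.procs i ((m.procs i).adv b), m.stack⟩ := by
  have hi : i < m.num := by have := hm.idx_le; omega
  have hP := hm.proc i hi
  have hb0 : 0 < b := by have := hP.cnt_lt; omega
  set new := (m.procs i).carry ≠ 0 ∧ (m.procs i).carry = (m.procs i).len + 1 ∧
    (m.procs i).len = i with hnew
  -- All processes but the last have already entered their zones, so only the last one can trigger a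
  -- new process.
  have htop : new → i + 1 = m.num := by
    rintro ⟨_, _, h3⟩
    by_contra hne
    have := hm.len_of_lt i (by omega)
    omega
  have hlen : new → ((m.procs i).adv b).len = i + 1 := by
    rintro ⟨h1, h2, h3⟩
    rw [Proc.len_adv, if_pos ⟨h1, h2⟩, h3]
  have hlen' : ¬ new → i + 1 = m.num → ((m.procs i).adv b).len ≤ i := by
    intro hn htop'
    have h3 := hm.len_top i htop'
    rw [Proc.len_adv]
    split_ifs with h4
    · have : (m.procs i).len ≠ i := fun h5 => hn ⟨h4.1, h4.2, h5⟩
      omega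
    · exact h3
  have hnum : m.num ≤ if new then m.num + 1 else m.num := by split <;> omega
  set num' := if new then m.num + 1 else m.num with hnum'
  have hlen0 : (m.procs i).len ≤ ((m.procs i).adv b).len := by
    rw [Proc.len_adv]
    split <;> omega
  have hbudget := hm.budget_le
  refine ⟨hm.D_le, ?_, by simp only; omega, fun h => by simp only at h; omega, fun z hz => ?_, fun z hz => ?_, fun z hz => ?_,
    fun z hz => ?_, hm.nodup, hm.nodup_stack, hm.stack_mem, fun v => ?_, fun h0 => ?_,
    fun _ => hm.le_h (by omega), fun z hz => ?_, ?_, fun q hq => ?_, ?_⟩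
  · simp only
    have := hm.idx_le
    omega
  · simp only [Function.update_apply] at hz ⊢
    split_ifs with hzi
    · exact hzi ▸ hP.adv hf
    · by_cases hzn : z < m.num
      · exact hm.proc z hzn
      · rw [hm.proc_init z (by omega)]
        exact Proc.Inv.init hb0
  · simp only at hz ⊢
    rw [Function.update_of_ne (by omega)]
    exact hm.proc_init z (by omega)
  · simp only [Function.update_apply] at hz ⊢
    split_ifs with hzi
    · subst hzi
      by_cases hn : new
      · exact (hlen hn).ge
      · rw [hnum', if_neg hn] at hz
        exact (hm.len_of_lt z hz).trans hlen0
    · refine hm.len_of_lt z ?_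
      by_contra h3
      have : new := by
        by_contra hn
        rw [hnum', if_neg hn] at hz
        omega
      rw [hnum', if_pos this] at hz
      have := htop this
      omega
  · simp only [Function.update_apply] at hz ⊢
    by_cases hn : new
    · rw [hnum', if_pos hn] at hz
      rw [if_neg (by have := htop hn; omega), hm.proc_init z (by omega)]
      exact Nat.zero_le _
    · rw [hnum', if_neg hn] at hz
      split_ifs with hzi
      · subst hzi
        exact hlen' hn hz
      · exact hm.len_top z hz
  · rw [hm.mem]
    refine and_congr_right fun hev => or_congr_right ?_
    simp only [Function.update_apply]
    constructor
    · rintro ⟨z, hz, h5, h6⟩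
      refine ⟨z, by omega, h5, ?_⟩
      split_ifs with hzi
      · subst hzi
        rw [Proc.t_adv]
        split <;> omega
      · exact h6
    · rintro ⟨z, hz, h5, h6⟩
      split_ifs at h6 with hzi
      · subst hzi
        refine ⟨z, hi, h5, ?_⟩
        rw [Proc.t_adv] at h6
        split_ifs at h6 with h7
        -- An output that is passed over silently occurs while the length is at most z, that is,
        -- before zone z begins.
        · by_contra h8
          obtain rfl : v = (m.procs z).t := by omega
          have h9 : (m.procs z).len ≤ z := by
            have : ¬ (m.procs z).len = z + 1 := fun h9 => hc ⟨h7, hev, h9⟩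
            have : ¬ z + 2 ≤ (m.procs z).len := fun h9 => hf (Or.inl h9)
            omega
          have := hP.t_lt h7
          have := two_pow_mul_le b h9
          omega
        · exact h6
      · refine ⟨z, ?_, h5, h6⟩
        by_contra h7
        rw [hm.proc_init z (by omega)] at h6
        exact Nat.not_lt_zero _ h6
  · simp only at h0
    omega
  · simp only [Function.update_apply]
    have hshare : ∀ z, z ≠ i → z < m.num → (⟨m.D, m.idx, m.budget - 1, num',
        Function.update m.procs i ((m.procs i).adv b), m.stack⟩ : Main).share z = m.share z := by
      intro z hz _
      simp only [Main.share, hidx]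
      rw [if_neg (show ¬ i + 1 = z + 1 by omega), if_neg (show ¬ i + 1 = z + 1 by omega)]
    split_ifs with hzi
    · subst hzi
      right
      rcases hm.progress z hi with h3 | h3
      · exact absurd h3 hf
      · simp only [Main.share, hidx] at h3 ⊢
        rw [if_neg (by omega), if_pos trivial] at h3 ⊢
        rw [Proc.prog_adv]
        omega
    · by_cases hzn : z < m.num
      · rw [hshare z hzi hzn]
        exact hm.progress z hzn
      · have hn : new := by
          by_contra hn
          simp only [hnum', if_neg hn] at hz
          omega
        have hz' : z = i + 1 := by
          simp only [hnum', if_pos hn] at hz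
          have := htop hn
          omega
        subst hz'
        right
        rcases hm.progress i hi with h3 | h3
        · exact absurd h3 hf
        -- The new process is started at the very moment when process i is at the lower end of its
        -- zone.
        have h4 : (m.procs i).t = 2 ^ i * b := by
          obtain ⟨h4, h5, h6⟩ := hn
          have h7 := hP.t_eq
          have h8 : ∑ j ∈ range (m.procs i).len, (m.procs i).bits j * 2 ^ j = 0 :=
            Finset.sum_eq_zero fun j hj => by
              rw [hP.low_bits j (by have := Finset.mem_range.mp hj; omega), zero_mul]
          rw [(hP.of_carry h4).2, Proc.val, h8, if_neg h4, h5, h6] at h7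
          rw [h7]
          simp [mul_comm]
        have h5 := hP.prog_le_three_mul
        -- At this moment nothing from zone i has been output, so the outputs to be compensated for
        -- process i + 1 are those already accounted for in the invariant of process i.
        have h6 : countBelow es (2 ^ (i + 1) * b) ≤ countBelow es (2 ^ i * b) := by
          unfold countBelow
          refine le_of_eq (List.countP_congr fun y hy => ?_)
          have h7 := ((hm.mem y.1).mp (List.mem_map_of_mem hy)).2
          have h8 : y.1 < 2 ^ i * b := by
            rcases h7 with h7 | ⟨z, hz, h7, h8⟩
            · exact h7.1.trans_le (Nat.le_mul_of_pos_left b (by positivity))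
            · have h9 : z ≤ i := by have := htop hn; omega
              rcases h9.lt_or_eq with h9 | rfl
              · exact (h8.trans_le (hm.proc z hz).t_le_zone).trans_le (two_pow_mul_le b h9)
              · omega
          have h9 := h8.trans_le (two_pow_mul_le b (Nat.le_succ i))
          simp only [Nat.succ_eq_add_one] at h9
          simp only [decide_eq_true_eq]
          exact ⟨fun _ => h8, fun _ => h9⟩
        have h7 := Nat.mul_le_mul_left m.D h6
        -- In units of 2^i b: at most 3 for the ticks of process i, 4 from its invariant, and 1 for
        -- the share `D` credited to the new process. The sum 8 equals 4 in units of 2^(i+1) b,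
        -- which explains the constant 4.
        have h8 : m.D ≤ 2 ^ i * b := hm.D_le.trans (Nat.le_mul_of_pos_left b (by positivity))
        simp only [Main.share, hidx] at h3 ⊢
        rw [if_pos le_rfl, hm.proc_init (i + 1) (by omega)]
        rw [if_neg (by omega), if_pos trivial] at h3
        rw [pow_succ', mul_assoc] at h7 ⊢
        simp only [Proc.init]
        omega
  · refine hm.sorted.imp fun q p hqp => ⟨hqp.1, hqp.2.trans ?_⟩
    simp only
    gcongr
  · have h3 := hm.age q hq
    have h4 : (m.num - m.idx) * (m.D + 2) ≤ (num' - m.idx) * (m.D + 2) :=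
      Nat.mul_le_mul_right _ (by omega)
    simp only
    omega
  · have h3 := hm.total
    have h4 := sum_update_proc (fun _ z => 2 * countBelow es
      (2 ^ (z + 1) * b)) m.procs ((m.procs i).adv b) hi
    rw [Proc.prog_adv] at h4
    have h5 : ∑ z ∈ range m.num, ((Function.update m.procs i ((m.procs i).adv b) z).prog +
        2 * countBelow es (2 ^ (z + 1) * b)) ≤
        ∑ z ∈ range num', ((Function.update m.procs i ((m.procs i).adv b) z).prog +
        2 * countBelow es (2 ^ (z + 1) * b)) :=
      Finset.sum_le_sum_of_subset (Finset.range_mono hnum)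
    simp only [hb, if_false] at h3 ⊢
    omega

theorem MInv.tick (hm : MInv b h em start now es m) (hD : m.num ≠ 0 → 1 ≤ m.D) {e : Option ℕ}
    {m' : Main} (ht : MTick b h em m e m') :
    MInv b h em start (now + 1) (e.toList.map (fun u => (u, now)) ++ es) m' := by
  have hi := hm.idx_le
  cases ht with
  | pop u st hidx hst => exact hm.pop hidx hst
  | move i hidx hb => exact hm.move hidx hb (hD (by omega))
  | skip i hidx hb hf => exact hm.skip hidx hb hf
  | out i hidx hb hf hc he hl => exact hm.out hidx hb hf hc he hl
  | micro i hidx hb hf hc => exact hm.micro hidx hb hf hc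

end Preservation

/-- The parameters of the abstract machine: the zone unit is `b = 24 * V`, the given machine halts
after `h` steps and outputs a word of length `wl u` at each step `u` with `em u`; the number `a` is
computed in `ia` steps, and its digits are `digits`. -/
structure Env where
  V : ℕ
  h : ℕ
  ia : ℕ
  a : ℕ
  em : ℕ → Bool
  wl : ℕ → ℕ
  digits : List ℕ

namespace Env

/-- The unit of the zones. -/
def b (E : Env) : ℕ := 24 * E.V

/-- The number of outputs before step `t`. -/
def count (E : Env) (t : ℕ) : ℕ := #{u ∈ range t | E.em u = true}

/-- The average delay, cut off at `V`. -/
def a' (E : Env) : ℕ := min E.a E.V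

/-- The time for storing the outputs before step `t`. -/
def storeTime (E : Env) (t : ℕ) : ℕ := ∑ u ∈ range t, if E.em u = true then E.wl u + 1 else 0

/-- The assumptions on the parameters. -/
structure OK (E : Env) : Prop where
  one_le_V : 1 ≤ E.V
  lt_h : ∀ u, E.em u = true → u < E.h
  wl_le : ∀ u, E.wl u ≤ E.V
  ia_le : E.ia ≤ E.V
  length_le : E.digits.length ≤ E.V
  digits_eq : Nat.ofDigits 2 E.digits = E.a
  h_le_of_empty : E.count E.h = 0 → E.h ≤ E.V
  h_le : E.count E.h ≠ 0 → E.h ≤ E.a' * E.count E.h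
  density : E.count E.h ≠ 0 → ∀ t ≤ E.h, t ≤ E.V + E.a' * E.count t

theorem storeTime_le {E : Env} {k : ℕ} (hk : ∀ u, E.em u = true → E.wl u ≤ k) (t : ℕ) :
    E.storeTime t ≤ (k + 1) * E.count t := by
  unfold storeTime count
  rw [← Finset.sum_filter, mul_comm, ← smul_eq_mul]
  exact Finset.sum_le_card_nsmul _ _ _ fun u hu => Nat.succ_le_succ (hk u (Finset.mem_filter.mp hu).2)

theorem count_le (E : Env) (t : ℕ) : E.count t ≤ t :=
  (Finset.card_filter_le _ _).trans (Finset.card_range t).le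

theorem count_le_count_h {E : Env} (hE : E.OK) (t : ℕ) : E.count t ≤ E.count E.h :=
  Finset.card_le_card fun u hu => by
    rw [mem_filter, Finset.mem_range] at hu ⊢
    exact ⟨hE.lt_h u hu.2, hu.2⟩

end Env

/-! ## Analysis of the scheduler -/

section Analysis

variable {b h : ℕ} {em : ℕ → Bool} {start now : ℕ} {es : List (ℕ × ℕ)} {m : Main}

theorem countBelow_eq (hnd : (es.map Prod.fst).Nodup) (B : ℕ) :
    countBelow es B = #{u ∈ (es.map Prod.fst).toFinset | u < B} := by
  have h1 : countBelow es B = ((es.map Prod.fst).filter fun u => decide (u < B)).length := by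
    rw [← List.countP_eq_length_filter, List.countP_map]
    rfl
  rw [h1, ← List.toFinset_card_of_nodup (hnd.filter _), List.toFinset_filter]
  simp

theorem countBelow_le (hnd : (es.map Prod.fst).Nodup) (B : ℕ) : countBelow es B ≤ B := by
  rw [countBelow_eq hnd]
  conv_rhs => rw [← Finset.card_range B]
  exact Finset.card_le_card fun u hu => Finset.mem_range.mpr (Finset.mem_filter.mp hu).2

theorem MInv.length_le (hm : MInv b h em start now es m) (hem : ∀ u, em u = true → u < h) :
    es.length ≤ #{u ∈ range h | em u = true} := by
  rw [← List.length_map (as := es) Prod.fst, ← List.toFinset_card_of_nodup hm.nodup]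
  refine Finset.card_le_card fun u hu => ?_
  have h1 := ((hm.mem u).mp (List.mem_toFinset.mp hu)).1
  exact Finset.mem_filter.mpr ⟨Finset.mem_range.mpr (hem u h1), h1⟩

/-- The second to last process has entered its zone, so the search lasts at least 2^(num-2) b steps.
For a single process, b ≤ h suffices. -/
theorem MInv.two_pow_num_le (hm : MInv b h em start now es m) (hn : m.num ≠ 0) :
    2 ^ m.num * b ≤ 4 * h := by
  have hb := hm.le_h hn
  rcases Nat.lt_or_ge m.num 2 with h1 | h1
  · have : m.num = 1 := by omega
    rw [this]
    omega
  · have h2 := (hm.proc (m.num - 2) (by omega)).le_t (hm.len_of_lt (m.num - 2) (by omega))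
    have h3 := (hm.proc (m.num - 2) (by omega)).t_le
    have h4 : 2 ^ m.num = 4 * 2 ^ (m.num - 2) := by
      rw [show (4 : ℕ) = 2 ^ 2 by norm_num, ← pow_add]
      congr 1
      omega
    rw [h4, mul_assoc]
    omega

/-- For each process, 3 ticks per step and a charge of 2 per output below the end of its zone amount
to 5 · 2^(z+1) b. This is a geometric series in z. -/
theorem MInv.now_le (hm : MInv b h em start now es m) :
    now ≤ start + 10 * (2 ^ m.num * b) + es.length + 2 * m.num + 1 := by
  have h1 := hm.total
  have h2 : ∑ z ∈ range m.num, ((m.procs z).prog + 2 * countBelow es (2 ^ (z + 1) * b)) ≤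
      ∑ z ∈ range m.num, 10 * b * 2 ^ z := by
    refine Finset.sum_le_sum fun z hz => ?_
    have hP := hm.proc z (Finset.mem_range.mp hz)
    have h3 := hP.prog_le_three_mul
    have h4 := hP.t_le_zone
    have h5 := countBelow_le hm.nodup (2 ^ (z + 1) * b)
    have h6 : 10 * b * 2 ^ z = 5 * (2 ^ (z + 1) * b) := by ring
    omega
  have h3 : ∑ z ∈ range m.num, 2 ^ z ≤ 2 ^ m.num := by
    have := Nat.geomSum_eq (m := 2) le_rfl m.num
    rw [this]
    exact Nat.div_le_of_le_mul (by simp)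
  rw [← Finset.mul_sum] at h2
  have h4 := Nat.mul_le_mul_left (10 * b) h3
  have h5 : 10 * b * 2 ^ m.num = 10 * (2 ^ m.num * b) := by ring
  have h6 : (if m.budget = 0 then 1 else 0) ≤ 1 := by split <;> omega
  have h7 := Nat.zero_le (2 ^ m.num)
  omega

variable {E : Env}

/-- Induction over the zones. If everything below zone z has been output, the number of these
outputs is large by density, so process z has received enough ticks to finish. Only the empty stack
is needed, since `progress` holds throughout a round. -/
theorem MInv.complete (hE : E.OK) (hm : MInv E.b E.h E.em start now es m)
    (hst : m.stack = []) (hD : m.num ≠ 0 → m.D = 24 * E.a') (u : ℕ) (hu : E.em u = true) :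
    u ∈ es.map Prod.fst := by
  by_cases hn : m.num = 0
  · exact (hm.mem u).mpr ⟨hu, Or.inl ⟨(hE.lt_h u hu).trans_le (hm.h_le hn), by simp [hst]⟩⟩
  have hbh := hm.le_h hn
  have hV := hE.one_le_V
  have hb : E.b = 24 * E.V := rfl
  have hcount : E.count E.h ≠ 0 := fun h0 => by have := hE.h_le_of_empty h0; omega
  have key : ∀ z ≤ m.num, ∀ u, E.em u = true → u < 2 ^ z * E.b → u ∈ es.map Prod.fst := by
    intro z
    induction z with
    | zero =>
      intro _ u hu hub
      exact (hm.mem u).mpr ⟨hu, Or.inl ⟨by simpa using hub, by simp [hst]⟩⟩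
    | succ z ih =>
      intro hz u hu hub
      have ih := ih (by omega)
      by_cases hzh : E.h ≤ 2 ^ z * E.b
      · exact ih u hu ((hE.lt_h u hu).trans_le hzh)
      by_cases huz : u < 2 ^ z * E.b
      · exact ih u hu huz
      have hfin : (m.procs z).Fin E.h z := by
        rcases hm.progress z (by omega) with h1 | h1
        · exact h1
        -- An unfinished process has used at most 3 · 2^(z+1) b ticks, so 24a' times the number of
        -- outputs below its zone is at most 10 · 2^z b. By density this product is at least 24 ·
        -- 2^z b - 24V, and 24V = b is at most 2^z b: a contradiction.
        · exfalso
          have h2 : E.count (2 ^ z * E.b) ≤ countBelow es (2 ^ z * E.b) := by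
            rw [countBelow_eq hm.nodup]
            refine Finset.card_le_card fun v hv => ?_
            rw [mem_filter, Finset.mem_range] at hv
            exact Finset.mem_filter.mpr ⟨List.mem_toFinset.mpr (ih v hv.2 hv.1), hv.1⟩
          have h3 := hE.density hcount (2 ^ z * E.b) (by omega)
          have hP := hm.proc z (by omega)
          have h4 := hP.prog_le_three_mul
          have h5 := hP.t_le_zone
          have h6 := Nat.mul_le_mul_left E.a' h2
          rw [hD hn, mul_assoc] at h1
          rw [pow_succ', mul_assoc] at h5
          have h7 : E.b ≤ 2 ^ z * E.b := Nat.le_mul_of_pos_left _ (by positivity)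
          omega
      have ht : u < (m.procs z).t := by
        rcases hfin with h1 | h1
        · have hP := hm.proc z (by omega)
          rw [hP.t_of_len (by have := hP.len_le; omega)]
          exact hub
        · exact (hE.lt_h u hu).trans_le h1.2
      exact (hm.mem u).mpr ⟨hu, Or.inr ⟨z, by omega, by omega, ht⟩⟩
  by_cases hlt : u < 2 ^ (m.num - 1) * E.b
  · exact key (m.num - 1) (by omega) u hu hlt
  -- It remains to exclude steps beyond the last zone. The last process has not entered its zone, so
  -- it can be finished only by halting before it, and then no such step exists. Otherwise the
  -- preceding computation applies.
  · have h1 := hm.len_top (m.num - 1) (by omega)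
    refine key m.num le_rfl u hu ?_
    by_contra h2
    have hP := hm.proc (m.num - 1) (by omega)
    have h3 := hE.lt_h u hu
    have h4 := hm.progress (m.num - 1) (by omega)
    rcases h4 with h4 | h4
    · rcases h4 with h4 | h4
      · omega
      · have h5 := hP.t_lt h4.1
        have h6 := two_pow_mul_le E.b h1
        omega
    · have h2' : E.count (2 ^ (m.num - 1) * E.b) ≤ countBelow es (2 ^ (m.num - 1) * E.b) := by
        rw [countBelow_eq hm.nodup]
        refine Finset.card_le_card fun v hv => ?_
        rw [mem_filter, Finset.mem_range] at hv
        exact Finset.mem_filter.mpr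
          ⟨List.mem_toFinset.mpr (key (m.num - 1) (by omega) v hv.2 hv.1), hv.1⟩
      have h3' := hE.density hcount (2 ^ (m.num - 1) * E.b) (by omega)
      have h4' := hP.prog_le_three_mul
      have h5 := hP.t_le_zone
      have h6 := Nat.mul_le_mul_left E.a' h2'
      rw [hD hn, mul_assoc] at h4
      rw [pow_succ', mul_assoc] at h5
      have h7 : E.b ≤ 2 ^ (m.num - 1) * E.b := Nat.le_mul_of_pos_left _ (by positivity)
      omega

/-- Combines h ≤ a'N with the length of the search forced by the number of processes. With b = 24V
and a' ≤ V, cancelling V leaves 24 · 2^num ≤ 4N; the logarithm in the delay comes from here. -/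
theorem MInv.bounds (hE : E.OK) (hm : MInv E.b E.h E.em start now es m) (hn : m.num ≠ 0) :
    E.count E.h ≠ 0 ∧ 1 ≤ E.a' ∧ 2 ^ (m.num + 2) ≤ E.count E.h ∧
      now ≤ start + 60 * (E.a' * E.count E.h) := by
  have hbh := hm.le_h hn
  have hV := hE.one_le_V
  have hb : E.b = 24 * E.V := rfl
  have hcount : E.count E.h ≠ 0 := fun h0 => by have := hE.h_le_of_empty h0; omega
  have h1 := hE.h_le hcount
  have ha : 1 ≤ E.a' := by
    by_contra hc
    have : E.a' = 0 := by omega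
    rw [this] at h1
    omega
  have h2 := hm.two_pow_num_le hn
  have h3 : E.V * (24 * 2 ^ m.num) ≤ E.V * (4 * E.count E.h) := by
    have h4 : E.a' * E.count E.h ≤ E.V * E.count E.h := Nat.mul_le_mul_right _ (min_le_right _ _)
    have h5 : E.V * (24 * 2 ^ m.num) = 2 ^ m.num * E.b := by rw [hb]; ring
    have h6 : E.V * (4 * E.count E.h) = 4 * (E.V * E.count E.h) := by ring
    omega
  have h4 := Nat.le_of_mul_le_mul_left h3 hV
  refine ⟨hcount, ha, by rw [pow_add]; omega, ?_⟩
  have h5 := hm.now_le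
  have h6 := hm.length_le hE.lt_h
  change _ ≤ E.count E.h at h6
  have h7 : E.count E.h ≤ E.a' * E.count E.h := Nat.le_mul_of_pos_left _ ha
  have h8 : m.num < 2 ^ m.num := Nat.lt_two_pow_self
  omega

end Analysis

/-! ## The phases of the abstract machine -/

/-- States of the abstract machine. In the first phase, the outputs of the first `b` steps of the
given machine are stored (`pre` and `copy`). Then `a` is computed (`calc`) and decoded (`dig`). -/
inductive State
  | pre (t : ℕ) (st : List ℕ)
  | copy (t : ℕ) (st : List ℕ) (j : ℕ)
  | eval (i : ℕ) (st : List ℕ)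
  | dig (i v : ℕ) (st : List ℕ)
  | main (m : Main)

/-- The initial state of the scheduler. -/
def Main.start (D n : ℕ) (st : List ℕ) : Main := ⟨D, n, D, n, fun _ => Proc.init, st⟩

/-- One tick of the abstract machine. -/
inductive Tick (E : Env) : State → Option ℕ → State → Prop
  | preStep (t : ℕ) (st : List ℕ) (hb : t < E.b) (hh : t < E.h) (he : E.em t = false) :
      Tick E (.pre t st) none (.pre (t + 1) st)
  | preOut (t : ℕ) (st : List ℕ) (hb : t < E.b) (hh : t < E.h) (he : E.em t = true) :
      Tick E (.pre t st) none (.copy t st 0)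
  | copyLetter (t : ℕ) (st : List ℕ) (j : ℕ) (hj : j < E.wl t) :
      Tick E (.copy t st j) none (.copy t st (j + 1))
  | copyEnd (t : ℕ) (st : List ℕ) (j : ℕ) (hj : E.wl t ≤ j) :
      Tick E (.copy t st j) none (.pre (t + 1) (t :: st))
  | preHalt (t : ℕ) (st : List ℕ) (hb : t < E.b) (hh : E.h ≤ t) :
      Tick E (.pre t st) none (.main (Main.start 0 0 st))
  | preEnd (st : List ℕ) : Tick E (.pre E.b st) none (.eval 0 st)
  | calcStep (i : ℕ) (st : List ℕ) (hi : i < E.ia) : Tick E (.eval i st) none (.eval (i + 1) st)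
  | calcOut (st : List ℕ) : Tick E (.eval E.ia st) none (.dig E.digits.length 0 st)
  | digStep (i v : ℕ) (st : List ℕ) :
      Tick E (.dig (i + 1) v st) none (.dig i (min (2 * v + E.digits.getD i 0) E.V) st)
  | digEnd (v : ℕ) (st : List ℕ) : Tick E (.dig 0 v st) none (.main (Main.start (24 * v) 1 st))
  | main (m : Main) (e : Option ℕ) (m' : Main) (h : MTick E.b E.h E.em m e m') :
      Tick E (.main m) e (.main m')

/-- The stack contains the steps before `t` with an output. -/
def StackOK (E : Env) (t : ℕ) (st : List ℕ) : Prop :=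
  st.Nodup ∧ ∀ u, u ∈ st ↔ u < t ∧ E.em u = true

/-- Invariants of the abstract machine. -/
def SInv (E : Env) (now : ℕ) (es : List (ℕ × ℕ)) : State → Prop
  | .pre t st => t ≤ E.b ∧ t ≤ E.h ∧ StackOK E t st ∧ now = t + E.storeTime t ∧ es = []
  | .copy t st j => t < E.b ∧ t < E.h ∧ E.em t = true ∧ StackOK E t st ∧ j ≤ E.wl t ∧
      now = t + E.storeTime t + 1 + j ∧ es = []
  | .eval i st => E.b ≤ E.h ∧ StackOK E E.b st ∧ i ≤ E.ia ∧
      now = E.b + E.storeTime E.b + 1 + i ∧ es = []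
  | .dig i v st => E.b ≤ E.h ∧ StackOK E E.b st ∧ i ≤ E.digits.length ∧
      v = min (Nat.ofDigits 2 (E.digits.drop i)) E.V ∧
      now + i = E.b + E.storeTime E.b + E.ia + E.digits.length + 2 ∧ es = []
  | .main m => (m.num ≠ 0 → m.D = 24 * E.a') ∧ (m.num = 0 → m.D = 0) ∧
      ∃ start, MInv E.b E.h E.em start now es m ∧
        (m.num = 0 → start ≤ E.h + E.storeTime E.h + 1) ∧
        (m.num ≠ 0 → start ≤ E.b + E.storeTime E.b + E.ia + E.digits.length + 3)

/-! ### Invariants of the abstract machine through its phases -/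

section Phases

variable {E : Env} {now : ℕ} {es : List (ℕ × ℕ)}

theorem MInv.of_start {b h : ℕ} {em : ℕ → Bool} {D n : ℕ} {st : List ℕ} (hb : 0 < b) (hn : n ≤ 1)
    (hD : D ≤ b) (hst : st.Nodup) (hmem : ∀ u, u ∈ st ↔ u < b ∧ em u = true) (h0 : n = 0 → h ≤ b)
    (h1 : n ≠ 0 → b ≤ h) : MInv b h em now now [] (Main.start D n st) := by
  refine ⟨hD, le_rfl, le_rfl, fun _ => rfl, fun z _ => Proc.Inv.init hb, fun _ _ => rfl,
    fun z hz => ?_, fun z hz => Nat.zero_le _, List.nodup_nil, hst, fun u hu => (hmem u).mp hu,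
    fun u => ?_, h0, h1, fun z hz => ?_, ?_, ?_, ?_⟩
  · simp only [Main.start] at hz
    omega
  · simp only [Main.start, List.map_nil, List.not_mem_nil, false_iff, not_and, not_or]
    exact fun hu => ⟨fun h2 h3 => h3 ((hmem u).mpr ⟨h2, hu⟩),
      fun ⟨z, _, _, h4⟩ => Nat.not_lt_zero _ h4⟩
  · right
    simp only [Main.start] at hz
    have : (Main.start D n st).share z = 0 := by
      unfold Main.share
      rw [if_neg (show ¬ (Main.start D n st).idx ≤ z from not_le.mpr hz)]
      split
      · exact Nat.sub_self D
      · rfl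
    rw [this]
    simp [countBelow]
  · simp
  · simp [Main.start]
  · simp [Main.start]
    omega

theorem storeTime_succ (t : ℕ) :
    E.storeTime (t + 1) = E.storeTime t + if E.em t = true then E.wl t + 1 else 0 :=
  Finset.sum_range_succ _ _

theorem SInv.tick (hE : E.OK) {s s' : State} {e : Option ℕ}
    (hs : SInv E now es s) (ht : Tick E s e s') :
    SInv E (now + 1) (e.toList.map (fun u => (u, now)) ++ es) s' := by
  have hV := hE.one_le_V
  have hb : E.b = 24 * E.V := rfl
  cases ht with
  | preStep t st htb hth he =>
    obtain ⟨h1, h2, ⟨h3, h4⟩, h5, h6⟩ := hs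
    refine ⟨htb, hth, ⟨h3, fun u => ?_⟩, ?_, by simp [h6]⟩
    · rw [h4, Nat.lt_succ_iff_lt_or_eq]
      constructor
      · exact fun h7 => ⟨Or.inl h7.1, h7.2⟩
      · rintro ⟨h7 | rfl, h8⟩
        · exact ⟨h7, h8⟩
        · rw [he] at h8
          cases h8
    · rw [storeTime_succ, he, h5]
      simp
      omega
  | preOut t st htb hth he =>
    obtain ⟨h1, h2, h3, h5, h6⟩ := hs
    exact ⟨htb, hth, he, h3, Nat.zero_le _, by omega, by simp [h6]⟩
  | copyLetter t st j hj =>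
    obtain ⟨h1, h2, h3, h4, h5, h6, h7⟩ := hs
    exact ⟨h1, h2, h3, h4, hj, by omega, by simp [h7]⟩
  | copyEnd t st j hj =>
    obtain ⟨h1, h2, h3, ⟨h4, h4'⟩, h5, h6, h7⟩ := hs
    refine ⟨h1, h2, ⟨?_, fun u => ?_⟩, ?_, by simp [h7]⟩
    · rw [List.nodup_cons, h4']
      exact ⟨fun h8 => lt_irrefl _ h8.1, h4⟩
    · rw [List.mem_cons, h4', Nat.lt_succ_iff_lt_or_eq]
      constructor
      · rintro (rfl | h8)
        · exact ⟨Or.inr rfl, h3⟩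
        · exact ⟨Or.inl h8.1, h8.2⟩
      · rintro ⟨h8 | h8, h9⟩
        · exact Or.inr ⟨h8, h9⟩
        · exact Or.inl h8
    · rw [storeTime_succ, if_pos h3]
      omega
  | preHalt t st htb hth =>
    obtain ⟨h1, h2, ⟨h3, h4⟩, h5, h6⟩ := hs
    obtain rfl : t = E.h := le_antisymm h2 hth
    subst h6
    -- The search ended within `b` steps, so the stack contains all outputs. The scheduler starts
    -- without processes and only pops.
    refine ⟨fun h => (h rfl).elim, fun _ => rfl, now + 1, MInv.of_start (by omega)
      (Nat.zero_le _) (Nat.zero_le _) h3 (fun u => ?_) (fun _ => htb.le) (fun h => (h rfl).elim),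
      fun _ => by omega, fun h => (h rfl).elim⟩
    rw [h4]
    exact and_congr_left fun h7 => ⟨fun h8 => h8.trans htb, fun _ => hE.lt_h u h7⟩
  | preEnd st =>
    obtain ⟨h1, h2, h3, h5, h6⟩ := hs
    exact ⟨h2, h3, Nat.zero_le _, by omega, by simp [h6]⟩
  | calcStep i st hi =>
    obtain ⟨h1, h2, h3, h5, h6⟩ := hs
    exact ⟨h1, h2, hi, by omega, by simp [h6]⟩
  | calcOut st =>
    obtain ⟨h1, h2, h3, h5, h6⟩ := hs
    exact ⟨h1, h2, le_rfl, by simp, by omega, by simp [h6]⟩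
  | digStep i v st =>
    obtain ⟨h1, h2, h3, h4, h5, h6⟩ := hs
    refine ⟨h1, h2, by omega, ?_, by omega, by simp [h6]⟩
    -- Horner's scheme from the most significant digit. Cutting off at `V` after each digit gives
    -- the same result as cutting off once at the end, because doubling and adding a digit never
    -- decreases the value.
    rw [List.drop_eq_getElem_cons (show i < E.digits.length by omega), Nat.ofDigits_cons,
      List.getD_eq_getElem _ _ (show i < E.digits.length by omega), h4]
    omega
  | digEnd v st =>
    obtain ⟨h1, h2, h3, h4, h5, h6⟩ := hs
    subst h6
    rw [List.drop_zero, hE.digits_eq] at h4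
    subst h4
    refine ⟨fun _ => rfl, fun h => absurd h one_ne_zero, now + 1, MInv.of_start (by omega) le_rfl ?_ h2.1 h2.2
      (fun h => absurd h one_ne_zero) (fun _ => h1), fun h => absurd h one_ne_zero,
      fun _ => by omega⟩
    have := min_le_right E.a E.V
    omega
  | main m e m' h =>
    obtain ⟨h1, h1', start, h2, h3, h4⟩ := hs
    -- If there is a process, then b ≤ h forces a solution and a' ≥ 1, hence a positive budget.
    have h5 := h2.tick (fun hn => by rw [h1 hn]; have := (h2.bounds hE hn).2.1; omega) h
    have h6 : m'.D = m.D ∧ (m'.num = 0 ↔ m.num = 0) := by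
      have hi := h2.idx_le
      cases h with
      | micro i hidx hb hf hc =>
        refine ⟨rfl, ?_⟩
        refine ⟨fun h0 => ?_, fun h0 => by omega⟩
        change (if _ then m.num + 1 else m.num) = 0 at h0
        split_ifs at h0
        exact h0
      | _ => exact ⟨rfl, Iff.rfl⟩
    refine ⟨fun hn => ?_, fun hn => ?_, start, h5, fun hn => h3 (h6.2.mp hn),
      fun hn => h4 (fun h0 => hn (h6.2.mpr h0))⟩
    · rw [h6.1]
      exact h1 fun h0 => hn (h6.2.mpr h0)
    · rw [h6.1]
      exact h1' (h6.2.mp hn)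

end Phases

/-! ## The code of the new machine

Registers: `0` and `1` contain the constants `0` and `1`; `2` the phase; `3` the unit `b`; `4` the
distance `W` of the rows; `5` the budget `D`; `6` the stack pointer; `7` the bottom of the stack; `8`
the number of simulated steps in the first phase; `9, 10` the ends of a word; `11` the start of the
word that is copied; `12` the number that is decoded; `13` the number `V`; `14` the index of the
current process and `15` the address of its row; `16` the number of processes and `17` the address
of the row of the last one; `18` the rest of the budget; `23` the number `4 + V`; the others are
temporary. In a row, the cells `1, 2, 3` contain the fields `cnt`, `carry` and `len` of a process, and
its bits are stored from the cell `4 + V` on. -/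

namespace Code

def newRound (k : Code) : Code := op (.copy 14 16) (op (.copy 15 17) (op (.copy 18 5) k))

/-- The three continuations of `sim` treat a silent step, an output and halting. When `b` steps are
done, subtracting register 4 moves the row address from row 1 to row 0, where `Pa` runs. -/
def preCode (M : Program) : Code :=
  ifEq 8 3 (op (.const 2 2) (op (.sub 15 15 4) done))
    (sim M (op (.add 8 8 1) done)
      (op (.add 8 8 1) (op (.copy 11 6) (op (.const 2 1) done)))
      (op (.const 2 4) (op (.const 16 0) (op (.copy 17 15) done))))

/-- Only one letter is copied per tick, since a word may be too long for a tick of constant length.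
The last tick pushes the start address of the word. -/
def copyCode : Code :=
  ifLt 9 10 (op (.load 19 9) (op (.store 6 19) (op (.add 6 6 1) (op (.add 9 9 1) done))))
    (op (.store 6 11) (op (.add 6 6 1) (op (.const 2 0) done)))

def calcCode (Pa : Program) : Code :=
  sim Pa done (op (.const 12 0) (op (.const 2 3) done)) done

def digCode : Code :=
  ifLt 9 10 (op (.sub 10 10 1) (op (.load 19 10) (op (.add 12 12 12) (op (.add 12 12 19)
      (ifLt 13 12 (op (.copy 12 13) done) done)))))
    (op (.const 19 24) (op (.mul 5 19 12) (op (.const 2 4) (newRound done))))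

/-- The stored start address makes popping possible in constant time. Addresses are at least 32, so
the subtractions do not truncate, even for the empty word. -/
def popCode : Code :=
  op (.sub 6 6 1) (op (.load 19 6) (op (.sub 20 6 1) (op (.output 19 20) (op (.copy 6 19)
    (newRound done)))))

def spend : Code := op (.sub 18 18 1) done

def countStep (k : Code) : Code :=
  op (.const 19 1) (op (.add 19 19 15) (op (.load 20 19) (op (.add 20 20 1)
    (ifEq 20 3 (op (.store 19 0) (op (.add 19 19 1) (op (.store 19 1) k))) (op (.store 19 20) k)))))

/-- Register 24 contains the length of the counter and register 14 the number i + 1, so their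
equality means that process i is in its zone. The end of the word in register 10 is exclusive,
whereas `Instr.output` expects the last index. -/
def stepCode (M : Program) : Code :=
  sim M (countStep spend)
    (countStep (ifEq 24 14 (op (.sub 10 10 1) (op (.output 9 10) (newRound done))) spend))
    (op (.const 18 0) done)

def carryTop : Code :=
  op (.store 22 1) (op (.store 19 0) (op (.add 19 19 1) (op (.add 24 24 1) (op (.store 19 24)
    (ifEq 24 14 (op (.add 16 16 1) (op (.add 17 17 4) spend)) spend)))))

def carryBit : Code :=
  op (.load 20 22)
    (ifEq 20 1 (op (.store 22 0) (op (.add 25 25 1) (op (.store 19 25) spend)))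
      (op (.store 22 1) (op (.store 19 0) spend)))

/-- Register 22 receives the address of the bit `carry` - 1, and register 21 its index. -/
def carryCode : Code :=
  op (.add 22 15 23) (op (.add 22 22 25) (op (.sub 22 22 1) (op (.sub 21 25 1)
    (ifEq 21 24 carryTop carryBit))))

/-- The first comparison tests whether the counter is longer than i + 1, the first alternative of
`Proc.Fin`. The second alternative, halting, is discovered in `stepCode`, when no carry is pending.
-/
def procCode (M : Program) : Code :=
  op (.const 19 3) (op (.add 19 19 15) (op (.load 24 19) (ifLt 14 24 (op (.const 18 0) done)
    (op (.const 19 2) (op (.add 19 19 15) (op (.load 25 19) (ifEq 25 0 (stepCode M) carryCode)))))))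

def mainCode (M : Program) : Code :=
  ifEq 14 0 (ifEq 6 7 halt popCode)
    (ifEq 18 0 (op (.sub 14 14 1) (op (.sub 15 15 4) (op (.copy 18 5) done))) (procCode M))

def body (M Pa : Program) : Code :=
  ifEq 2 0 (preCode M) (op (.const 19 1) (ifEq 2 19 copyCode (op (.const 19 2) (ifEq 2 19
    (calcCode Pa) (op (.const 19 3) (ifEq 2 19 digCode (mainCode M)))))))

end Code

/-! ### Representation of the abstract states in memory -/

/-- The stack of words in the registers, from address `32` on; each word is followed by its own
address. -/
def StackRel (r : ℕ → ℕ) (word : ℕ → List ℕ) : List ℕ → ℕ → Prop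
  | [], sp => sp = 32
  | u :: st, sp => ∃ q, StackRel r word st q ∧ Stored r q (word u) ∧
      r (q + (word u).length) = q ∧ sp = q + (word u).length + 1

theorem StackRel.le {r : ℕ → ℕ} {word : ℕ → List ℕ} {st : List ℕ} {sp : ℕ}
    (h : StackRel r word st sp) : 32 ≤ sp := by
  induction st generalizing sp with
  | nil => exact le_of_eq h.symm
  | cons u st ih =>
    obtain ⟨q, hq, _, _, rfl⟩ := h
    have := ih hq
    omega

theorem StackRel.le_mul {r : ℕ → ℕ} {word : ℕ → List ℕ} {st : List ℕ} {sp V : ℕ}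
    (h : StackRel r word st sp) (hV : ∀ u, (word u).length ≤ V) :
    sp ≤ 32 + st.length * (V + 1) := by
  induction st generalizing sp with
  | nil => exact le_of_eq_of_le h (Nat.le_add_right _ _)
  | cons u st ih =>
    obtain ⟨q, hq, _, _, rfl⟩ := h
    have := ih hq
    have := hV u
    rw [List.length_cons, add_mul, one_mul]
    omega

theorem Stored.congr {r r' : ℕ → ℕ} {a : ℕ} {w : List ℕ} (h : Stored r a w)
    (hr : ∀ i, a ≤ i → i < a + w.length → r' i = r i) : Stored r' a w := fun i hi => by
  rw [hr _ (by omega) (by omega), h i hi]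

theorem StackRel.congr {r r' : ℕ → ℕ} {word : ℕ → List ℕ} {st : List ℕ} {sp : ℕ}
    (h : StackRel r word st sp) (hr : ∀ i, 32 ≤ i → i < sp → r' i = r i) :
    StackRel r' word st sp := by
  induction st generalizing sp with
  | nil => exact h
  | cons u st ih =>
    obtain ⟨q, hq, h1, h2, rfl⟩ := h
    have hq32 := hq.le
    exact ⟨q, ih hq fun i h3 h4 => hr i h3 (by omega),
      h1.congr fun i h3 h4 => hr i (by omega) (by omega), by rw [hr _ (by omega) (by omega), h2], rfl⟩

/-- The row at address `p` contains the process `P`. -/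
structure RowProc {σ : ℕ} (M : Program) (x : Word σ) (V W : ℕ) (r : ℕ → ℕ) (p : ℕ) (P : Proc) :
    Prop where
  holds : Holds V p (run M x P.t) r
  cnt : r (p + 1) = P.cnt
  carry : r (p + 2) = P.carry
  len : r (p + 3) = P.len
  bits : ∀ i, 4 + V + i < W → r (p + 4 + V + i) = P.bits i

theorem RowProc.congr {σ : ℕ} {M : Program} {x : Word σ} {V W : ℕ} {r r' : ℕ → ℕ} {p : ℕ}
    {P : Proc} (h : RowProc M x V W r p P) (hW : 4 + V ≤ W)
    (hr : ∀ i, p ≤ i → i < p + W → r' i = r i) : RowProc M x V W r' p P := by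
  refine ⟨⟨?_, fun d hd => ?_⟩, ?_, ?_, ?_, fun i hi => ?_⟩
  · rw [hr _ (by omega) (by omega)]; exact h.holds.1
  · rw [hr _ (by omega) (by omega)]; exact h.holds.2 d hd
  · rw [hr _ (by omega) (by omega)]; exact h.cnt
  · rw [hr _ (by omega) (by omega)]; exact h.carry
  · rw [hr _ (by omega) (by omega)]; exact h.len
  · rw [hr _ (by omega) (by omega)]; exact h.bits i hi

theorem Holds.congr {V p : ℕ} {c : Config} {r r' : ℕ → ℕ} (h : Holds V p c r)
    (hr : ∀ i, p ≤ i → i < p + 4 + V → r' i = r i) : Holds V p c r' := by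
  refine ⟨?_, fun d hd => ?_⟩
  · rw [hr _ (by omega) (by omega)]; exact h.1
  · rw [hr _ (by omega) (by omega)]; exact h.2 d hd

theorem Agree.scalar {V p : ℕ} {r r' : ℕ → ℕ} (h : Agree V p r r') {i : ℕ} (hp : 32 ≤ p)
    (hi : i < 9 ∨ (10 < i ∧ i < 19) ∨ (22 < i ∧ i < 32)) : r' i = r i :=
  h i (by unfold IsTemp; omega) (by omega) (by omega)

theorem Agree.mem {V p : ℕ} {r r' : ℕ → ℕ} (h : Agree V p r r') {i : ℕ} (hi : 32 ≤ i) (h1 : i ≠ p)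
    (h2 : i < p + 4 ∨ p + 4 + V ≤ i) : r' i = r i :=
  h i (by unfold IsTemp; omega) h1 (by omega)

/-- The address of the row `j`. -/
def Env.row (E : Env) (W j : ℕ) : ℕ := 32 + E.b * (E.V + 1) + j * W

/-- The parameters `E` belong to the computations of `M` and `Pa` on `x`, and the sizes `W` of the
rows and `S` of the memory suffice for `B` processes. -/
structure Setup {σ : ℕ} (M Pa : Program) (x : Word σ) (E : Env) (W B S : ℕ) : Prop where
  ok : E.OK
  em_eq : ∀ u, E.em u = (emits M x u).isSome
  wl_eq : ∀ u, E.wl u = (wordAt M x u).length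
  halted : Halted M (run M x E.h)
  not_halted : ∀ t < E.h, ¬ Halted M (run M x t)
  pcBound_M : pcBound M ≤ E.V
  pcBound_Pa : pcBound Pa ≤ E.V
  reg_M : ∀ t i, (run M x t).reg i ≤ E.V
  reg_Pa : ∀ t i, (run Pa x t).reg i ≤ E.V
  accessed_M : ∀ t I, M[(run M x t).pc]? = some I → I.accessed (run M x t).reg ≤ E.V
  accessed_Pa : ∀ t I, Pa[(run Pa x t).pc]? = some I → I.accessed (run Pa x t).reg ≤ E.V
  calc_none : ∀ i < E.ia, emits Pa x i = none
  calc_not_halted : ∀ i ≤ E.ia, ¬ Halted Pa (run Pa x i)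
  calc_out : emits Pa x E.ia = some E.digits
  digits_lt : ∀ d ∈ E.digits, d < 2
  count_lt : E.count E.h < 2 ^ B
  le_W : 4 + E.V + B + 4 ≤ W
  le_S : E.row W (B + 4) ≤ S

/-- The registers with constant contents. -/
structure Consts (E : Env) (W : ℕ) (r : ℕ → ℕ) : Prop where
  r0 : r 0 = 0
  r1 : r 1 = 1
  r3 : r 3 = E.b
  r4 : r 4 = W
  r7 : r 7 = 32
  r13 : r 13 = E.V
  r23 : r 23 = 4 + E.V

/-- The contents of further registers before the last phase. -/
structure Before {σ : ℕ} (M : Program) (x : Word σ) (E : Env) (W : ℕ) (r : ℕ → ℕ) : Prop where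
  consts : Consts E W r
  r5 : r 5 = 0
  r14 : r 14 = 0
  r16 : r 16 = 1
  r17 : r 17 = E.row W 2
  r18 : r 18 = 0
  rows : ∀ z, RowProc M x E.V W r (E.row W (z + 2)) Proc.init

/-- The registers represent the state. -/
def Rel {σ : ℕ} (M Pa : Program) (x : Word σ) (E : Env) (W : ℕ) : State → (ℕ → ℕ) → Prop
  | .pre t st, r => Before M x E W r ∧ r 2 = 0 ∧ r 8 = t ∧ r 15 = E.row W 1 ∧
      StackRel r (wordAt M x) st (r 6) ∧ Holds E.V (E.row W 1) (run M x t) r ∧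
      Holds E.V (E.row W 0) (run Pa x 0) r
  | .copy t st j, r => Before M x E W r ∧ r 2 = 1 ∧ r 8 = t + 1 ∧ r 15 = E.row W 1 ∧
      StackRel r (wordAt M x) st (r 11) ∧ r 6 = r 11 + j ∧
      (∃ A, E.row W 1 ≤ A ∧ r 9 = A + j ∧ (wordAt M x t).length = r 10 - A ∧
        Stored r A (wordAt M x t)) ∧ Stored r (r 11) ((wordAt M x t).take j) ∧
      Holds E.V (E.row W 1) (run M x (t + 1)) r ∧ Holds E.V (E.row W 0) (run Pa x 0) r
  | .eval i st, r => Before M x E W r ∧ r 2 = 2 ∧ r 15 = E.row W 0 ∧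
      StackRel r (wordAt M x) st (r 6) ∧ Holds E.V (E.row W 0) (run Pa x i) r
  | .dig i v st, r => Before M x E W r ∧ r 2 = 3 ∧ r 12 = v ∧
      StackRel r (wordAt M x) st (r 6) ∧ i = r 10 - r 9 ∧ 32 ≤ r 9 ∧ Stored r (r 9) E.digits
  | .main m, r => Consts E W r ∧ r 2 = 4 ∧ r 5 = m.D ∧ r 14 = m.idx ∧ r 15 = E.row W (m.idx + 1) ∧
      r 16 = m.num ∧ r 17 = E.row W (m.num + 1) ∧ r 18 = m.budget ∧
      StackRel r (wordAt M x) m.stack (r 6) ∧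
      ∀ z, RowProc M x E.V W r (E.row W (z + 2)) (m.procs z)

/-- The code has executed one tick from the state `s`, or halts in a final state. -/
structure TickPost {σ : ℕ} (M Pa : Program) (x : Word σ) (E : Env) (W : ℕ) (s : State) (halts : Prop)
    (r : ℕ → ℕ) (o : List (List ℕ)) : Prop where
  halt : halts → ∃ m, s = .main m ∧ m.stack = [] ∧ o = []
  tick : ¬ halts → ∃ e s', Tick E s e s' ∧ Rel M Pa x E W s' r ∧ o = e.toList.map (wordAt M x)

/-! ### Correctness of the code before the scheduler starts -/

section Ticks

variable {σ : ℕ} {M Pa : Program} {x : Word σ} {E : Env} {W B S now : ℕ} {es : List (ℕ × ℕ)}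
  {r : ℕ → ℕ}

theorem TickPost.of_tick {s s' : State} {e : Option ℕ} {o : List (List ℕ)} (ht : Tick E s e s')
    (hr : Rel M Pa x E W s' r) (ho : o = e.toList.map (wordAt M x)) :
    TickPost M Pa x E W s False r o :=
  ⟨False.elim, fun _ => ⟨e, s', ht, hr, ho⟩⟩

theorem row_succ (j : ℕ) : E.row W (j + 1) = E.row W j + W := by
  unfold Env.row
  ring

theorem row_mono {i j : ℕ} (h : i ≤ j) : E.row W i ≤ E.row W j := by
  unfold Env.row
  have := Nat.mul_le_mul_right W h
  omega

/-- Distinct rows do not overlap. Row 0 is used by `Pa`, row 1 by `M` in the first phase and row z +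
2 by process z; the stack lies below row 0. -/
theorem row_add_le {i j : ℕ} (h : i < j) : E.row W i + W ≤ E.row W j := by
  rw [← row_succ]
  exact row_mono h

theorem le_row (j : ℕ) : 32 ≤ E.row W j := by
  unfold Env.row
  omega

theorem Before.congr {r' : ℕ → ℕ} (h : Before M x E W r) (hW : 4 + E.V ≤ W)
    (h1 : ∀ i < 32, i ≠ 2 → i ≠ 6 → i < 8 ∨ 12 < i → i ≠ 15 → i < 19 ∨ 22 < i → r' i = r i)
    (h2 : ∀ i, E.row W 2 ≤ i → r' i = r i) : Before M x E W r' := by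
  have hc := h.consts
  refine ⟨⟨?_, ?_, ?_, ?_, ?_, ?_, ?_⟩, ?_, ?_, ?_, ?_, ?_, fun z => (h.rows z).congr hW ?_⟩
  · rw [h1 _ (by omega) (by omega) (by omega) (by omega) (by omega) (by omega)]; exact hc.r0
  · rw [h1 _ (by omega) (by omega) (by omega) (by omega) (by omega) (by omega)]; exact hc.r1
  · rw [h1 _ (by omega) (by omega) (by omega) (by omega) (by omega) (by omega)]; exact hc.r3
  · rw [h1 _ (by omega) (by omega) (by omega) (by omega) (by omega) (by omega)]; exact hc.r4
  · rw [h1 _ (by omega) (by omega) (by omega) (by omega) (by omega) (by omega)]; exact hc.r7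
  · rw [h1 _ (by omega) (by omega) (by omega) (by omega) (by omega) (by omega)]; exact hc.r13
  · rw [h1 _ (by omega) (by omega) (by omega) (by omega) (by omega) (by omega)]; exact hc.r23
  · rw [h1 _ (by omega) (by omega) (by omega) (by omega) (by omega) (by omega)]; exact h.r5
  · rw [h1 _ (by omega) (by omega) (by omega) (by omega) (by omega) (by omega)]; exact h.r14
  · rw [h1 _ (by omega) (by omega) (by omega) (by omega) (by omega) (by omega)]; exact h.r16
  · rw [h1 _ (by omega) (by omega) (by omega) (by omega) (by omega) (by omega)]; exact h.r17
  · rw [h1 _ (by omega) (by omega) (by omega) (by omega) (by omega) (by omega)]; exact h.r18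
  · intro i hi _
    exact h2 i ((row_mono (by omega)).trans hi)

theorem Consts.congr {r' : ℕ → ℕ} (hc : Consts E W r)
    (h1 : ∀ i < 24, i < 2 ∨ i = 3 ∨ i = 4 ∨ i = 7 ∨ i = 13 ∨ i = 23 → r' i = r i) :
    Consts E W r' := by
  refine ⟨?_, ?_, ?_, ?_, ?_, ?_, ?_⟩
  · rw [h1 _ (by omega) (by omega)]; exact hc.r0
  · rw [h1 _ (by omega) (by omega)]; exact hc.r1
  · rw [h1 _ (by omega) (by omega)]; exact hc.r3
  · rw [h1 _ (by omega) (by omega)]; exact hc.r4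
  · rw [h1 _ (by omega) (by omega)]; exact hc.r7
  · rw [h1 _ (by omega) (by omega)]; exact hc.r13
  · rw [h1 _ (by omega) (by omega)]; exact hc.r23

theorem Setup.simReady_M (hS : Setup M Pa x E W B S) {t j : ℕ} (hj : j ≤ B + 1)
    (h15 : r 15 = E.row W j) (h1 : r 1 = 1) (hH : Holds E.V (E.row W j) (run M x t) r) :
    SimReady M x S E.V (E.row W j) (run M x t) r := by
  have h2 := hS.le_W
  have h3 := hS.le_S
  have h4 := row_mono (E := E) (W := W) hj
  have h5 := row_add_le (E := E) (W := W) (show B + 1 < B + 2 by omega)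
  have h6 := row_add_le (E := E) (W := W) (show B + 2 < B + 3 by omega)
  have h7 := row_add_le (E := E) (W := W) (show B + 3 < B + 4 by omega)
  have h8 := le_row (E := E) (W := W) j
  refine ⟨h15, h1, h8, by omega, by have := hS.pcBound_M; omega, hS.reg_M t, fun i => ?_, run_pc_le t,
    hS.accessed_M t, hH⟩
  rw [← run_succ]
  exact hS.reg_M _ i

theorem Setup.simReady_Pa (hS : Setup M Pa x E W B S) {t j : ℕ} (hj : j ≤ B + 1)
    (h15 : r 15 = E.row W j) (h1 : r 1 = 1) (hH : Holds E.V (E.row W j) (run Pa x t) r) :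
    SimReady Pa x S E.V (E.row W j) (run Pa x t) r := by
  have h2 := hS.le_W
  have h3 := hS.le_S
  have h4 := row_mono (E := E) (W := W) hj
  have h5 := row_add_le (E := E) (W := W) (show B + 1 < B + 2 by omega)
  have h6 := row_add_le (E := E) (W := W) (show B + 2 < B + 3 by omega)
  have h7 := row_add_le (E := E) (W := W) (show B + 3 < B + 4 by omega)
  have h8 := le_row (E := E) (W := W) j
  refine ⟨h15, h1, h8, by omega, by have := hS.pcBound_Pa; omega, hS.reg_Pa t, fun i => ?_, run_pc_le t,
    hS.accessed_Pa t, hH⟩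
  rw [← run_succ]
  exact hS.reg_Pa _ i

/-- Simple bounds on the size of the memory. -/
theorem Setup.bounds (hS : Setup M Pa x E W B S) : E.b + 64 ≤ S ∧ 4 + E.V + 1 ≤ W ∧
    E.row W 0 = 32 + E.b * (E.V + 1) ∧ E.row W 0 + 4 * W ≤ S ∧ E.row W 1 = E.row W 0 + W ∧
    E.row W 2 = E.row W 1 + W ∧ E.b = 24 * E.V := by
  have h1 := hS.le_W
  have h2 := hS.le_S
  have h3 : E.row W 0 + 4 * W ≤ E.row W (B + 4) := by
    have := row_mono (E := E) (W := W) (show 4 ≤ B + 4 by omega)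
    have h4 : E.row W 4 = E.row W 0 + 4 * W := by unfold Env.row; ring
    omega
  have h5 : E.row W 0 = 32 + E.b * (E.V + 1) := by unfold Env.row; ring
  have h6 : E.b ≤ E.b * (E.V + 1) := Nat.le_mul_of_pos_right _ (Nat.succ_pos _)
  have h7 := hS.ok.one_le_V
  have h8 : 36 ≤ 4 * W + 16 := by omega
  have h9 : E.b * 2 ≤ E.b * (E.V + 1) := Nat.mul_le_mul_left _ (by omega)
  have h10 : E.b = 24 * E.V := rfl
  exact ⟨by omega, by omega, h5, by omega, row_succ 0, row_succ 1, h10⟩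

/-- The stacked steps are distinct and below `t`, so there are at most `t` words, each with at most
V letters and one address. -/
theorem Setup.stack_le (hS : Setup M Pa x E W B S) {t : ℕ} {st : List ℕ} {sp : ℕ}
    (hst : StackRel r (wordAt M x) st sp) (h1 : st.Nodup) (h2 : ∀ u ∈ st, u < t) :
    sp ≤ 32 + t * (E.V + 1) := by
  have hq := hst.le_mul (V := E.V) fun u => by rw [← hS.wl_eq u]; exact hS.ok.wl_le u
  have h3 : st.length ≤ t := by
    have : st.toFinset ⊆ range t := fun u hu => Finset.mem_range.mpr (h2 u (List.mem_toFinset.mp hu))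
    have := Finset.card_le_card this
    rwa [List.toFinset_card_of_nodup h1, Finset.card_range] at this
  have h4 := Nat.mul_le_mul_right (E.V + 1) h3
  omega

theorem Setup.halted_iff (hS : Setup M Pa x E W B S) {t : ℕ} :
    Halted M (run M x t) ↔ E.h ≤ t := by
  constructor
  · intro h
    by_contra hc
    exact hS.not_halted t (by omega) h
  · intro h
    rw [run_of_halted hS.halted h]
    exact hS.halted

theorem wp_copyCode (hS : Setup M Pa x E W B S) {t : ℕ} {st : List ℕ} {j : ℕ}
    (hr : ∀ i, r i ≤ S) (hR : Rel M Pa x E W (.copy t st j) r)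
    (hI : SInv E now es (.copy t st j)) :
    Code.copyCode.wp x S (TickPost M Pa x E W (.copy t st j)) r [] := by
  obtain ⟨hB, r2, r8, r15, hst, r6, ⟨A, hA, r9, hlen, hword⟩, hpart, hH1, hH0⟩ := hR
  obtain ⟨htb, hth, hem, hstk, hj, -, -⟩ := hI
  obtain ⟨b1, b2, b3, b4, b5, b6, b7⟩ := hS.bounds
  have hwl := hS.wl_eq t
  have hwV := hS.ok.wl_le t
  have hc := hB.consts
  have r1 := hc.r1
  have hsp := hst.le
  -- There is still room for the current word and its address. The word is copied from row 1, so the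
  -- copy cannot overwrite its source.
  have hq' : r 11 + (E.V + 1) ≤ E.row W 0 := by
    have hq := hS.stack_le hst hstk.1 fun u hu => ((hstk.2 u).mp hu).1
    have h2 : (t + 1) * (E.V + 1) ≤ E.b * (E.V + 1) := Nat.mul_le_mul_right _ (by omega)
    rw [add_mul, one_mul] at h2
    omega
  have h10 := hr 10
  have hA' := hr (A + j)
  have hlp : ((wordAt M x t).take j).length = j := by rw [List.length_take]; omega
  simp (disch := omega) only [Code.copyCode, Code.wp, Instr.Straight, Instr.accessed, Instr.written,
    Instr.nextReg, Instr.emitted, Function.update_self, Function.update_of_ne, List.append_nil,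
    true_and, r1, r6, r9]
  refine ⟨by omega, by omega, fun h => ?_, fun h => ?_⟩
  · repeat refine And.intro (by omega) ?_
    refine .of_tick (.copyLetter t st j (by omega)) ?_ rfl
    have e1 : r (A + j) = (wordAt M x t)[j]'(by omega) := hword j (by omega)
    generalize hr' : Function.update _ 9 _ = r'
    have e : ∀ i, i ≠ 19 → i ≠ 6 → i ≠ 9 → i ≠ r 11 + j → r' i = r i := fun i _ _ _ _ => by
      rw [← hr']; simp (disch := omega) only [Function.update_of_ne]
    have e6 : r' 6 = r 11 + j + 1 := by
      rw [← hr']; simp (disch := omega) only [Function.update_of_ne, Function.update_self]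
    have e9 : r' 9 = A + j + 1 := by rw [← hr', Function.update_self]
    have eq : r' (r 11 + j) = r (A + j) := by
      rw [← hr']; simp (disch := omega) only [Function.update_of_ne, Function.update_self]
    have e11 := e 11 (by omega) (by omega) (by omega) (by omega)
    refine ⟨hB.congr (by omega) (fun i _ _ _ _ _ _ => e i (by omega) (by omega) (by omega) (by omega))
      fun i hi => e i (by omega) (by omega) (by omega) (by omega), ?_, ?_, ?_, ?_, ?_,
      ⟨A, hA, by omega, ?_, ?_⟩, ?_, ?_, ?_⟩
    · rw [e 2 (by omega) (by omega) (by omega) (by omega), r2]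
    · rw [e 8 (by omega) (by omega) (by omega) (by omega), r8]
    · rw [e 15 (by omega) (by omega) (by omega) (by omega), r15]
    · rw [e11]
      exact hst.congr fun i h1 h2 => e i (by omega) (by omega) (by omega) (by omega)
    · omega
    · rw [e 10 (by omega) (by omega) (by omega) (by omega), hlen]
    · exact hword.congr fun i h1 h2 => e i (by omega) (by omega) (by omega) (by omega)
    · intro i hi
      rw [e11, List.getElem_take]
      rw [List.length_take] at hi
      rcases Nat.lt_or_ge i j with h1 | h1
      · rw [e _ (by omega) (by omega) (by omega) (by omega), hpart i (by omega), List.getElem_take]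
      · obtain rfl : i = j := by omega
        rw [eq, e1]
    · exact hH1.congr fun i h1 h2 => e i (by omega) (by omega) (by omega) (by omega)
    · exact hH0.congr fun i h1 h2 => e i (by omega) (by omega) (by omega) (by omega)
  · repeat refine And.intro (by omega) ?_
    refine .of_tick (.copyEnd t st j (by omega)) ?_ rfl
    have hjl : j = (wordAt M x t).length := by omega
    rw [List.take_of_length_le (by omega)] at hpart
    generalize hr' : Function.update _ 2 _ = r'
    have e : ∀ i, i ≠ 2 → i ≠ 6 → i ≠ r 11 + j → r' i = r i := fun i _ _ _ => by
      rw [← hr']; simp (disch := omega) only [Function.update_of_ne]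
    have e6 : r' 6 = r 11 + j + 1 := by
      rw [← hr']; simp (disch := omega) only [Function.update_of_ne, Function.update_self]
    have e2 : r' 2 = 0 := by rw [← hr', Function.update_self]
    have eq : r' (r 11 + j) = r 11 := by
      rw [← hr']; simp (disch := omega) only [Function.update_of_ne, Function.update_self]
    refine ⟨hB.congr (by omega) (fun i _ _ _ _ _ _ => e i (by omega) (by omega) (by omega))
      fun i hi => e i (by omega) (by omega) (by omega), e2, ?_, ?_, ?_, ?_, ?_⟩
    · rw [e 8 (by omega) (by omega) (by omega), r8]
    · rw [e 15 (by omega) (by omega) (by omega), r15]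
    · refine ⟨r 11, hst.congr fun i h1 h2 => e i (by omega) (by omega) (by omega),
        hpart.congr fun i h1 h2 => e i (by omega) (by omega) (by omega), ?_, ?_⟩
      · rw [← hjl, eq]
      · rw [e6, hjl]
    · exact hH1.congr fun i h1 h2 => e i (by omega) (by omega) (by omega)
    · exact hH0.congr fun i h1 h2 => e i (by omega) (by omega) (by omega)

theorem wp_preCode (hS : Setup M Pa x E W B S) {t : ℕ} {st : List ℕ}
    (hr : ∀ i, r i ≤ S) (hR : Rel M Pa x E W (.pre t st) r) (hI : SInv E now es (.pre t st)) :
    (Code.preCode M).wp x S (TickPost M Pa x E W (.pre t st)) r [] := by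
  obtain ⟨hB, r2, r8, r15, hst, hH1, hH0⟩ := hR
  obtain ⟨htb, hth, hstk, -, -⟩ := hI
  obtain ⟨b1, b2, b3, b4, b5, b6, b7⟩ := hS.bounds
  have hc := hB.consts
  have r1 := hc.r1
  have r3 := hc.r3
  have r4 := hc.r4
  have hsp := hst.le
  have hq' : r 6 ≤ E.row W 0 := by
    have hq := hS.stack_le hst hstk.1 fun u hu => ((hstk.2 u).mp hu).1
    have h2 : t * (E.V + 1) ≤ E.b * (E.V + 1) := Nat.mul_le_mul_right _ (by omega)
    omega
  refine ⟨by omega, by omega, fun h => ?_, fun h => ?_⟩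
  · obtain rfl : t = E.b := by omega
    simp (disch := omega) only [Code.wp, Instr.Straight, Instr.accessed, Instr.written,
      Instr.nextReg, Instr.emitted, Function.update_of_ne, List.append_nil,
      true_and, r4, r15]
    repeat refine And.intro (by omega) ?_
    refine .of_tick (.preEnd st) ?_ rfl
    generalize hr' : Function.update _ 15 _ = r'
    have e : ∀ i, i ≠ 2 → i ≠ 15 → r' i = r i := fun i _ _ => by
      rw [← hr']; simp (disch := omega) only [Function.update_of_ne]
    refine ⟨hB.congr (by omega) (fun i _ _ _ _ _ _ => e i (by omega) (by omega))
      fun i hi => e i (by omega) (by omega), ?_, ?_, ?_, ?_⟩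
    · rw [← hr']; simp (disch := omega) only [Function.update_of_ne, Function.update_self]
    · rw [← hr', Function.update_self]; omega
    · rw [e 6 (by omega) (by omega)]
      exact hst.congr fun i h1 h2 => e i (by omega) (by omega)
    · exact hH0.congr fun i h1 h2 => e i (by omega) (by omega)
  · have htb' : t < E.b := by omega
    refine wp_sim (hS.simReady_M (by omega) r15 r1 hH1) ?_ ?_ ?_
    · intro hh r' e
      have e : ∀ i, i < 9 ∨ (10 < i ∧ i < 19) ∨ 22 < i → r' i = r i := fun i hi =>
        e i (by unfold IsTemp; omega)
      have e15 := e 15 (by omega)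
      simp (disch := omega) only [Code.wp, Instr.Straight, Instr.accessed, Instr.written,
        Instr.nextReg, Instr.emitted, Function.update_of_ne, List.append_nil,
        true_and, e15, r15]
      repeat refine And.intro (by omega) ?_
      refine .of_tick (.preHalt t st htb' (hS.halted_iff.mp hh)) ?_ rfl
      generalize hr' : Function.update _ 17 _ = r''
      have e' : ∀ i, i < 9 ∧ i ≠ 2 ∨ (10 < i ∧ i < 19 ∧ i ≠ 16 ∧ i ≠ 17) ∨ 22 < i → r'' i = r i :=
        fun i hi => by
          rw [← hr']; simp (disch := omega) only [Function.update_of_ne]; exact e i (by omega)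
      refine ⟨hc.congr fun i _ _ => e' i (by omega), ?_, ?_, ?_, ?_, ?_, ?_, ?_, ?_, fun z => ?_⟩
      · rw [← hr']; simp (disch := omega) only [Function.update_of_ne, Function.update_self]
      · rw [e' 5 (by omega), hB.r5]; rfl
      · rw [e' 14 (by omega), hB.r14]; rfl
      · rw [e' 15 (by omega), r15]; rfl
      · rw [← hr']; simp (disch := omega) only [Function.update_of_ne, Function.update_self]; rfl
      · rw [← hr', Function.update_self]; rfl
      · rw [e' 18 (by omega), hB.r18]; rfl
      · rw [e' 6 (by omega)]
        exact hst.congr fun i h1 h2 => e' i (by omega)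
      · refine (hB.rows z).congr (by omega) fun i h1 h2 => e' i ?_
        have := le_row (E := E) (W := W) (z + 2)
        omega
    · intro r' ho hh hA hH
      have hrow0 := le_row (E := E) (W := W) 0
      have e8 := hA.scalar (i := 8) (by omega) (by omega)
      have e1 := hA.scalar (i := 1) (by omega) (by omega)
      simp (disch := omega) only [Code.wp, Instr.Straight, Instr.accessed, Instr.written,
        Instr.nextReg, Instr.emitted, List.append_nil, true_and, e8, r8, e1, r1]
      repeat refine And.intro (by omega) ?_
      refine .of_tick (.preStep t st htb' (not_le.mp fun h => hh (hS.halted_iff.mpr h)) ?_) ?_ rfl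
      · rw [hS.em_eq, emits, ho]
        rfl
      generalize hr' : Function.update _ 8 _ = r''
      have e : ∀ i, i ≠ 8 → r'' i = r' i := fun i _ => by
        rw [← hr']; simp (disch := omega) only [Function.update_of_ne]
      have e' : ∀ i, i < 8 ∨ (10 < i ∧ i < 19) ∨ (22 < i ∧ i < 32) → r'' i = r i := fun i hi => by
        rw [e i (by omega)]
        exact hA.scalar (by omega) (by omega)
      have e'' : ∀ i, 32 ≤ i → i < E.row W 1 ∨ E.row W 1 + 4 + E.V ≤ i → r'' i = r i := fun i h1 h2 => by
        rw [e i (by omega)]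
        exact hA.mem h1 (by omega) (by omega)
      refine ⟨hB.congr (by omega) (fun i _ _ _ _ _ _ => e' i (by omega))
        fun i hi => e'' i (by omega) (by omega), ?_, ?_, ?_, ?_, ?_, ?_⟩
      · rw [e' 2 (by omega), r2]
      · rw [← hr', Function.update_self]
      · rw [e' 15 (by omega), r15]
      · rw [e' 6 (by omega)]
        exact hst.congr fun i h1 h2 => e'' i (by omega) (by omega)
      · rw [run_succ]
        exact hH.congr fun i h1 h2 => e i (by omega)
      · exact hH0.congr fun i h1 h2 => e'' i (by omega) (by omega)
    · intro r' w ho hA hH hw hword h9 h10 h10'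
      have hrow0 := le_row (E := E) (W := W) 0
      have hem : emits M x t = some w := ho
      have hword' : wordAt M x t = w := by simp [wordAt, hem]
      have e8 := hA.scalar (i := 8) (by omega) (by omega)
      have e1 := hA.scalar (i := 1) (by omega) (by omega)
      have e6 := hA.scalar (i := 6) (by omega) (by omega)
      have := hr 6
      simp (disch := omega) only [Code.wp, Instr.Straight, Instr.accessed, Instr.written,
        Instr.nextReg, Instr.emitted, List.append_nil, true_and, e8, r8, e1, r1,
        Function.update_of_ne, e6]
      repeat refine And.intro (by omega) ?_
      have hh : ¬ Halted M (run M x t) := not_halted_of_emits (by simp [hem])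
      refine .of_tick (.preOut t st htb' (not_le.mp fun h => hh (hS.halted_iff.mpr h)) ?_) ?_ rfl
      · rw [hS.em_eq, hem]
        rfl
      generalize hr' : Function.update _ 2 _ = r''
      have e : ∀ i, i ≠ 8 → i ≠ 11 → i ≠ 2 → r'' i = r' i := fun i _ _ _ => by
        rw [← hr']; simp (disch := omega) only [Function.update_of_ne]
      have e' : ∀ i, i < 8 ∧ i ≠ 2 ∨ (11 < i ∧ i < 19) ∨ (22 < i ∧ i < 32) → r'' i = r i :=
        fun i hi => by
          rw [e i (by omega) (by omega) (by omega)]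
          exact hA.scalar (by omega) (by omega)
      have e'' : ∀ i, 32 ≤ i → i < E.row W 1 ∨ E.row W 1 + 4 + E.V ≤ i → r'' i = r i := fun i h1 h2 => by
        rw [e i (by omega) (by omega) (by omega)]
        exact hA.mem h1 (by omega) (by omega)
      have e11 : r'' 11 = r 6 := by
        rw [← hr']; simp (disch := omega) only [Function.update_of_ne, Function.update_self]
      refine ⟨hB.congr (by omega) (fun i _ _ _ _ _ _ => e' i (by omega))
        fun i hi => e'' i (by omega) (by omega), ?_, ?_, ?_, ?_, ?_, ⟨r' 9, by omega, ?_, ?_, ?_⟩,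
        ?_, ?_, ?_⟩
      · rw [← hr', Function.update_self]
      · rw [← hr']; simp (disch := omega) only [Function.update_of_ne, Function.update_self]
      · rw [e' 15 (by omega), r15]
      · rw [e11]
        exact hst.congr fun i h1 h2 => e'' i (by omega) (by omega)
      · rw [e' 6 (by omega), e11]; rfl
      · rw [e 9 (by omega) (by omega) (by omega)]; rfl
      · rw [e 10 (by omega) (by omega) (by omega), hword', hw]
      · rw [hword']
        exact hword.congr fun i h1 h2 => e i (by omega) (by omega) (by omega)
      · intro i hi
        simp at hi
      · rw [run_succ]
        exact hH.congr fun i h1 h2 => e i (by omega) (by omega) (by omega)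
      · exact hH0.congr fun i h1 h2 => e'' i (by omega) (by omega)

theorem wp_calcCode (hS : Setup M Pa x E W B S) {t : ℕ} {st : List ℕ}
    (hR : Rel M Pa x E W (.eval t st) r) (hI : SInv E now es (.eval t st)) :
    (Code.calcCode Pa).wp x S (TickPost M Pa x E W (.eval t st)) r [] := by
  obtain ⟨hB, r2, r15, hst, hH0⟩ := hR
  obtain ⟨hbh, hstk, hti, -, -⟩ := hI
  obtain ⟨b1, b2, b3, b4, b5, b6, b7⟩ := hS.bounds
  have hc := hB.consts
  have r1 := hc.r1
  have hsp := hst.le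
  have hq' : r 6 ≤ E.row W 0 := by
    have hq := hS.stack_le hst hstk.1 fun u hu => ((hstk.2 u).mp hu).1
    omega
  have hrow0 := le_row (E := E) (W := W) 0
  refine wp_sim (hS.simReady_Pa (by omega) r15 r1 hH0) ?_ ?_ ?_
  · intro hh
    exact absurd hh (hS.calc_not_halted t hti)
  · intro r' ho hh hA hH
    have hti' : t < E.ia := by
      refine lt_of_le_of_ne hti fun h => ?_
      have h1 : emits Pa x t = none := ho
      rw [h, hS.calc_out] at h1
      cases h1
    refine .of_tick (.calcStep t st hti') ?_ rfl
    have e' : ∀ i, i < 9 ∨ (10 < i ∧ i < 19) ∨ (22 < i ∧ i < 32) → r' i = r i := fun i hi =>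
      hA.scalar (by omega) (by omega)
    have e'' : ∀ i, 32 ≤ i → i < E.row W 0 ∨ E.row W 0 + 4 + E.V ≤ i → r' i = r i := fun i h1 h2 =>
      hA.mem h1 (by omega) (by omega)
    refine ⟨hB.congr (by omega) (fun i _ _ _ _ _ _ => e' i (by omega))
      fun i hi => e'' i (by omega) (by omega), ?_, ?_, ?_, ?_⟩
    · rw [e' 2 (by omega), r2]
    · rw [e' 15 (by omega), r15]
    · rw [e' 6 (by omega)]
      exact hst.congr fun i h1 h2 => e'' i (by omega) (by omega)
    · rw [run_succ]
      exact hH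
  · intro r' w ho hA hH hw hword h9 h10 h10'
    have hem : emits Pa x t = some w := ho
    -- `Pa` outputs nothing before step `ia`, so this output is the list of digits.
    obtain rfl : t = E.ia := by
      by_contra h
      rw [hS.calc_none t (by omega)] at hem
      cases hem
    rw [hS.calc_out] at hem
    obtain rfl := Option.some.inj hem
    simp (disch := omega) only [Code.wp, Instr.Straight, Instr.accessed, Instr.written,
      Instr.nextReg, Instr.emitted, List.append_nil, true_and]
    repeat refine And.intro (by omega) ?_
    refine .of_tick (.calcOut st) ?_ rfl
    generalize hr' : Function.update _ 2 _ = r''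
    have e : ∀ i, i ≠ 12 → i ≠ 2 → r'' i = r' i := fun i _ _ => by
      rw [← hr']; simp (disch := omega) only [Function.update_of_ne]
    have e' : ∀ i, i < 9 ∧ i ≠ 2 ∨ (12 < i ∧ i < 19) ∨ (22 < i ∧ i < 32) → r'' i = r i :=
      fun i hi => by
        rw [e i (by omega) (by omega)]
        exact hA.scalar (by omega) (by omega)
    have e'' : ∀ i, 32 ≤ i → i < E.row W 0 ∨ E.row W 0 + 4 + E.V ≤ i → r'' i = r i := fun i h1 h2 => by
      rw [e i (by omega) (by omega)]
      exact hA.mem h1 (by omega) (by omega)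
    refine ⟨hB.congr (by omega) (fun i _ _ _ _ _ _ => e' i (by omega))
      fun i hi => e'' i (by omega) (by omega), ?_, ?_, ?_, ?_, ?_, ?_⟩
    · rw [← hr', Function.update_self]
    · rw [← hr']; simp (disch := omega) only [Function.update_of_ne, Function.update_self]
    · rw [e' 6 (by omega)]
      exact hst.congr fun i h1 h2 => e'' i (by omega) (by omega)
    · rw [e 9 (by omega) (by omega), e 10 (by omega) (by omega), hw]
    · rw [e 9 (by omega) (by omega)]
      omega
    · rw [e 9 (by omega) (by omega)]
      exact hword.congr fun i h1 h2 => e i (by omega) (by omega)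

theorem wp_digCode (hS : Setup M Pa x E W B S) {i v : ℕ} {st : List ℕ}
    (hr : ∀ i, r i ≤ S) (hR : Rel M Pa x E W (.dig i v st) r) (hI : SInv E now es (.dig i v st)) :
    Code.digCode.wp x S (TickPost M Pa x E W (.dig i v st)) r [] := by
  obtain ⟨hB, r2, r12, hst, hi, h9, hword⟩ := hR
  obtain ⟨hbh, hstk, hil, hv, -, -⟩ := hI
  obtain ⟨b1, b2, b3, b4, b5, b6, b7⟩ := hS.bounds
  have hV := hS.ok.one_le_V
  have hvV : v ≤ E.V := hv ▸ min_le_right _ _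
  have hc := hB.consts
  have r1 := hc.r1
  have r13 := hc.r13
  have hsp := hst.le
  have h10 := hr 10
  refine ⟨by omega, by omega, fun h => ?_, fun h => ?_⟩
  · obtain ⟨k, rfl⟩ : ∃ k, i = k + 1 := ⟨i - 1, by omega⟩
    have hrk : r 10 - 1 = r 9 + k := by omega
    have hk : k < E.digits.length := by omega
    have hrd : r (r 9 + k) = E.digits.getD k 0 := by
      rw [hword k hk, List.getD_eq_getElem _ _ hk]
    have hd : E.digits.getD k 0 < 2 := by
      rw [List.getD_eq_getElem _ _ hk]
      exact hS.digits_lt _ (List.getElem_mem _)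
    simp (disch := omega) only [Code.wp, Instr.Straight, Instr.accessed, Instr.written,
      Instr.nextReg, Instr.emitted, Function.update_self, Function.update_of_ne, List.append_nil,
      true_and, r1, r12, r13, hrk, hrd]
    iterate 10 refine And.intro (by omega) ?_
    refine And.intro (fun h => ?_) fun h => ?_
    · repeat refine And.intro (by omega) ?_
      refine .of_tick (.digStep k v st) ?_ rfl
      generalize hr' : Function.update _ 12 _ = r'
      have e : ∀ i, i ≠ 10 → i ≠ 19 → i ≠ 12 → r' i = r i := fun i _ _ _ => by
        rw [← hr']; simp (disch := omega) only [Function.update_of_ne]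
      have e10 : r' 10 = r 9 + k := by
        rw [← hr']; simp (disch := omega) only [Function.update_of_ne, Function.update_self]
      have e12 : r' 12 = E.V := by
        rw [← hr']; simp (disch := omega) only [Function.update_self]
      have e9 := e 9 (by omega) (by omega) (by omega)
      refine ⟨hB.congr (by omega) (fun i _ _ _ _ _ _ => e i (by omega) (by omega) (by omega))
        fun i hi => e i (by omega) (by omega) (by omega), ?_, ?_, ?_, ?_, ?_, ?_⟩
      · rw [e 2 (by omega) (by omega) (by omega), r2]
      · rw [e12]; omega
      · rw [e 6 (by omega) (by omega) (by omega)]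
        exact hst.congr fun i h1 h2 => e i (by omega) (by omega) (by omega)
      · rw [e9, e10]; omega
      · rw [e9]; exact h9
      · rw [e9]
        exact hword.congr fun i h1 h2 => e i (by omega) (by omega) (by omega)
    · refine .of_tick (.digStep k v st) ?_ rfl
      generalize hr' : Function.update _ 12 _ = r'
      have e : ∀ i, i ≠ 10 → i ≠ 19 → i ≠ 12 → r' i = r i := fun i _ _ _ => by
        rw [← hr']; simp (disch := omega) only [Function.update_of_ne]
      have e10 : r' 10 = r 9 + k := by
        rw [← hr']; simp (disch := omega) only [Function.update_of_ne, Function.update_self]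
      have e12 : r' 12 = v + v + E.digits.getD k 0 := by
        rw [← hr']; simp (disch := omega) only [Function.update_self]
      have e9 := e 9 (by omega) (by omega) (by omega)
      refine ⟨hB.congr (by omega) (fun i _ _ _ _ _ _ => e i (by omega) (by omega) (by omega))
        fun i hi => e i (by omega) (by omega) (by omega), ?_, ?_, ?_, ?_, ?_, ?_⟩
      · rw [e 2 (by omega) (by omega) (by omega), r2]
      · rw [e12]; omega
      · rw [e 6 (by omega) (by omega) (by omega)]
        exact hst.congr fun i h1 h2 => e i (by omega) (by omega) (by omega)
      · rw [e9, e10]; omega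
      · rw [e9]; exact h9
      · rw [e9]
        exact hword.congr fun i h1 h2 => e i (by omega) (by omega) (by omega)
  · obtain rfl : i = 0 := by omega
    have h16 := hB.r16
    have h17 := hB.r17
    simp (disch := omega) only [Code.newRound, Code.wp, Instr.Straight, Instr.accessed,
      Instr.written, Instr.nextReg, Instr.emitted, Function.update_self, Function.update_of_ne,
      List.append_nil, true_and, r12, h16, h17]
    repeat refine And.intro (by omega) ?_
    refine .of_tick (.digEnd v st) ?_ rfl
    generalize hr' : Function.update _ 18 _ = r'
    have e : ∀ i, i ≠ 19 → i ≠ 5 → i ≠ 2 → i ≠ 14 → i ≠ 15 → i ≠ 18 → r' i = r i :=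
      fun i _ _ _ _ _ _ => by rw [← hr']; simp (disch := omega) only [Function.update_of_ne]
    refine ⟨hc.congr fun i _ _ => e i (by omega) (by omega) (by omega) (by omega) (by omega)
      (by omega), ?_, ?_, ?_, ?_, ?_, ?_, ?_, ?_, fun z => ?_⟩
    · rw [← hr']; simp (disch := omega) only [Function.update_of_ne, Function.update_self]
    · rw [← hr']; simp (disch := omega) only [Function.update_of_ne, Function.update_self]; rfl
    · rw [← hr']; simp (disch := omega) only [Function.update_of_ne, Function.update_self]; rfl
    · rw [← hr']; simp (disch := omega) only [Function.update_of_ne, Function.update_self]; rfl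
    · rw [e 16 (by omega) (by omega) (by omega) (by omega) (by omega) (by omega), h16]; rfl
    · rw [e 17 (by omega) (by omega) (by omega) (by omega) (by omega) (by omega), h17]; rfl
    · rw [← hr', Function.update_self]; rfl
    · rw [e 6 (by omega) (by omega) (by omega) (by omega) (by omega) (by omega)]
      exact hst.congr fun i h1 h2 => e i (by omega) (by omega) (by omega) (by omega) (by omega)
        (by omega)
    · refine (hB.rows z).congr (by omega) fun i h1 h2 => ?_
      have := le_row (E := E) (W := W) (z + 2)
      exact e i (by omega) (by omega) (by omega) (by omega) (by omega) (by omega)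

end Ticks

/-! ### Correctness of the scheduler code: simulation steps -/

section MainTicks

variable {σ : ℕ} {M Pa : Program} {x : Word σ} {E : Env} {W B S now : ℕ} {es : List (ℕ × ℕ)}
  {r r' : ℕ → ℕ} {m : Main}

theorem rows_update (hW : 4 + E.V ≤ W) {procs : ℕ → Proc} {i : ℕ} {P : Proc}
    (h : ∀ z, RowProc M x E.V W r (E.row W (z + 2)) (procs z))
    (hr : ∀ a, 32 ≤ a → a < E.row W (i + 2) ∨ E.row W (i + 2) + W ≤ a → r' a = r a)
    (hP : RowProc M x E.V W r' (E.row W (i + 2)) P) (z : ℕ) :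
    RowProc M x E.V W r' (E.row W (z + 2)) (Function.update procs i P z) := by
  have h1 := le_row (E := E) (W := W) (z + 2)
  rcases lt_trichotomy z i with hz | rfl | hz
  · have h2 := row_add_le (E := E) (W := W) (show z + 2 < i + 2 by omega)
    rw [Function.update_of_ne hz.ne]
    exact (h z).congr hW fun a _ _ => hr a (by omega) (by omega)
  · rwa [Function.update_self]
  · have h2 := row_add_le (E := E) (W := W) (show i + 2 < z + 2 by omega)
    rw [Function.update_of_ne hz.ne']
    exact (h z).congr hW fun a _ _ => hr a (by omega) (by omega)

/-- The registers may represent a state in which one process has changed. -/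
theorem Rel.update_proc (hW : 4 + E.V ≤ W) (hR : Rel M Pa x E W (.main m) r)
    (hsp : r 6 ≤ E.row W 0) {i : ℕ} {P : Proc} {idx budget num : ℕ}
    (hlow : ∀ a, a < 8 ∨ a = 13 ∨ a = 23 → r' a = r a)
    (hmem : ∀ a, 32 ≤ a → a < E.row W (i + 2) ∨ E.row W (i + 2) + W ≤ a → r' a = r a)
    (hP : RowProc M x E.V W r' (E.row W (i + 2)) P) (h14 : r' 14 = idx)
    (h15 : r' 15 = E.row W (idx + 1)) (h16 : r' 16 = num) (h17 : r' 17 = E.row W (num + 1))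
    (h18 : r' 18 = budget) :
    Rel M Pa x E W (.main ⟨m.D, idx, budget, num, Function.update m.procs i P, m.stack⟩) r' := by
  obtain ⟨hc, r2, r5, -, -, -, -, -, hst, hrows⟩ := hR
  have h0 := row_mono (E := E) (W := W) (show 0 ≤ i + 2 by omega)
  refine ⟨hc.congr fun a _ _ => hlow a (by omega), by rw [hlow 2 (by omega), r2],
    by rw [hlow 5 (by omega), r5], h14, h15, h16, h17, h18, ?_, rows_update hW hrows hmem hP⟩
  rw [hlow 6 (by omega)]
  exact hst.congr fun a h1 h2 => hmem a h1 (by omega)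

theorem Rel.main_congr (hW : 4 + E.V ≤ W) (hR : Rel M Pa x E W (.main m) r)
    (h1 : ∀ a, a < 8 ∨ (12 < a ∧ a < 19) ∨ a = 23 ∨ 32 ≤ a → r' a = r a) :
    Rel M Pa x E W (.main m) r' := by
  obtain ⟨hc, r2, r5, r14, r15, r16, r17, r18, hst, hrows⟩ := hR
  refine ⟨hc.congr fun a _ _ => h1 a (by omega), by rw [h1 _ (by omega), r2],
    by rw [h1 _ (by omega), r5], by rw [h1 _ (by omega), r14], by rw [h1 _ (by omega), r15],
    by rw [h1 _ (by omega), r16], by rw [h1 _ (by omega), r17], by rw [h1 _ (by omega), r18], ?_,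
    fun z => (hrows z).congr hW fun a h2 h3 => h1 a ?_⟩
  · rw [h1 6 (by omega)]
    exact hst.congr fun a h2 h3 => h1 a (by omega)
  · have := le_row (E := E) (W := W) (z + 2)
    omega

theorem wp_countStep {Q : Prop → (ℕ → ℕ) → List (List ℕ) → Prop} {k : Code} {p : ℕ}
    {o : List (List ℕ)} (hp : 32 ≤ p) (hpS : p + 4 ≤ S) (h0 : r 0 = 0) (h1 : r 1 = 1) (h15 : r 15 = p)
    (hcnt : r (p + 1) < S)
    (h : ∀ r', (∀ a, a ≠ 19 → a ≠ 20 → a ≠ p + 1 → a ≠ p + 2 → r' a = r a) →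
      r' (p + 1) = (if r (p + 1) + 1 = r 3 then 0 else r (p + 1) + 1) →
      r' (p + 2) = (if r (p + 1) + 1 = r 3 then 1 else r (p + 2)) → k.wp x S Q r' o) :
    (Code.countStep k).wp x S Q r o := by
  have e1 : 1 + p = p + 1 := by omega
  have e2 : p + 1 + 1 = p + 2 := by omega
  simp (disch := omega) only [Code.countStep, Code.wp, Instr.Straight, Instr.accessed,
    Instr.written, Instr.nextReg, Instr.emitted, Function.update_self, Function.update_of_ne,
    List.append_nil, true_and, h0, h1, h15, e1, e2]
  iterate 10 refine And.intro (by omega) ?_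
  refine And.intro (fun hb => ?_) fun hb => ?_
  · iterate 6 refine And.intro (by omega) ?_
    refine h _ (fun a _ _ _ _ => ?_) ?_ ?_
    · simp (disch := omega) only [Function.update_of_ne]
    · simp (disch := omega) only [Function.update_of_ne, Function.update_self, if_pos]
    · simp (disch := omega) only [Function.update_self, if_pos]
  · iterate 2 refine And.intro (by omega) ?_
    refine h _ (fun a _ _ _ _ => ?_) ?_ ?_
    · simp (disch := omega) only [Function.update_of_ne]
    · simp (disch := omega) only [Function.update_self, if_neg]
    · simp (disch := omega) only [Function.update_of_ne, if_neg]

theorem RowProc.adv_of_countStep {r₁ : ℕ → ℕ} {p : ℕ} {P : Proc}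
    (h : RowProc M x E.V W r p P) (hp : 32 ≤ p) (h3 : r 3 = E.b) (hc : P.carry = 0)
    (hA : Agree E.V p r r₁) (hH : Holds E.V p (run M x (P.t + 1)) r₁)
    (hr' : ∀ a, a ≠ 19 → a ≠ 20 → a ≠ p + 1 → a ≠ p + 2 → r' a = r₁ a)
    (h1 : r' (p + 1) = (if r₁ (p + 1) + 1 = r₁ 3 then 0 else r₁ (p + 1) + 1))
    (h2 : r' (p + 2) = (if r₁ (p + 1) + 1 = r₁ 3 then 1 else r₁ (p + 2))) :
    RowProc M x E.V W r' p (P.adv E.b) := by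
  have e1 : r₁ (p + 1) = P.cnt := by rw [hA.mem (by omega) (by omega) (by omega), h.cnt]
  have e2 : r₁ (p + 2) = P.carry := by rw [hA.mem (by omega) (by omega) (by omega), h.carry]
  have e3 : r₁ 3 = E.b := by rw [hA.scalar (by omega) (by omega), h3]
  have e4 : r' (p + 3) = P.len := by
    rw [hr' _ (by omega) (by omega) (by omega) (by omega), hA.mem (by omega) (by omega) (by omega),
      h.len]
  have e5 : ∀ i, 4 + E.V + i < W → r' (p + 4 + E.V + i) = P.bits i := fun i hi => by
    rw [hr' _ (by omega) (by omega) (by omega) (by omega), hA.mem (by omega) (by omega) (by omega),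
      h.bits i hi]
  have e6 : Holds E.V p (run M x (P.t + 1)) r' := by
    refine ⟨?_, fun d hd => ?_⟩
    · rw [hr' _ (by omega) (by omega) (by omega) (by omega)]; exact hH.1
    · rw [hr' _ (by omega) (by omega) (by omega) (by omega)]; exact hH.2 d hd
  rw [e1, e3] at h1 h2
  rw [e2, hc] at h2
  unfold Proc.adv
  rw [if_pos hc]
  split_ifs at h1 h2 ⊢
  · exact ⟨e6, h1, h2, e4, e5⟩
  · exact ⟨e6, h1, h2, e4, e5⟩

/-- Bounds on the data of the current process. -/
theorem main_bounds (hS : Setup M Pa x E W B S) (hI : SInv E now es (.main m)) {i : ℕ}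
    (hidx : m.idx = i + 1) : i < m.num ∧ m.num + 2 < B ∧ (m.procs i).Inv E.b E.h i := by
  obtain ⟨-, -, start, hm, -, -⟩ := hI
  have hi : i < m.num := by have := hm.idx_le; omega
  refine ⟨hi, ?_, hm.proc i hi⟩
  -- The logarithmic bound on the number of processes keeps their rows within the memory, including
  -- the row of a process about to be started.
  have h1 := (hm.bounds hS.ok (by omega)).2.2.1.trans_lt hS.count_lt
  exact (Nat.pow_lt_pow_iff_right (by norm_num)).mp h1

theorem main_sp_le (hS : Setup M Pa x E W B S) (hI : SInv E now es (.main m))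
    (hst : StackRel r (wordAt M x) m.stack (r 6)) : r 6 ≤ E.row W 0 := by
  obtain ⟨-, -, start, hm, -, -⟩ := hI
  have h1 := hS.stack_le hst hm.nodup_stack fun u hu => (hm.stack_mem u hu).1
  have h2 := hS.bounds.2.2.1
  omega

theorem map_range'_of_stored {a n : ℕ} {w : List ℕ} (h : Stored r a w) (hn : n = w.length) :
    (List.range' a n).map r = w := by
  subst hn
  refine List.ext_getElem (by simp) fun i h1 h2 => ?_
  simp [h i h2]

theorem wp_stepCode (hS : Setup M Pa x E W B S) (hR : Rel M Pa x E W (.main m) r)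
    (hI : SInv E now es (.main m)) {i : ℕ} (hidx : m.idx = i + 1) (hb : m.budget ≠ 0)
    (hlen : (m.procs i).len ≤ i + 1) (hc : (m.procs i).carry = 0) (r24 : r 24 = (m.procs i).len) :
    (Code.stepCode M).wp x S (TickPost M Pa x E W (.main m)) r [] := by
  obtain ⟨hi, hnB, hPI⟩ := main_bounds hS hI hidx
  obtain ⟨b1, b2, b3, b4, b5, b6, b7⟩ := hS.bounds
  have hR' := hR
  obtain ⟨hcon, r2, r5, r14, r15, r16, r17, r18, hst, hrows⟩ := hR
  have hsp := main_sp_le hS hI hst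
  rw [hidx] at r14 r15
  have r0 := hcon.r0
  have r1 := hcon.r1
  have r3 := hcon.r3
  have hrow := hrows i
  have hrow32 := le_row (E := E) (W := W) (i + 2)
  have hrowS := row_add_le (E := E) (W := W) (show i + 2 < B + 4 by omega)
  have hS' := hS.le_S
  have hcnt := hPI.cnt_lt
  have hleW := hS.le_W
  refine wp_sim (hS.simReady_M (j := i + 2) (by omega) r15 r1 hrow.holds) ?_ ?_ ?_
  · intro hh r' e
    have e : ∀ i, i < 9 ∨ (10 < i ∧ i < 19) ∨ 22 < i → r' i = r i := fun i hi =>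
      e i (by unfold IsTemp; omega)
    simp (disch := omega) only [Code.wp, Instr.Straight, Instr.accessed, Instr.written,
      Instr.nextReg, Instr.emitted, List.append_nil, true_and]
    iterate 2 refine And.intro (by omega) ?_
    refine .of_tick (.main _ _ _ (.skip m i hidx hb (Or.inr ⟨hc, hS.halted_iff.mp hh⟩))) ?_ rfl
    generalize hr' : Function.update _ 18 _ = r''
    have e' : ∀ i, i < 9 ∨ (10 < i ∧ i < 18) ∨ 22 < i → r'' i = r i :=
      fun i hi => by
        rw [← hr']; simp (disch := omega) only [Function.update_of_ne]; exact e i (by omega)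
    have := hR'.update_proc (r' := r'') (i := i) (P := m.procs i) (by omega) hsp
      (fun a _ => e' a (by omega)) (fun a _ _ => e' a (by omega))
      (hrow.congr (by omega) fun a _ _ => e' a (by omega)) (idx := m.idx) (budget := 0)
      (num := m.num) (by rw [e' 14 (by omega), r14, hidx]) (by rw [e' 15 (by omega), r15, hidx])
      (by rw [e' 16 (by omega), r16]) (by rw [e' 17 (by omega), r17])
      (by rw [← hr', Function.update_self])
    rwa [Function.update_eq_self] at this
  · intro r₁ ho hh hA hH
    have hA' := fun a ha => hA.scalar (i := a) (by omega) ha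
    have hcnt' : r₁ (E.row W (i + 2) + 1) = (m.procs i).cnt := by
      rw [hA.mem (by omega) (by omega) (by omega), hrow.cnt]
    refine wp_countStep hrow32 (by omega) (by rw [hA' 0 (by omega), r0])
      (by rw [hA' 1 (by omega), r1]) (by rw [hA' 15 (by omega), r15]) (by omega) ?_
    intro r₂ e h1 h2
    have hP := hrow.adv_of_countStep hrow32 r3 hc hA (by rwa [run_succ]) e h1 h2
    have e' : ∀ a, a < 9 ∨ (10 < a ∧ a < 19) ∨ (22 < a ∧ a < 32) → r₂ a = r a := fun a ha => by
      rw [e a (by omega) (by omega) (by omega) (by omega), hA' a ha]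
    have e'' : ∀ a, 32 ≤ a → a < E.row W (i + 2) ∨ E.row W (i + 2) + W ≤ a → r₂ a = r a :=
      fun a h3 h4 => by
        rw [e a (by omega) (by omega) (by omega) (by omega), hA.mem h3 (by omega) (by omega)]
    have e18 := e' 18 (by omega)
    have e1 := e' 1 (by omega)
    have hbud : m.budget ≤ S := by
      obtain ⟨_, _, start, hm, _⟩ := hI
      have h5 := hm.budget_le
      have h6 := hm.D_le
      omega
    simp (disch := omega) only [Code.spend, Code.wp, Instr.Straight, Instr.accessed,
      Instr.written, Instr.nextReg, Instr.emitted, List.append_nil, true_and, e18, e1, r1, r18]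
    iterate 2 refine And.intro (by omega) ?_
    have hem : E.em (m.procs i).t = false := by
      rw [hS.em_eq, emits, ho]
      rfl
    refine .of_tick (.main _ _ _ (.micro m i hidx hb ?_ ?_)) ?_ rfl
    · rintro (h | h)
      · omega
      · exact hh (hS.halted_iff.mpr h.2)
    · rw [hem]
      simp
    rw [if_neg (by simp [hc])]
    generalize hr' : Function.update _ 18 _ = r₃
    have e3 : ∀ a, a ≠ 18 → r₃ a = r₂ a := fun a _ => by
      rw [← hr']; simp (disch := omega) only [Function.update_of_ne]
    refine hR'.update_proc (by omega) hsp
      (fun a _ => by rw [e3 a (by omega), e' a (by omega)])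
      (fun a _ _ => by rw [e3 a (by omega), e'' a (by omega) (by omega)])
      (hP.congr (by omega) fun a _ _ => e3 a (by omega)) ?_ ?_ ?_ ?_ ?_
    · rw [e3 14 (by omega), e' 14 (by omega), r14, hidx]
    · rw [e3 15 (by omega), e' 15 (by omega), r15, hidx]
    · rw [e3 16 (by omega), e' 16 (by omega), r16]
    · rw [e3 17 (by omega), e' 17 (by omega), r17]
    · rw [← hr', Function.update_self]
  · intro r₁ w ho hA hH hw hword h9 h10 h10'
    have hA' := fun a ha => hA.scalar (i := a) (by omega) ha
    have hcnt' : r₁ (E.row W (i + 2) + 1) = (m.procs i).cnt := by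
      rw [hA.mem (by omega) (by omega) (by omega), hrow.cnt]
    refine wp_countStep hrow32 (by omega) (by rw [hA' 0 (by omega), r0])
      (by rw [hA' 1 (by omega), r1]) (by rw [hA' 15 (by omega), r15]) (by omega) ?_
    intro r₂ e h1 h2
    have hP := hrow.adv_of_countStep hrow32 r3 hc hA (by rwa [run_succ]) e h1 h2
    have e' : ∀ a, a < 9 ∨ (10 < a ∧ a < 19) ∨ (22 < a ∧ a < 32) → r₂ a = r a := fun a ha => by
      rw [e a (by omega) (by omega) (by omega) (by omega), hA' a ha]
    have e'' : ∀ a, 32 ≤ a → a < E.row W (i + 2) ∨ E.row W (i + 2) + W ≤ a → r₂ a = r a :=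
      fun a h3 h4 => by
        rw [e a (by omega) (by omega) (by omega) (by omega), hA.mem h3 (by omega) (by omega)]
    have e18 := e' 18 (by omega)
    have e1 := e' 1 (by omega)
    have e14 := e' 14 (by omega)
    have e24 := e' 24 (by omega)
    have e16 := e' 16 (by omega)
    have e17 := e' 17 (by omega)
    have e5 := e' 5 (by omega)
    have e9 := e 9 (by omega) (by omega) (by omega) (by omega)
    have e10 := e 10 (by omega) (by omega) (by omega) (by omega)
    have hbud : m.budget ≤ m.D ∧ m.D ≤ E.b := by
      obtain ⟨_, _, start, hm, _⟩ := hI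
      exact ⟨hm.budget_le, hm.D_le⟩
    have hem' : emits M x (m.procs i).t = some w := ho
    have hem : E.em (m.procs i).t = true := by
      rw [hS.em_eq, hem']
      rfl
    have hfin : ¬ (m.procs i).Fin E.h i := by
      rintro (h | h)
      · omega
      · exact not_halted_of_emits (by simp [hem']) (hS.halted_iff.mpr h.2)
    refine ⟨by omega, by omega, fun h => ?_, fun h => ?_⟩
    · rw [e24, e14, r24, r14] at h
      have hrow17 := row_add_le (E := E) (W := W) (show m.num + 1 < B + 4 by omega)
      simp (disch := omega) only [Code.newRound, Code.wp, Instr.Straight, Instr.accessed,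
        Instr.written, Instr.nextReg, Instr.emitted, Function.update_self, Function.update_of_ne,
        List.append_nil, List.nil_append, true_and, e1, r1, e9, e10, e16, e17, r16, r17, e5, r5]
      -- The registers accessed by the output instruction; the case distinction is there for the
      -- empty word.
      have hout : (if r₁ 9 ≤ r₁ 10 - 1 then r₁ 10 - 1 + 1 else 0) ≤ S := by
        split <;> omega
      iterate 10 refine And.intro (by omega) ?_
      refine .of_tick (.main _ _ _ (.out m i hidx hb hfin hc hem h)) ?_ ?_
      · generalize hr' : Function.update _ 18 _ = r₃
        have e3 : ∀ a, a ≠ 10 → a ≠ 14 → a ≠ 15 → a ≠ 18 → r₃ a = r₂ a := fun a _ _ _ _ => by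
          rw [← hr']; simp (disch := omega) only [Function.update_of_ne]
        refine hR'.update_proc (by omega) hsp
          (fun a _ => by rw [e3 a (by omega) (by omega) (by omega) (by omega), e' a (by omega)])
          (fun a _ _ => by
            rw [e3 a (by omega) (by omega) (by omega) (by omega), e'' a (by omega) (by omega)])
          (hP.congr (by omega) fun a _ _ => e3 a (by omega) (by omega) (by omega) (by omega))
          ?_ ?_ ?_ ?_ ?_
        · rw [← hr']; simp (disch := omega) only [Function.update_of_ne, Function.update_self]
        · rw [← hr']; simp (disch := omega) only [Function.update_of_ne, Function.update_self]
        · rw [e3 16 (by omega) (by omega) (by omega) (by omega), e16, r16]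
        · rw [e3 17 (by omega) (by omega) (by omega) (by omega), e17, r17]
        · rw [← hr', Function.update_self]
      · rw [map_range'_of_stored (w := w) _ (by omega)]
        · simp [wordAt, hem']
        · refine hword.congr fun a h3 h4 => ?_
          rw [Function.update_of_ne (by omega), e a (by omega) (by omega) (by omega) (by omega)]
    · rw [e24, e14, r24, r14] at h
      simp (disch := omega) only [Code.spend, Code.wp, Instr.Straight, Instr.accessed,
        Instr.written, Instr.nextReg, Instr.emitted, List.append_nil, true_and, e18, e1, r1, r18]
      iterate 2 refine And.intro (by omega) ?_
      refine .of_tick (.main _ _ _ (.micro m i hidx hb hfin fun h3 => h h3.2.2)) ?_ rfl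
      rw [if_neg (by simp [hc])]
      generalize hr' : Function.update _ 18 _ = r₃
      have e3 : ∀ a, a ≠ 18 → r₃ a = r₂ a := fun a _ => by
        rw [← hr']; simp (disch := omega) only [Function.update_of_ne]
      refine hR'.update_proc (by omega) hsp
        (fun a _ => by rw [e3 a (by omega), e' a (by omega)])
        (fun a _ _ => by rw [e3 a (by omega), e'' a (by omega) (by omega)])
        (hP.congr (by omega) fun a _ _ => e3 a (by omega)) ?_ ?_ ?_ ?_ ?_
      · rw [e3 14 (by omega), e' 14 (by omega), r14, hidx]
      · rw [e3 15 (by omega), e' 15 (by omega), r15, hidx]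
      · rw [e3 16 (by omega), e' 16 (by omega), r16]
      · rw [e3 17 (by omega), e' 17 (by omega), r17]
      · rw [← hr', Function.update_self]

end MainTicks

/-! ### Correctness of the scheduler code: the binary counter -/

section CarryTicks

variable {σ : ℕ} {M Pa : Program} {x : Word σ} {E : Env} {W B S now : ℕ} {es : List (ℕ × ℕ)}
  {r r' : ℕ → ℕ} {m : Main}

theorem wp_carryTop {Q : Prop → (ℕ → ℕ) → List (List ℕ) → Prop} {p q len : ℕ}
    (hp : 32 ≤ p) (hq : p + 4 ≤ q) (hqS : q + 1 < S) (hlen : len < S) (r0 : r 0 = 0)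
    (r1 : r 1 = 1) (r22 : r 22 = q) (r24 : r 24 = len) (r19 : r 19 = p + 2) (h18 : r 18 ≤ S)
    (h16 : r 16 < S) (h17 : r 17 + r 4 ≤ S)
    (h : ∀ r', (∀ a, a < 16 ∨ a = 23 ∨ 32 ≤ a → a ≠ p + 2 → a ≠ p + 3 → a ≠ q → r' a = r a) →
      r' (p + 2) = 0 → r' (p + 3) = len + 1 → r' q = 1 →
      r' 16 = (if len + 1 = r 14 then r 16 + 1 else r 16) →
      r' 17 = (if len + 1 = r 14 then r 17 + r 4 else r 17) → r' 18 = r 18 - 1 → Q False r' []) :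
    Code.carryTop.wp x S Q r [] := by
  have e1 : p + 2 + 1 = p + 3 := by omega
  simp (disch := omega) only [Code.carryTop, Code.spend, Code.wp, Instr.Straight, Instr.accessed,
    Instr.written, Instr.nextReg, Instr.emitted, Function.update_self, Function.update_of_ne,
    List.append_nil, true_and, r0, r1, r22, r24, r19, e1]
  iterate 12 refine And.intro (by omega) ?_
  refine And.intro (fun hn => ?_) fun hn => ?_
  · iterate 6 refine And.intro (by omega) ?_
    refine h _ (fun a _ _ _ _ => ?_) ?_ ?_ ?_ ?_ ?_ ?_ <;>
    simp (disch := omega) only [Function.update_self, Function.update_of_ne, if_pos]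
  · iterate 2 refine And.intro (by omega) ?_
    refine h _ (fun a _ _ _ _ => ?_) ?_ ?_ ?_ ?_ ?_ ?_ <;>
    simp (disch := omega) only [Function.update_self, Function.update_of_ne, if_neg]

theorem wp_carryBit {Q : Prop → (ℕ → ℕ) → List (List ℕ) → Prop} {p q c : ℕ}
    (hp : 32 ≤ p) (hq : p + 4 ≤ q) (hqS : q + 1 < S) (hcS : c + 2 ≤ S) (r0 : r 0 = 0)
    (r1 : r 1 = 1) (r25 : r 25 = c + 1) (r22 : r 22 = q) (r19 : r 19 = p + 2) (h18 : r 18 ≤ S)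
    (hbit : r q ≤ S)
    (h : ∀ r', (∀ a, a < 18 ∨ a = 23 ∨ 32 ≤ a → a ≠ p + 2 → a ≠ q → r' a = r a) →
      r' (p + 2) = (if r q = 1 then c + 2 else 0) → r' q = (if r q = 1 then 0 else 1) →
      r' 18 = r 18 - 1 → Q False r' []) :
    Code.carryBit.wp x S Q r [] := by
  have e4 : c + 1 + 1 = c + 2 := by omega
  simp (disch := omega) only [Code.carryBit, Code.spend, Code.wp, Instr.Straight, Instr.accessed,
    Instr.written, Instr.nextReg, Instr.emitted, Function.update_self, Function.update_of_ne,
    List.append_nil, true_and, r0, r1, r22, r25, r19, e4]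
  iterate 4 refine And.intro (by omega) ?_
  refine And.intro (fun hn => ?_) fun hn => ?_
  · iterate 8 refine And.intro (by omega) ?_
    refine h _ (fun a _ _ _ => ?_) ?_ ?_ ?_ <;>
    simp (disch := omega) only [Function.update_self, Function.update_of_ne, if_pos]
  · iterate 6 refine And.intro (by omega) ?_
    refine h _ (fun a _ _ _ => ?_) ?_ ?_ ?_ <;>
    simp (disch := omega) only [Function.update_self, Function.update_of_ne, if_neg]

theorem wp_carryCode (hS : Setup M Pa x E W B S) (hR : Rel M Pa x E W (.main m) r)
    (hI : SInv E now es (.main m)) {i : ℕ} (hidx : m.idx = i + 1) (hb : m.budget ≠ 0)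
    (hlen : (m.procs i).len ≤ i + 1) (hc : (m.procs i).carry ≠ 0) (r24 : r 24 = (m.procs i).len)
    (r25 : r 25 = (m.procs i).carry) (r19 : r 19 = E.row W (i + 2) + 2) :
    Code.carryCode.wp x S (TickPost M Pa x E W (.main m)) r [] := by
  obtain ⟨hi, hnB, hPI⟩ := main_bounds hS hI hidx
  obtain ⟨b1, b2, b3, b4, b5, b6, b7⟩ := hS.bounds
  have hsp := main_sp_le hS hI hR.2.2.2.2.2.2.2.2.1
  obtain ⟨hcon, -, -, r14, r15, r16, r17, r18, -, hrows⟩ := id hR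
  rw [hidx] at r14 r15
  replace r15 : r 15 = E.row W (i + 2) := r15
  have r0 := hcon.r0
  have r1 := hcon.r1
  have r4 := hcon.r4
  have r23 := hcon.r23
  have hrow := hrows i
  have hrow32 := le_row (E := E) (W := W) (i + 2)
  have hrowS := row_add_le (E := E) (W := W) (show i + 2 < B + 4 by omega)
  have hrowN := row_add_le (E := E) (W := W) (show m.num + 1 < B + 4 by omega)
  have hS' := hS.le_S
  have hleW := hS.le_W
  have hcl := hPI.carry_le
  have hbud : m.budget ≤ S := by
    obtain ⟨_, _, start, hm, _⟩ := hI
    have h5 := hm.budget_le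
    have h6 := hm.D_le
    omega
  have hfin : ¬ (m.procs i).Fin E.h i := by
    rintro (h | h)
    · omega
    · exact hc h.1
  have hnc : ¬ ((m.procs i).carry = 0 ∧ E.em (m.procs i).t = true ∧ (m.procs i).len = i + 1) :=
    fun h => hc h.1
  have hbits := hrow.bits
  have hbl := hPI.bits_le
  have htick := Tick.main _ _ _ (MTick.micro (b := E.b) m i hidx hb hfin hnc)
  obtain ⟨c, hc'⟩ : ∃ c, (m.procs i).carry = c + 1 := ⟨_, (Nat.succ_pred hc).symm⟩
  have hbit : r (E.row W (i + 2) + 4 + E.V + c) = (m.procs i).bits c := hbits c (by omega)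
  have hbl := hbl c
  have hrS : E.row W (i + 2) + W ≤ S := by omega
  have hcW : 4 + E.V + c + 2 < W := by omega
  have hnS : m.num < S := by omega
  have hnS' : E.row W (m.num + 1) + W ≤ S := by omega
  have hV : 4 + E.V ≤ W := by omega
  clear b1 b2 b3 b4 b5 b6 b7 hrowS hrowN hS' hleW hcon hnB
  -- Common end of the three cases of a carry: only `carry`, `len`, the bit c and `prog` of the
  -- process change, and possibly the number of processes.
  have key : ∀ r' P' num', (∀ a, a < 16 ∨ a = 23 ∨ 32 ≤ a → a ≠ E.row W (i + 2) + 2 →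
      a ≠ E.row W (i + 2) + 3 → a ≠ E.row W (i + 2) + 4 + E.V + c → r' a = r a) →
      (m.procs i).adv E.b = P' → P'.t = (m.procs i).t → P'.cnt = (m.procs i).cnt →
      r' (E.row W (i + 2) + 2) = P'.carry →
      r' (E.row W (i + 2) + 3) = P'.len → r' (E.row W (i + 2) + 4 + E.V + c) = P'.bits c →
      (∀ j, j ≠ c → P'.bits j = (m.procs i).bits j) →
      (if (m.procs i).carry ≠ 0 ∧ (m.procs i).carry = (m.procs i).len + 1 ∧ (m.procs i).len = i
        then m.num + 1 else m.num) = num' → r' 16 = num' → r' 17 = E.row W (num' + 1) →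
      r' 18 = r 18 - 1 → TickPost M Pa x E W (.main m) False r' [] := by
    intro r' P' num' e hP' ht hcnt h2 h3 hq hj hn e16 e17 e18
    refine .of_tick htick ?_ rfl
    rw [hn, hP']
    refine hR.update_proc hV hsp (fun a _ => e a (by omega) (by omega) (by omega) (by omega))
      (fun a _ _ => e a (by omega) (by omega) (by omega) (by omega))
      ⟨⟨?_, fun d hd => ?_⟩, ?_, h2, h3, fun j hjW => ?_⟩ ?_ ?_ e16 e17 (by rw [e18, r18])
    · rw [e _ (by omega) (by omega) (by omega) (by omega), ht]; exact hrow.holds.1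
    · rw [e _ (by omega) (by omega) (by omega) (by omega), ht]; exact hrow.holds.2 d hd
    · rw [e _ (by omega) (by omega) (by omega) (by omega), hcnt]; exact hrow.cnt
    · by_cases hjc : j = c
      · rw [hjc, hq]
      · rw [e _ (by omega) (by omega) (by omega) (by omega), hj j hjc, hbits j hjW]
    · rw [e _ (by omega) (by omega) (by omega) (by omega), r14, hidx]
    · rw [e _ (by omega) (by omega) (by omega) (by omega), r15, hidx]
  simp (disch := omega) only [Code.carryCode, Code.wp, Instr.Straight, Instr.accessed,
    Instr.written, Instr.nextReg, Instr.emitted, Function.update_self, Function.update_of_ne,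
    List.append_nil, true_and, r1, r15, r23, r25, r24]
  iterate 10 refine And.intro (by omega) ?_
  generalize hr₁ : Function.update _ 21 _ = r₁
  have e₁ : ∀ a, a ≠ 21 → a ≠ 22 → r₁ a = r a := fun a _ _ => by
    rw [← hr₁]; simp (disch := omega) only [Function.update_of_ne]
  have e22 : r₁ 22 = E.row W (i + 2) + 4 + E.V + c := by
    rw [← hr₁]
    simp (disch := omega) only [Function.update_of_ne, Function.update_self]
    omega
  have f := fun a h1 h2 => e₁ a h1 h2
  refine And.intro (fun h => ?_) fun h => ?_
  · have hcl' : c = (m.procs i).len := by omega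
    refine wp_carryTop (p := E.row W (i + 2)) (q := E.row W (i + 2) + 4 + E.V + c)
      (len := (m.procs i).len) hrow32 (by omega) (by omega) (by omega) ?_ ?_ e22 ?_ ?_ ?_ ?_ ?_ ?_
    · rw [f 0 (by omega) (by omega), r0]
    · rw [f 1 (by omega) (by omega), r1]
    · rw [f 24 (by omega) (by omega), r24]
    · rw [f 19 (by omega) (by omega), r19]
    · rw [f 18 (by omega) (by omega), r18]; exact hbud
    · rw [f 16 (by omega) (by omega), r16]; exact hnS
    · rw [f 17 (by omega) (by omega), f 4 (by omega) (by omega), r17, r4]; exact hnS'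
    · intro r' e h2 h3 hq e16 e17 e18
      rw [f 14 (by omega) (by omega), r14, f 16 (by omega) (by omega), r16] at e16
      rw [f 14 (by omega) (by omega), r14, f 17 (by omega) (by omega), r17,
        f 4 (by omega) (by omega), r4] at e17
      rw [f 18 (by omega) (by omega)] at e18
      have hadv : (m.procs i).adv E.b = ⟨(m.procs i).t, (m.procs i).cnt, 0, (m.procs i).len + 1,
          Function.update (m.procs i).bits (m.procs i).len 1, (m.procs i).prog + 1⟩ := by
        rw [Proc.adv, if_neg hc, if_pos (by omega)]
      refine key r' _ _ (fun a h4 h5 h6 h7 => by rw [e a (by omega) h5 h6 h7, f a (by omega) (by omega)])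
        hadv rfl rfl h2 h3 ?_ (fun j hj => ?_) rfl
        ?_ ?_ e18
      · rw [hq, hcl']; simp
      · exact Function.update_of_ne (by omega) _ _
      · rw [e16]
        exact if_congr (by omega) rfl rfl
      · rw [e17]
        by_cases hn : (m.procs i).len = i
        · rw [if_pos (by omega), if_pos (by omega), row_succ (m.num + 1)]
        · rw [if_neg (by omega), if_neg (by omega)]
  · have hcl' : c ≠ (m.procs i).len := by omega
    refine wp_carryBit (p := E.row W (i + 2)) (q := E.row W (i + 2) + 4 + E.V + c) (c := c)
      hrow32 (by omega) (by omega) (by omega) ?_ ?_ ?_ e22 ?_ ?_ ?_ ?_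
    · rw [f 0 (by omega) (by omega), r0]
    · rw [f 1 (by omega) (by omega), r1]
    · rw [f 25 (by omega) (by omega), r25, hc']
    · rw [f 19 (by omega) (by omega), r19]
    · rw [f 18 (by omega) (by omega), r18]; exact hbud
    · rw [f _ (by omega) (by omega), hbit]; omega
    · intro r' e h2 hq e18
      have f' : ∀ a, a < 18 ∨ a = 23 ∨ 32 ≤ a → a ≠ E.row W (i + 2) + 2 →
          a ≠ E.row W (i + 2) + 4 + E.V + c → r' a = r a := fun a h4 h5 h7 => by
        rw [e a h4 h5 h7, f a (by omega) (by omega)]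
      rw [f _ (by omega) (by omega), hbit] at h2 hq
      rw [f 18 (by omega) (by omega)] at e18
      have hn : (if (m.procs i).carry ≠ 0 ∧ (m.procs i).carry = (m.procs i).len + 1 ∧
          (m.procs i).len = i then m.num + 1 else m.num) = m.num := if_neg (by omega)
      have h3 : r' (E.row W (i + 2) + 3) = (m.procs i).len := by
        rw [f' _ (by omega) (by omega) (by omega), hrow.len]
      have e16 : r' 16 = m.num := by rw [f' _ (by omega) (by omega) (by omega), r16]
      have e17 : r' 17 = E.row W (m.num + 1) := by
        rw [f' _ (by omega) (by omega) (by omega), r17]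
      have hcc : (m.procs i).carry - 1 = c := by omega
      by_cases hb1 : (m.procs i).bits c = 1
      · rw [if_pos hb1] at h2 hq
        have hadv : (m.procs i).adv E.b = ⟨(m.procs i).t, (m.procs i).cnt, (m.procs i).carry + 1,
            (m.procs i).len, Function.update (m.procs i).bits c 0, (m.procs i).prog + 1⟩ := by
          rw [Proc.adv, if_neg hc, if_neg (by omega), hcc, if_pos hb1]
        refine key r' _ _ (fun a h4 h5 h6 h7 => f' a (by omega) h5 h7) hadv rfl rfl ?_ h3 ?_
          (fun j hj => Function.update_of_ne (by omega) _ _) hn e16 e17 e18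
        · rw [h2, hc']
        · rw [hq]; simp
      · rw [if_neg hb1] at h2 hq
        have hadv : (m.procs i).adv E.b = ⟨(m.procs i).t, (m.procs i).cnt, 0,
            (m.procs i).len, Function.update (m.procs i).bits c 1, (m.procs i).prog + 1⟩ := by
          rw [Proc.adv, if_neg hc, if_neg (by omega), hcc, if_neg hb1]
        refine key r' _ _ (fun a h4 h5 h6 h7 => f' a (by omega) h5 h7) hadv rfl rfl h2 h3 ?_
          (fun j hj => Function.update_of_ne (by omega) _ _) hn e16 e17 e18
        rw [hq]; simp

end CarryTicks

/-! ### Correctness of the complete loop body -/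

section BodyTicks

variable {σ : ℕ} {M Pa : Program} {x : Word σ} {E : Env} {W B S now : ℕ} {es : List (ℕ × ℕ)}
  {r r' : ℕ → ℕ} {m : Main}

theorem wp_procCode (hS : Setup M Pa x E W B S) (hr : ∀ i, r i ≤ S)
    (hR : Rel M Pa x E W (.main m) r) (hI : SInv E now es (.main m)) {i : ℕ} (hidx : m.idx = i + 1)
    (hb : m.budget ≠ 0) : (Code.procCode M).wp x S (TickPost M Pa x E W (.main m)) r [] := by
  obtain ⟨hi, hnB, hPI⟩ := main_bounds hS hI hidx
  obtain ⟨b1, b2, b3, b4, b5, b6, b7⟩ := hS.bounds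
  obtain ⟨hcon, -, -, r14, r15, -, -, -, -, hrows⟩ := id hR
  rw [hidx] at r14 r15
  replace r15 : r 15 = E.row W (i + 2) := r15
  have r0 := hcon.r0
  have hrow := hrows i
  have hrow32 := le_row (E := E) (W := W) (i + 2)
  have hrowS := row_add_le (E := E) (W := W) (show i + 2 < B + 4 by omega)
  have hS' := hS.le_S
  have e1 : 3 + E.row W (i + 2) = E.row W (i + 2) + 3 := by omega
  have e2 : 2 + E.row W (i + 2) = E.row W (i + 2) + 2 := by omega
  have hl := hrow.len
  have hc := hrow.carry
  have hlS := hr (E.row W (i + 2) + 3)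
  have hcS := hr (E.row W (i + 2) + 2)
  rw [hl] at hlS
  rw [hc] at hcS
  simp (disch := omega) only [Code.procCode, Code.wp, Instr.Straight, Instr.accessed,
    Instr.written, Instr.nextReg, Instr.emitted, Function.update_self, Function.update_of_ne,
    List.append_nil, true_and, r0, r14, r15, e1, e2, hl, hc]
  iterate 8 refine And.intro (by omega) ?_
  refine And.intro (fun h => ?_) fun h => ?_
  · iterate 2 refine And.intro (by omega) ?_
    refine .of_tick (.main _ _ _ (.skip m i hidx hb (Or.inl h))) ?_ rfl
    generalize hr' : Function.update _ 18 _ = r''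
    have e : ∀ a, a ≠ 18 → a ≠ 19 → a ≠ 24 → r'' a = r a := fun i _ _ _ => by
      rw [← hr']; simp (disch := omega) only [Function.update_of_ne]
    obtain ⟨-, r2, r5, r14, r15, r16, r17, r18, hst, -⟩ := hR
    refine ⟨hcon.congr fun a _ _ => e a (by omega) (by omega) (by omega), ?_, ?_, ?_, ?_, ?_, ?_, ?_,
      ?_, fun z => (hrows z).congr (by omega) fun a _ _ => ?_⟩
    · rw [e _ (by omega) (by omega) (by omega), r2]
    · rw [e _ (by omega) (by omega) (by omega), r5]
    · rw [e _ (by omega) (by omega) (by omega), r14]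
    · rw [e _ (by omega) (by omega) (by omega), r15]
    · rw [e _ (by omega) (by omega) (by omega), r16]
    · rw [e _ (by omega) (by omega) (by omega), r17]
    · rw [← hr', Function.update_self]
    · rw [e _ (by omega) (by omega) (by omega)]
      exact hst.congr fun a _ _ => e a (by omega) (by omega) (by omega)
    · have := le_row (E := E) (W := W) (z + 2)
      exact e a (by omega) (by omega) (by omega)
  · iterate 8 refine And.intro (by omega) ?_
    generalize hr' : Function.update _ 25 _ = r''
    have e : ∀ a, a ≠ 25 → a ≠ 19 → a ≠ 24 → r'' a = r a := fun i _ _ _ => by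
      rw [← hr']; simp (disch := omega) only [Function.update_of_ne]
    have e24 : r'' 24 = (m.procs i).len := by
      rw [← hr']; simp (disch := omega) only [Function.update_of_ne, Function.update_self]
    have e25 : r'' 25 = (m.procs i).carry := by rw [← hr', Function.update_self]
    have e19 : r'' 19 = E.row W (i + 2) + 2 := by
      rw [← hr']; simp (disch := omega) only [Function.update_of_ne, Function.update_self]
    have hR'' := hR.main_congr (r' := r'') (by omega) fun a _ =>
      e a (by omega) (by omega) (by omega)
    exact ⟨fun h0 => wp_stepCode hS hR'' hI hidx hb (by omega) h0 e24,
      fun h0 => wp_carryCode hS hR'' hI hidx hb (by omega) h0 e24 e25 e19⟩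

theorem wp_popCode (hS : Setup M Pa x E W B S) (hr : ∀ i, r i ≤ S)
    (hR : Rel M Pa x E W (.main m) r) (hI : SInv E now es (.main m)) (hidx : m.idx = 0) {u : ℕ}
    {st : List ℕ} (hstk : m.stack = u :: st) :
    Code.popCode.wp x S (TickPost M Pa x E W (.main m)) r [] := by
  have hsp := main_sp_le hS hI hR.2.2.2.2.2.2.2.2.1
  obtain ⟨b1, b2, b3, b4, b5, b6, b7⟩ := hS.bounds
  obtain ⟨hcon, r2, r5, r14, r15, r16, r17, r18, hst, hrows⟩ := hR
  rw [hstk] at hst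
  obtain ⟨q, hst, hword, hq, h6⟩ := hst
  have hq32 := hst.le
  have r1 := hcon.r1
  have h5 := hr 5
  have h16 := hr 16
  have h17 := hr 17
  rw [r5] at h5
  rw [r16] at h16
  rw [r17] at h17
  have e1 : q + (wordAt M x u).length + 1 - 1 = q + (wordAt M x u).length := by omega
  simp (disch := omega) only [Code.popCode, Code.newRound, Code.wp, Instr.Straight, Instr.accessed,
    Instr.written, Instr.nextReg, Instr.emitted, Function.update_self, Function.update_of_ne,
    List.append_nil, List.nil_append, true_and, r1, h6, e1, hq, r5, r16, r17]
  have hout : (if q ≤ q + (wordAt M x u).length - 1 then q + (wordAt M x u).length - 1 + 1 else 0)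
      ≤ S := by
    split <;> omega
  iterate 16 refine And.intro (by omega) ?_
  refine .of_tick (.main _ _ _ (.pop m u st hidx hstk)) ?_ ?_
  · generalize hr' : Function.update _ 18 _ = r''
    have e : ∀ a, a ≠ 6 → a ≠ 14 → a ≠ 15 → a ≠ 18 → a ≠ 19 → a ≠ 20 → r'' a = r a :=
      fun i _ _ _ _ _ _ => by rw [← hr']; simp (disch := omega) only [Function.update_of_ne]
    refine ⟨hcon.congr fun a _ _ => e a (by omega) (by omega) (by omega) (by omega) (by omega)
      (by omega), ?_, ?_, ?_, ?_, ?_, ?_, ?_, ?_, fun z => (hrows z).congr (by omega) fun a _ _ => ?_⟩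
    · rw [e _ (by omega) (by omega) (by omega) (by omega) (by omega) (by omega), r2]
    · rw [e _ (by omega) (by omega) (by omega) (by omega) (by omega) (by omega), r5]
    · rw [← hr']; simp (disch := omega) only [Function.update_of_ne, Function.update_self]
    · rw [← hr']; simp (disch := omega) only [Function.update_of_ne, Function.update_self]
    · rw [e _ (by omega) (by omega) (by omega) (by omega) (by omega) (by omega), r16]
    · rw [e _ (by omega) (by omega) (by omega) (by omega) (by omega) (by omega), r17]
    · rw [← hr', Function.update_self]
    · have e6 : r'' 6 = q := by
        rw [← hr']; simp (disch := omega) only [Function.update_of_ne, Function.update_self]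
      rw [e6]
      exact hst.congr fun a _ _ => e a (by omega) (by omega) (by omega) (by omega) (by omega)
        (by omega)
    · have := le_row (E := E) (W := W) (z + 2)
      exact e a (by omega) (by omega) (by omega) (by omega) (by omega) (by omega)
  · rw [map_range'_of_stored (w := wordAt M x u) _ (by omega)]
    · rfl
    · exact hword.congr fun a _ _ => by simp (disch := omega) only [Function.update_of_ne]

theorem wp_mainCode (hS : Setup M Pa x E W B S) (hr : ∀ i, r i ≤ S)
    (hR : Rel M Pa x E W (.main m) r) (hI : SInv E now es (.main m)) :
    (Code.mainCode M).wp x S (TickPost M Pa x E W (.main m)) r [] := by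
  obtain ⟨b1, b2, b3, b4, b5, b6, b7⟩ := hS.bounds
  obtain ⟨hcon, r2, r5, r14, r15, r16, r17, r18, hst, hrows⟩ := id hR
  have r0 := hcon.r0
  have r1 := hcon.r1
  have r4 := hcon.r4
  have r7 := hcon.r7
  refine ⟨by omega, by omega, fun h => ⟨by omega, by omega, fun h' => ?_, fun h' => ?_⟩,
    fun h => ⟨by omega, by omega, fun h' => ?_, fun h' => ?_⟩⟩
  -- Each entry of the stack occupies at least the cell with its address, even for the empty word.
  -- Hence the stack is empty exactly if its pointer is at the bottom.
  · cases hstk : m.stack with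
    | nil => exact ⟨fun _ => ⟨m, rfl, hstk, rfl⟩, fun h => (h trivial).elim⟩
    | cons u st =>
      rw [hstk] at hst
      obtain ⟨q, hst, -, -, h6⟩ := hst
      have := hst.le
      omega
  · cases hstk : m.stack with
    | nil =>
      rw [hstk] at hst
      have : r 6 = 32 := hst
      omega
    | cons u st => exact wp_popCode hS hr hR hI (by omega) hstk
  · obtain ⟨i, hidx⟩ : ∃ i, m.idx = i + 1 := ⟨m.idx - 1, by omega⟩
    have h5 := hr 5
    have h15 := hr 15
    rw [r15, hidx] at h15
    rw [hidx] at r14 r15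
    have h14 := hr 14
    have e1 : E.row W (i + 1 + 1) - W = E.row W (i + 1) := by
      rw [row_succ (i + 1)]
      omega
    rw [r5] at h5
    simp (disch := omega) only [Code.wp, Instr.Straight, Instr.accessed,
      Instr.written, Instr.nextReg, Instr.emitted, Function.update_of_ne,
      List.append_nil, true_and, r1, r5, r14, r15, r4, Nat.add_sub_cancel, e1]
    iterate 6 refine And.intro (by omega) ?_
    refine .of_tick (.main _ _ _ (.move m i hidx (by omega))) ?_ rfl
    generalize hr' : Function.update _ 18 _ = r''
    have e : ∀ a, a ≠ 14 → a ≠ 15 → a ≠ 18 → r'' a = r a := fun i _ _ _ => by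
      rw [← hr']; simp (disch := omega) only [Function.update_of_ne]
    refine ⟨hcon.congr fun a _ _ => e a (by omega) (by omega) (by omega), ?_, ?_, ?_, ?_, ?_, ?_, ?_,
      ?_, fun z => (hrows z).congr (by omega) fun a _ _ => ?_⟩
    · rw [e _ (by omega) (by omega) (by omega), r2]
    · rw [e _ (by omega) (by omega) (by omega), r5]
    · rw [← hr']; simp (disch := omega) only [Function.update_of_ne, Function.update_self]
    · rw [← hr']; simp (disch := omega) only [Function.update_of_ne, Function.update_self]
    · rw [e _ (by omega) (by omega) (by omega), r16]
    · rw [e _ (by omega) (by omega) (by omega), r17]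
    · rw [← hr', Function.update_self]
    · rw [e _ (by omega) (by omega) (by omega)]
      exact hst.congr fun a _ _ => e a (by omega) (by omega) (by omega)
    · have := le_row (E := E) (W := W) (z + 2)
      exact e a (by omega) (by omega) (by omega)
  · obtain ⟨i, hidx⟩ : ∃ i, m.idx = i + 1 := ⟨m.idx - 1, by omega⟩
    exact wp_procCode hS hr hR hI hidx (by omega)

/-- The phase of a state. -/
def State.phase : State → ℕ
  | .pre _ _ => 0
  | .copy _ _ _ => 1
  | .eval _ _ => 2
  | .dig _ _ _ => 3
  | .main _ => 4

theorem Rel.phase {s : State} (h : Rel M Pa x E W s r) : Consts E W r ∧ r 2 = s.phase := by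
  cases s with
  | main m => exact ⟨h.1, h.2.1⟩
  | _ => exact ⟨h.1.consts, h.2.1⟩

/-- The dispatch on the phase loads constants into register 19, on which no state depends. -/
theorem Rel.update_temp (hW : 4 + E.V ≤ W) {s : State} (h : Rel M Pa x E W s r) (v : ℕ) :
    Rel M Pa x E W s (Function.update r 19 v) := by
  have e : ∀ a, a ≠ 19 → Function.update r 19 v a = r a := fun a h => Function.update_of_ne h _ _
  have hB : Before M x E W r → Before M x E W (Function.update r 19 v) := fun hB =>
    hB.congr hW (fun i _ _ _ _ _ _ => e i (by omega)) fun i hi => e i (by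
      have := le_row (E := E) (W := W) 2
      omega)
  have hH : ∀ {j c}, Holds E.V (E.row W j) c r → Holds E.V (E.row W j) c (Function.update r 19 v) :=
    fun {j c} hH => hH.congr fun i h1 h2 => e i (by
      have := le_row (E := E) (W := W) j
      omega)
  have hst : ∀ {st sp}, StackRel r (wordAt M x) st sp →
      StackRel (Function.update r 19 v) (wordAt M x) st sp :=
    fun h => h.congr fun i h1 h2 => e i (by omega)
  cases s with
  | pre t st =>
    obtain ⟨h0, h2, h8, h15, h6, h1, h3⟩ := h
    exact ⟨hB h0, h2, h8, h15, hst h6, hH h1, hH h3⟩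
  | copy t st j =>
    obtain ⟨h0, h2, h8, h15, h11, h6, ⟨A, hA, h9, hl, hw⟩, hw', h1, h3⟩ := h
    have := le_row (E := E) (W := W) 1
    have := h11.le
    exact ⟨hB h0, h2, h8, h15, hst h11, h6,
      ⟨A, hA, h9, hl, hw.congr fun i h1 h2 => e i (by omega)⟩,
      hw'.congr fun i h1 h2 => e i (by change r 11 ≤ i at h1; omega), hH h1, hH h3⟩
  | eval i st =>
    obtain ⟨h0, h2, h15, h6, h1⟩ := h
    exact ⟨hB h0, h2, h15, hst h6, hH h1⟩
  | dig i v st =>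
    obtain ⟨h0, h2, h12, h6, hi, h9, hw⟩ := h
    exact ⟨hB h0, h2, h12, hst h6, hi, h9,
      hw.congr fun i h1 h2 => e i (by change r 9 ≤ i at h1; omega)⟩
  | main m => exact h.main_congr hW fun a ha => e a (by omega)

/-- The interface between code and abstract machine: one pass through the loop body is one tick. -/
theorem wp_body (hS : Setup M Pa x E W B S) (hr : ∀ i, r i ≤ S) {s : State}
    (hR : Rel M Pa x E W s r) (hI : SInv E now es s) :
    (Code.body M Pa).wp x S (TickPost M Pa x E W s) r [] := by
  obtain ⟨b1, b2, -⟩ := hS.bounds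
  obtain ⟨hcon, h2⟩ := hR.phase
  have r0 := hcon.r0
  have hu : ∀ v ≤ S, ∀ a, Function.update r 19 v a ≤ S := fun v hv a => by
    rw [Function.update_apply]
    split
    · exact hv
    · exact hr a
  simp only [Code.body, Code.wp, Instr.Straight, Instr.accessed, Instr.written, Instr.nextReg,
    Instr.emitted, Function.update_self, Function.update_idem, List.append_nil, true_and,
    Function.update_of_ne (show (2 : ℕ) ≠ 19 by decide), h2, r0]
  refine ⟨by omega, by omega, fun h => ?_, fun h => ⟨by omega, by omega, by omega, by omega,
    fun h' => ?_, fun h' => ⟨by omega, by omega, by omega, by omega, fun h'' => ?_,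
    fun h'' => ⟨by omega, by omega, by omega, by omega, fun h3 => ?_, fun h3 => ?_⟩⟩⟩⟩
  · cases s with
    | pre t st => exact wp_preCode hS hr hR hI
    | _ => exact absurd h (by simp [State.phase])
  · cases s with
    | copy t st j => exact wp_copyCode hS (hu 1 (by omega)) (hR.update_temp (by omega) _) hI
    | _ => exact absurd h' (by simp [State.phase])
  · cases s with
    | eval i st => exact wp_calcCode hS (hR.update_temp (by omega) _) hI
    | _ => exact absurd h'' (by simp [State.phase])
  · cases s with
    | dig i v st => exact wp_digCode hS (hu 3 (by omega)) (hR.update_temp (by omega) _) hI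
    | _ => exact absurd h3 (by simp [State.phase])
  · cases s with
    | main m => exact wp_mainCode hS (hu 3 (by omega)) (hR.update_temp (by omega) _) hI
    | pre t st => exact absurd rfl h
    | copy t st j => exact absurd rfl h'
    | eval i st => exact absurd rfl h''
    | dig i v st => exact absurd rfl h3

end BodyTicks

/-! ## The new machine -/

namespace Code

def power : ℕ → Code → Code
  | 0, k => k
  | e + 1, k => op (.mul 13 13 19) (power e k)

def rowInit : Code :=
  op (.const 7 32) (op (.copy 6 7) (op (.add 20 13 1) (op (.mul 20 3 20) (op (.add 20 20 7)
    (op (.add 15 20 4) (op (.add 17 15 4) (op (.const 16 1) done)))))))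

/-- Initialization of the registers; `V` is `c * (n + 1) ^ e` and `W` is `w * V`. -/
def prologue (c e w : ℕ) : Code :=
  op (.const 1 1) (op (.inputLength 19) (op (.add 19 19 1) (op (.const 13 c) (power e
    (op (.const 20 24) (op (.mul 3 20 13) (op (.const 20 w) (op (.mul 4 20 13) (op (.const 20 4)
      (op (.add 23 20 13) rowInit))))))))))

end Code

/-- The prologue, followed by a loop. -/
def loopProgram (k₀ k : Code) : Program :=
  k₀.compile k₀.size (k₀.size + k.size) 0 ++ k.compile k₀.size (k₀.size + k.size) k₀.size

theorem containsAt_loopProgram (k₀ k : Code) :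
    ContainsAt (loopProgram k₀ k) (k₀.compile k₀.size (k₀.size + k.size) 0) 0 ∧
      ContainsAt (loopProgram k₀ k) (k.compile k₀.size (k₀.size + k.size) k₀.size) k₀.size := by
  have h : ContainsAt (loopProgram k₀ k) (loopProgram k₀ k) 0 := fun i _ => by rw [Nat.zero_add]
  refine ⟨h.left, ?_⟩
  have := h.right
  rwa [Code.length_compile, Nat.zero_add] at this

theorem length_loopProgram (k₀ k : Code) : (loopProgram k₀ k).length = k₀.size + k.size := by
  rw [loopProgram, List.length_append, Code.length_compile, Code.length_compile]

/-! ### From ticks to machine steps -/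

section Loop

variable {σ : ℕ} {M Pa : Program} {x : Word σ} {E : Env} {W B S now : ℕ} {es : List (ℕ × ℕ)}
  {r r' : ℕ → ℕ}

/-- The factor is at least 1, so the intermediate products are bounded by the final one. -/
theorem wp_power {Q : Prop → (ℕ → ℕ) → List (List ℕ) → Prop} {e : ℕ} {k : Code}
    {o : List (List ℕ)} (hS : 20 ≤ S) (h19 : 1 ≤ r 19) (h : r 13 * r 19 ^ e ≤ S)
    (hk : k.wp x S Q (Function.update r 13 (r 13 * r 19 ^ e)) o) :
    (Code.power e k).wp x S Q r o := by
  induction e generalizing r with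
  | zero => simpa [Code.power] using hk
  | succ e ih =>
    have h1 : r 13 * r 19 * r 19 ^ e = r 13 * r 19 ^ (e + 1) := by ring
    have h2 : r 13 * r 19 ≤ r 13 * r 19 * r 19 ^ e := Nat.le_mul_of_pos_right _ (by positivity)
    refine ⟨trivial, hS, by simp only [Instr.written]; omega, ?_⟩
    simp only [Instr.emitted, List.append_nil, Instr.nextReg]
    refine ih ?_ ?_ ?_
    · simpa using h19
    · simpa [h1] using h
    · simpa [h1] using hk

theorem wp_prologue {c e w : ℕ} (hV : E.V = c * (x.length + 1) ^ e) (hn : x.length + 1 ≤ E.V)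
    (hW : W = w * E.V) (hW4 : 4 ≤ W) (hS : E.row W 4 ≤ S) :
    (Code.prologue c e w).wp x S
      (fun b r o => ¬ b ∧ Rel M Pa x E W (.pre 0 []) r ∧ o = []) (fun _ => 0) [] := by
  have h0 : E.row W 0 = 32 + E.b * (E.V + 1) := by unfold Env.row; ring
  have h1 : E.row W 1 = E.row W 0 + W := row_succ 0
  have h2 : E.row W 2 = E.row W 1 + W := row_succ 1
  have h4 := row_mono (E := E) (W := W) (show 2 ≤ 4 by omega)
  have hcV : c ≤ E.V := hV ▸ Nat.le_mul_of_pos_right _ (by positivity)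
  have hwW : w ≤ W := hW ▸ Nat.le_mul_of_pos_right _ (by omega)
  have hb : 24 * E.V = E.b := rfl
  have hbV : E.b ≤ E.b * (E.V + 1) := Nat.le_mul_of_pos_right _ (by omega)
  simp (disch := omega) only [Code.prologue, Code.wp, Instr.Straight, Instr.accessed,
    Instr.written, Instr.nextReg, Instr.emitted, Function.update_self, Function.update_of_ne,
    List.append_nil, true_and]
  iterate 8 refine And.intro (by omega) ?_
  refine wp_power (by omega) ?_ ?_ ?_
  · simp (disch := omega) only [Function.update_self, Function.update_of_ne]
    omega
  · simp (disch := omega) only [Function.update_self, Function.update_of_ne]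
    omega
  · simp (disch := omega) only [Code.wp, Instr.Straight, Instr.accessed,
      Instr.written, Instr.nextReg, Instr.emitted, Function.update_self, Function.update_of_ne,
      List.append_nil, true_and, ← hV, ← hW, hb]
    iterate 12 refine And.intro (by omega) ?_
    generalize hr₁ : Function.update _ 23 _ = r₁
    have f : ∀ a, a = 0 ∨ a = 2 ∨ a = 5 ∨ a = 8 ∨ a = 14 ∨ a = 18 ∨ 32 ≤ a → r₁ a = 0 :=
      fun i hi => by rw [← hr₁]; simp (disch := omega) only [Function.update_of_ne]
    have f1 : r₁ 1 = 1 := by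
      rw [← hr₁]; simp (disch := omega) only [Function.update_self, Function.update_of_ne]
    have f3 : r₁ 3 = E.b := by
      rw [← hr₁]; simp (disch := omega) only [Function.update_self, Function.update_of_ne]
    have f4 : r₁ 4 = W := by
      rw [← hr₁]; simp (disch := omega) only [Function.update_self, Function.update_of_ne]
    have f13 : r₁ 13 = E.V := by
      rw [← hr₁]; simp (disch := omega) only [Function.update_self, Function.update_of_ne]
    have f23 : r₁ 23 = 4 + E.V := by
      rw [← hr₁]; simp (disch := omega) only [Function.update_self]
    have e0 : E.b * (E.V + 1) + 32 = E.row W 0 := by omega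
    simp (disch := omega) only [Code.rowInit, Code.wp, Instr.Straight, Instr.accessed,
      Instr.written, Instr.nextReg, Instr.emitted, Function.update_self, Function.update_of_ne,
      List.append_nil, true_and, f1, f3, f4, f13, e0, ← h1, ← h2]
    iterate 16 refine And.intro (by omega) ?_
    refine ⟨not_false, ?_, trivial⟩
    generalize hr' : Function.update _ 16 _ = r'
    have e : ∀ a, a < 6 ∨ (7 < a ∧ a < 15) ∨ a = 18 ∨ a = 23 ∨ 32 ≤ a → r' a = r₁ a :=
      fun i hi => by rw [← hr']; simp (disch := omega) only [Function.update_of_ne]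
    -- All rows are still zero, and zero registers with program counter zero are the initial
    -- configuration of any program. Nothing has to be initialized in the rows.
    have hH : ∀ (P : Program) j, Holds E.V (E.row W j) (run P x 0) r' := fun P j => by
      have := le_row (E := E) (W := W) j
      exact ⟨by rw [e _ (by omega), f _ (by omega)]; rfl,
        fun d _ => by rw [e _ (by omega), f _ (by omega)]; rfl⟩
    refine ⟨⟨⟨?_, ?_, ?_, ?_, ?_, ?_, ?_⟩, ?_, ?_, ?_, ?_,
      ?_, fun z => ?_⟩, ?_, ?_, ?_, ?_, hH _ _, hH _ _⟩
    · rw [e _ (by omega), f _ (by omega)]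
    · rw [e _ (by omega), f1]
    · rw [e _ (by omega), f3]
    · rw [e _ (by omega), f4]
    · rw [← hr']; simp (disch := omega) only [Function.update_self, Function.update_of_ne]
    · rw [e _ (by omega), f13]
    · rw [e _ (by omega), f23]
    · rw [e _ (by omega), f _ (by omega)]
    · rw [e _ (by omega), f _ (by omega)]
    · rw [← hr', Function.update_self]
    · rw [← hr']; simp (disch := omega) only [Function.update_self, Function.update_of_ne]
    · rw [e _ (by omega), f _ (by omega)]
    · have := le_row (E := E) (W := W) (z + 2)
      refine ⟨hH M (z + 2), ?_, ?_, ?_, fun i _ => ?_⟩ <;> rw [e _ (by omega), f _ (by omega)] <;> rfl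
    · rw [e _ (by omega), f _ (by omega)]
    · rw [e _ (by omega), f _ (by omega)]
    · rw [← hr']; simp (disch := omega) only [Function.update_self, Function.update_of_ne]
    · rw [← hr']; simp (disch := omega) only [Function.update_self, Function.update_of_ne]
      rfl

/-- Invariants at the start of the loop: the configuration `c` represents the state `s` after `now`
iterations, each of which has taken at most `K` steps. The list `ts` contains the iterations with an
output, with the times of the outputs. -/
structure LoopInv (M Pa : Program) (x : Word σ) (E : Env) (W S : ℕ) (P : Program) (l K : ℕ)
    (c : Config) (now : ℕ) (es ts : List (ℕ × ℕ)) (s : State) : Prop where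
  pc_eq : c.pc = l
  reached : ∃ t, run P x t = c ∧ ∀ u ≤ t, Within S (run P x u)
  rel : Rel M Pa x E W s c.reg
  inv : SInv E now es s
  words_eq : c.words = es.reverse.map fun y => wordAt M x y.1
  map_fst : ts.map Prod.fst = es.reverse.map Prod.snd
  map_snd : ts.map Prod.snd = c.out.map Prod.snd
  -- Outputs at ticks y.1 and z.1 are at most K(z.1 - y.1 + 1) steps apart; the additional K is due
  -- to the unknown position of an output within its tick. The form without subtraction suits
  -- natural numbers.
  pairwise : ts.Pairwise fun y z => z.2 + K * y.1 ≤ y.2 + K * (z.1 + 1)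
  le_first : ∀ y ∈ ts, y.2 ≤ K + K * (y.1 + 1)
  time_le_add : ∀ y ∈ ts, c.time + K * y.1 ≤ y.2 + K * now
  time_le : c.time ≤ K + K * now

theorem Within.of_reaches {P : Program} {K : ℕ} {c c' : Config} {w : List (List ℕ)}
    (h : Reaches P x S K c c' w) (hc : ∃ t, run P x t = c ∧ ∀ u ≤ t, Within S (run P x u)) :
    ∃ t, run P x t = c' ∧ ∀ u ≤ t, Within S (run P x u) := by
  obtain ⟨t, rfl, ht⟩ := hc
  obtain ⟨t', -, -, hrun, hw, -⟩ := h
  have hadd : ∀ u, run P x (t + u) = (step P x)^[u] (run P x t) := fun u => by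
    rw [run, run, Nat.add_comm, Function.iterate_add_apply]
  refine ⟨t + t', by rw [hadd, hrun], fun u hu => ?_⟩
  rcases Nat.lt_or_ge u t with h1 | h1
  · exact ht u h1.le
  · obtain ⟨v, rfl⟩ := Nat.exists_eq_add_of_le h1
    rw [hadd]
    exact hw v (by omega)

theorem LoopInv.step {P : Program} {l K : ℕ} {c c' : Config} {ts : List (ℕ × ℕ)} {s s' : State}
    (hL : LoopInv M Pa x E W S P l K c now es ts s) (hE : E.OK) {e : Option ℕ} {w : List (List ℕ)}
    (ht : Tick E s e s') (hr : Reaches P x S K c c' w) (hR : Rel M Pa x E W s' c'.reg)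
    (hw : w = e.toList.map (wordAt M x)) (hpc : c'.pc = l) :
    ∃ es' ts', LoopInv M Pa x E W S P l K c' (now + 1) es' ts' s' := by
  have hreach := Within.of_reaches hr hL.reached
  obtain ⟨t, -, -, -, -, h1, h2, o, hout, hmap, ho⟩ := hr
  have hK : ∀ y, K * (y + 1) = K * y + K := fun y => by ring
  refine ⟨_, ts ++ o.map fun y => (now, y.2), hpc, hreach, hR, hL.inv.tick hE ht, ?_, ?_, ?_, ?_,
    ?_, ?_, ?_⟩
  · have hwords : c'.words = c.words ++ w := by rw [Config.words, hout, List.map_append, hmap]; rfl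
    rw [hwords, hL.words_eq, hw]
    cases e <;> simp
  · rw [List.map_append, hL.map_fst, List.map_map, List.reverse_append, List.map_append]
    congr 1
    -- A tick outputs at most one word, so times and ticks of the outputs can be matched.
    have hlen : o.length = e.toList.length := by
      rw [← List.length_map (f := Prod.fst), hmap, hw, List.length_map]
    cases e with
    | none =>
      obtain rfl : o = [] := List.length_eq_zero_iff.mp hlen
      rfl
    | some u =>
      obtain ⟨y, rfl⟩ := List.length_eq_one_iff.mp hlen
      rfl
  · rw [List.map_append, hL.map_snd, hout, List.map_append, List.map_map]
    rfl
  · rw [List.pairwise_append]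
    refine ⟨hL.pairwise, ?_, ?_⟩
    · have hlen : o.length = e.toList.length := by
        rw [← List.length_map (f := Prod.fst), hmap, hw, List.length_map]
      cases e with
      | none =>
        obtain rfl : o = [] := List.length_eq_zero_iff.mp hlen
        exact List.Pairwise.nil
      | some u =>
        obtain ⟨y, rfl⟩ := List.length_eq_one_iff.mp hlen
        exact List.pairwise_singleton _ _
    · intro y hy z hz
      obtain ⟨z', hz', rfl⟩ := List.mem_map.mp hz
      have h3 := ho z' hz'
      have h4 := hL.time_le_add y hy
      simp only [hK]
      omega
  · intro y hy
    rcases List.mem_append.mp hy with hy | hy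
    · exact hL.le_first y hy
    · obtain ⟨z, hz, rfl⟩ := List.mem_map.mp hy
      have h3 := ho z hz
      have h4 := hL.time_le
      simp only [hK]
      omega
  · intro y hy
    rcases List.mem_append.mp hy with hy | hy
    · have h4 := hL.time_le_add y hy
      rw [hK]
      omega
    · obtain ⟨z, hz, rfl⟩ := List.mem_map.mp hy
      have h3 := ho z hz
      simp only [hK]
      omega
  · have h4 := hL.time_le
    rw [hK]
    omega

/-- A crude bound, independent of the state, on the number of ticks; its only purpose is
termination. -/
theorem SInv.now_le (hE : E.OK) {s : State} (h : SInv E now es s) :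
    now ≤ E.b + E.h + E.storeTime E.b + E.storeTime E.h + E.ia + E.digits.length + 3 +
      60 * (E.a' * E.count E.h) + E.count E.h := by
  have hmono : ∀ {t}, t ≤ E.h → E.storeTime t ≤ E.storeTime E.h := fun h =>
    Finset.sum_le_sum_of_subset (Finset.range_mono h)
  cases s with
  | pre t st =>
    obtain ⟨h1, h2, -, h3, -⟩ := h
    have := hmono h2
    omega
  | copy t st j =>
    obtain ⟨h1, h2, h3, -, h4, h5, -⟩ := h
    have h6 := hmono (show t + 1 ≤ E.h from h2)
    rw [storeTime_succ, if_pos h3] at h6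
    omega
  | eval i st =>
    obtain ⟨h1, h2, h3, h4, -⟩ := h
    omega
  | dig i v st =>
    obtain ⟨h1, h2, h3, h4, h5, -⟩ := h
    omega
  | main m =>
    obtain ⟨-, -, start, hm, h0, h1⟩ := h
    by_cases hn : m.num = 0
    · have h2 := hm.total
      have h3 := h0 hn
      have h4 := hm.length_le hE.lt_h
      change _ ≤ E.count E.h at h4
      rw [hn] at h2
      simp only [Finset.range_zero, Finset.sum_empty] at h2
      split at h2 <;> omega
    · have h2 := (hm.bounds hE hn).2.2.2
      have h3 := h1 hn
      omega

theorem LoopInv.halts (hS : Setup M Pa x E W B S) {P : Program} {l l' K : ℕ}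
    (hP : ContainsAt P ((Code.body M Pa).compile l l' l) l) (hK : (Code.body M Pa).size ≤ K)
    {c : Config} {ts : List (ℕ × ℕ)} {s : State}
    (hL : LoopInv M Pa x E W S P l K c now es ts s) :
    ∃ c now es ts m c', LoopInv M Pa x E W S P l K c now es ts (.main m) ∧ m.stack = [] ∧
      Reaches P x S K c c' [] ∧ c'.pc = l' := by
  obtain ⟨N, hN⟩ : ∃ N, N = E.b + E.h + E.storeTime E.b + E.storeTime E.h + E.ia +
    E.digits.length + 3 + 60 * (E.a' * E.count E.h) + E.count E.h := ⟨_, rfl⟩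
  -- Every pass through the loop that does not halt increases `now`, which is bounded by `N`.
  induction hd : N - now using Nat.strong_induction_on generalizing c now es ts s with
  | _ d ih =>
    have hle := hL.inv.now_le hS.ok
    have hwithin : Within S c := by
      obtain ⟨t, rfl, ht⟩ := hL.reached
      exact ht t le_rfl
    obtain ⟨c', w, b, hr, hQ, hb1, hb2⟩ := Code.reaches_of_wp _ l hP c hwithin hL.pc_eq []
      (wp_body hS hwithin.2 hL.rel hL.inv)
    by_cases hb : b
    · obtain ⟨m, rfl, hst, hw⟩ := hQ.halt hb
      rw [List.nil_append] at hw
      exact ⟨c, now, es, ts, m, c', hL, hst, hw ▸ hr.mono hK, hb1 hb⟩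
    · obtain ⟨e, s', ht, hR, hw⟩ := hQ.tick hb
      obtain ⟨es', ts', hL'⟩ := hL.step hS.ok ht (hr.mono hK) hR hw (hb2 hb)
      have hle' := hL'.inv.now_le hS.ok
      exact ih (N - (now + 1)) (by omega) hL' rfl

theorem loopProgram_halts (hS : Setup M Pa x E W B S) {k₀ : Code} {K : ℕ}
    (hk₀ : k₀.wp x S (fun b r o => ¬ b ∧ Rel M Pa x E W (.pre 0 []) r ∧ o = []) (fun _ => 0) [])
    (hK₀ : k₀.size ≤ K) (hK : (Code.body M Pa).size ≤ K) :
    ∃ c now es ts m c', LoopInv M Pa x E W S (loopProgram k₀ (Code.body M Pa)) k₀.size K c now es ts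
        (.main m) ∧ m.stack = [] ∧ Reaches (loopProgram k₀ (Code.body M Pa)) x S K c c' [] ∧
      Halted (loopProgram k₀ (Code.body M Pa)) c' := by
  obtain ⟨h1, h2⟩ := containsAt_loopProgram k₀ (Code.body M Pa)
  have hinit : Within S Config.init := ⟨Nat.zero_le _, fun _ => Nat.zero_le _⟩
  obtain ⟨c, w, b, hr, ⟨hb, hR, hw⟩, -, hpc⟩ :=
    Code.reaches_of_wp (Q := fun b r o => ¬ b ∧ Rel M Pa x E W (.pre 0 []) r ∧ o = []) k₀ 0 h1
      Config.init hinit rfl [] hk₀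
  have hreach := Within.of_reaches hr ⟨0, rfl, fun u hu => by rw [Nat.le_zero.mp hu]; exact hinit⟩
  obtain ⟨t, -, -, -, -, ht, -, o, hout, ho, -⟩ := hr
  rw [List.nil_append] at hw
  rw [hw, List.map_eq_nil_iff] at ho
  rw [ho] at hout
  have hout' : c.out = [] := hout
  have hL : LoopInv M Pa x E W S (loopProgram k₀ (Code.body M Pa)) k₀.size K c 0 [] [] (.pre 0 []) := by
    refine ⟨hpc hb, hreach, hR, ?_, ?_, rfl, ?_, List.Pairwise.nil, by simp, by simp, ?_⟩
    · refine ⟨Nat.zero_le _, Nat.zero_le _, ⟨List.nodup_nil, fun u => by simp⟩, ?_, rfl⟩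
      simp [Env.storeTime]
    · simp [Config.words, hout']
    · simp [hout']
    · have : Config.init.time = 0 := rfl
      omega
  obtain ⟨c, now, es, ts, m, c', hL', hst, hr', hpc'⟩ := hL.halts hS h2 hK
  exact ⟨c, now, es, ts, m, c', hL', hst, hr', by
    rw [Halted, length_loopProgram, hpc']⟩

end Loop

/-! ### Choice of the parameters for an instance -/

section Parameters

variable {σ : ℕ} {P : Program} {x : Word σ}

theorem HaltsWith.exists_time {c : Config} (h : HaltsWith P x c) :
    Halted P (run P x c.time) ∧ run P x c.time = c ∧ ∀ u < c.time, ¬ Halted P (run P x u) := by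
  classical
  obtain ⟨t, rfl, ht⟩ := h
  have hex : ∃ t, Halted P (run P x t) := ⟨t, ht⟩
  have h1 := Nat.find_spec hex
  have h2 : ∀ u < Nat.find hex, ¬ Halted P (run P x u) := fun u hu => Nat.find_min hex hu
  have h3 := run_of_halted h1 (Nat.find_min' hex ht)
  have h4 : (run P x t).time = Nat.find hex := by rw [h3]; exact run_time h2
  rw [h4]
  exact ⟨h1, h3.symm, h2⟩

theorem UsesSpace.length_wordAt_le {s : Polynomial ℕ} (hs : UsesSpace σ P s) (u : ℕ) :
    (wordAt P x u).length ≤ s.eval x.length := by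
  unfold wordAt emits outputOf
  cases h : P[(run P x u).pc]? with
  | none => simp
  | some I =>
    have h1 := hs.accessed_le h
    cases I with
    | output i j =>
      simp only [Instr.emitted, List.head?_cons, Option.getD_some, List.length_map,
        List.length_range', Instr.accessed] at h1 ⊢
      split at h1 <;> omega
    | _ => simp [Instr.emitted]

/-- A word of length at most V is determined by its values at the first V positions, each a letter
or "past the end". This bounds the length of the counters, hence the size of a row. -/
theorem ncard_words_le {V : ℕ} {S : Set (Word σ)} (h : ∀ y ∈ S, y.length ≤ V) :
    S.ncard ≤ (σ + 1) ^ V := by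
  have h1 : Set.InjOn (fun y : Word σ => fun i : Fin V => y[(i : ℕ)]?) S := by
    intro y hy z hz hyz
    refine List.ext_getElem? fun i => ?_
    rcases Nat.lt_or_ge i V with hi | hi
    · exact congrFun hyz ⟨i, hi⟩
    · rw [List.getElem?_eq_none ((h y hy).trans hi), List.getElem?_eq_none ((h z hz).trans hi)]
  rw [← h1.ncard_image]
  refine (Set.ncard_le_ncard (Set.subset_univ _) Set.finite_univ).trans ?_
  rw [Set.ncard_univ, Nat.card_eq_fintype_card]
  simp

/-- The parameters for the instance `x`. -/
structure Params (M Pa : Program) (A : EnumProblem σ) (d : Word σ → ℕ) (x : Word σ) (V : ℕ) (E : Env) :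
    Prop where
  V_eq : E.V = V
  a_eq : E.a = d x
  setup : Setup M Pa x E ((σ + 12) * V) ((σ + 1) * V + 1)
    (32 + 24 * V * (V + 1) + ((σ + 1) * V + 5) * ((σ + 12) * V))
  ncard_eq : (A x).ncard = E.count E.h
  inj : ∀ u v, E.em u = true → E.em v = true → wordAt M x u = wordAt M x v → u = v
  image_eq : encode '' A x = {z | ∃ u, E.em u = true ∧ wordAt M x u = z}
  nonempty : (A x).Nonempty → E.count E.h ≠ 0

theorem exists_params {A : EnumProblem σ} {d : Word σ → ℕ} {M Pa : Program} {p s qa : Polynomial ℕ}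
    (hM : SolvesByFlashlight M A p d) (hspace : UsesSpace σ M s) (hspace' : UsesSpace σ Pa qa)
    {cPa : Config} (hPa : HaltsWith Pa x cPa) (hPa' : cPa.time ≤ qa.eval x.length)
    (hPa'' : cPa.words = [Nat.digits 2 (d x)]) {V : ℕ} (hp : p.eval x.length ≤ V)
    (hs : s.eval x.length ≤ V) (hqa : qa.eval x.length ≤ V) (h1 : pcBound M ≤ V)
    (h2 : pcBound Pa ≤ V) (hV : 1 ≤ V) : ∃ E, Params M Pa A d x V E := by
  obtain ⟨h, hh, hnh, hempty, hne⟩ := hM.density x hp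
  obtain ⟨hnd, himg, hcard⟩ := hM.1.ncard_eq x hh
  obtain ⟨hcP, hcP', hcP''⟩ := hPa.exists_time
  -- `Pa` outputs exactly one word in all, hence nothing before the step `ia` at which the digits
  -- appear.
  have hcount : #{u ∈ range cPa.time | (emits Pa x u).isSome} = 1 := by
    rw [← length_words_run, hcP', hPa'']
    rfl
  obtain ⟨ia, hia, hia'⟩ : ∃ u < cPa.time, emits Pa x u = some (Nat.digits 2 (d x)) := by
    rw [← mem_words_run, hcP', hPa'']
    exact List.mem_singleton_self _
  have hnone : ∀ i < ia, emits Pa x i = none := by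
    intro i hi
    by_contra hc
    obtain ⟨u, hu⟩ := Finset.card_eq_one.mp hcount
    have h3 : i ∈ ({u} : Finset ℕ) := by
      rw [← hu]
      exact Finset.mem_filter.mpr ⟨Finset.mem_range.mpr (by omega), Option.isSome_iff_ne_none.mpr hc⟩
    have h4 : ia ∈ ({u} : Finset ℕ) := by
      rw [← hu]
      exact Finset.mem_filter.mpr ⟨Finset.mem_range.mpr hia, by simp [hia']⟩
    rw [Finset.mem_singleton] at h3 h4
    omega
  have hlt : ∀ u, (emits M x u).isSome = true → u < h := fun u hu => by
    by_contra hc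
    refine not_halted_of_emits hu ?_
    rw [run_of_halted hh (not_lt.mp hc)]
    exact hh
  have hmem : ∀ u, (emits M x u).isSome = true → ∃ y ∈ A x, encode y = wordAt M x u := fun u hu => by
    have : wordAt M x u ∈ encode '' A x := by
      rw [← himg]
      exact mem_words_run.mpr ⟨u, hlt u hu, emits_of_isSome hu⟩
    exact this
  have hwords : encode '' A x = {z | ∃ u, (emits M x u).isSome = true ∧ wordAt M x u = z} := by
    rw [← himg]
    ext z
    rw [Set.mem_ofPred_eq, mem_words_run]
    constructor
    · rintro ⟨u, _, hu⟩
      exact ⟨u, by simp [hu], by simp [wordAt, hu]⟩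
    · rintro ⟨u, hu, rfl⟩
      exact ⟨u, hlt u hu, emits_of_isSome hu⟩
  have hwl : ∀ u, (wordAt M x u).length ≤ V := fun u => (hspace.length_wordAt_le u).trans hs
  -- The solutions fit into the memory of `M`, so their length is polynomially bounded even if k(x)
  -- is not.
  have hlen : ∀ y ∈ A x, y.length ≤ V := by
    intro y hy
    have h3 : encode y ∈ {z | ∃ u, (emits M x u).isSome = true ∧ wordAt M x u = z} :=
      hwords ▸ Set.mem_image_of_mem _ hy
    obtain ⟨u, -, hu⟩ := h3
    have h4 := hwl u
    rw [hu] at h4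
    simpa [encode] using h4
  have hnonempty : (A x).Nonempty ↔ countOutputs M x (range h) ≠ 0 := by
    rw [← hcard]
    have hfin : (A x).Finite := by
      refine Set.Finite.of_finite_image (f := encode) ?_ encode_injective.injOn
      rw [← himg]
      exact List.finite_toSet _
    rw [Ne, Set.ncard_eq_zero hfin]
    exact Set.nonempty_iff_ne_empty
  refine ⟨⟨V, h, ia, d x, fun u => (emits M x u).isSome, fun u => (wordAt M x u).length,
    Nat.digits 2 (d x)⟩, rfl, rfl, ⟨⟨hV, hlt, hwl, ?_, ?_, Nat.ofDigits_digits _ _, fun h0 => ?_,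
      fun h0 => ?_, fun h0 => ?_⟩, fun _ => rfl, fun _ => rfl, hh, hnh, h1, h2, ?_, ?_, ?_, ?_, hnone, ?_,
      hia', fun z hz => Nat.digits_lt_base (by norm_num) hz, ?_, ?_, ?_⟩, hcard, ?_, hwords, ?_⟩
  · change ia ≤ V
    omega
  · have h3 := hspace'.length_wordAt_le (x := x) ia
    rw [wordAt, hia'] at h3
    exact h3.trans hqa
  · refine hempty (Set.not_nonempty_iff_eq_empty.mp fun hA => hnonempty.mp hA h0)
  · exact (hne (hnonempty.mpr h0)).1
  · exact (hne (hnonempty.mpr h0)).2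
  · exact fun t i => ((hspace x t).2 i).trans hs
  · exact fun t i => ((hspace' x t).2 i).trans hqa
  · exact fun t I hI => (hspace.accessed_le hI).trans hs
  · exact fun t I hI => (hspace'.accessed_le hI).trans hqa
  · exact fun i hi => hcP'' i (lt_of_le_of_lt hi hia)
  -- Since σ + 1 ≤ 2^(σ+1), the number of solutions is below 2^B for B = (σ + 1)V + 1.
  · refine hcard.symm.le.trans_lt ((ncard_words_le hlen).trans_lt ?_)
    calc (σ + 1) ^ V ≤ (2 ^ (σ + 1)) ^ V := Nat.pow_le_pow_left Nat.lt_two_pow_self.le _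
      _ = 2 ^ ((σ + 1) * V) := (pow_mul _ _ _).symm
      _ < 2 ^ ((σ + 1) * V + 1) := Nat.pow_lt_pow_right (by norm_num) (Nat.lt_succ_self _)
  · simp only
    nlinarith
  · unfold Env.row Env.b
    simp only
    apply le_of_eq
    ring
  · intro u v hu hv huv
    exact wordAt_injOn hnd (hlt u hu) (hlt v hv) hu hv huv
  · exact hnonempty.mp

/-- A number has at most as many bits as its value, so S registers with values up to S occupy at
most S² bits. -/
theorem Within.space_le {S : ℕ} {c : Config} (h : Within S c) (hS : 1 ≤ S) : c.space ≤ S * S := by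
  unfold Config.space
  calc _ ≤ ∑ i ∈ range c.top, S := Finset.sum_le_sum fun i _ => by
        refine max_le hS ((Nat.size_le.mpr ?_).trans (h.2 i))
        exact Nat.lt_two_pow_self
    _ = c.top * S := by simp
    _ ≤ S * S := Nat.mul_le_mul_right _ h.1

end Parameters

/-! ### Delay and running time -/

section Final

variable {σ : ℕ} {x : Word σ} {E : Env} {now : ℕ} {es : List (ℕ × ℕ)} {m : Main}

/-- The schedule of the outputs at the end of the computation. -/
theorem SInv.schedule (hE : E.OK) (hI : SInv E now es (.main m)) {B k : ℕ}
    (hB : E.count E.h < 2 ^ B) (hk : ∀ u, E.em u = true → E.wl u ≤ k) :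
    ∃ start G l, (start :: (es.map Prod.snd).reverse).IsChain (fun p q => p ≤ q ∧ q ≤ p + G) ∧
      (∀ q ∈ (start :: (es.map Prod.snd).reverse).getLast?, now ≤ q + G) ∧
      start + G ≤ E.b * (E.V + 2) + 2 * E.V + 5 + B * (E.b + 2) ∧
      now ≤ start + 60 * (E.a * E.count E.h) + E.count E.h + 1 ∧
      (E.count E.h ≠ 0 → 1 ≤ E.a ∧ G + 1 ≤ 26 * E.a * l ∧ 1 ≤ l ∧ 2 ^ l ≤ E.count E.h + 1 ∧
        (2 ≤ E.count E.h → 2 ^ l ≤ E.count E.h) ∧ start + 2 ≤ 6 * (max E.a k * E.count E.h)) := by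
  obtain ⟨hD, hD0, start, hm, hs0, hs1⟩ := hI
  have hV := hE.one_le_V
  have hb : E.b = 24 * E.V := rfl
  have hia := hE.ia_le
  have hdl := hE.length_le
  have haa : E.a' ≤ E.a := min_le_left _ _
  have hchain : (start :: (es.map Prod.snd).reverse).IsChain
      (fun p q => p ≤ q ∧ q ≤ p + (m.num + 1) * (m.D + 2)) := by
    rw [← List.isChain_reverse, List.reverse_cons, List.reverse_reverse]
    exact hm.sorted
  have hlast : ∀ q ∈ (start :: (es.map Prod.snd).reverse).getLast?,
      now ≤ q + (m.num + 1) * (m.D + 2) := by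
    intro q hq
    rw [← List.head?_reverse, List.reverse_cons, List.reverse_reverse] at hq
    have h1 := (hm.age q hq).2
    have h2 : (m.num - m.idx) * (m.D + 2) ≤ m.num * (m.D + 2) :=
      Nat.mul_le_mul_right _ (Nat.sub_le _ _)
    rw [add_mul]
    omega
  have hlen := hm.length_le hE.lt_h
  change _ ≤ E.count E.h at hlen
  have hst : ∀ t, E.storeTime t ≤ (E.V + 1) * E.count t := E.storeTime_le fun u _ => hE.wl_le u
  have hstk : ∀ t, E.storeTime t ≤ (k + 1) * E.count t := E.storeTime_le hk
  have hcountb : E.storeTime E.b ≤ E.b * (E.V + 1) := by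
    rw [mul_comm E.b]
    exact (hst E.b).trans (Nat.mul_le_mul_left _ (E.count_le E.b))
  have hb2 : E.b * (E.V + 2) = E.b * (E.V + 1) + E.b := by ring
  have ha1 : E.count E.h ≠ 0 → 1 ≤ E.a' := fun h0 => by
    by_contra hc
    have h1 := hE.h_le h0
    have h2 := E.count_le E.h
    rw [show E.a' = 0 by omega, zero_mul] at h1
    omega
  have hmul : E.a' * E.count E.h ≤ E.a * E.count E.h := Nat.mul_le_mul_right _ haa
  have hmax : E.a * E.count E.h ≤ max E.a k * E.count E.h :=
    Nat.mul_le_mul_right _ (le_max_left _ _)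
  -- Storing a word costs k + 1 ticks, at most 2 max(a, k) because a ≥ 1 when there is a solution.
  have hmaxk : E.count E.h ≠ 0 → ∀ t, E.storeTime t ≤ 2 * (max E.a k * E.count E.h) := by
    intro h0 t
    have h1 := ha1 h0
    have h2 : k + 1 ≤ 2 * max E.a k := by
      have := le_max_left E.a k
      have := le_max_right E.a k
      omega
    calc _ ≤ (k + 1) * E.count t := hstk t
      _ ≤ 2 * max E.a k * E.count E.h := Nat.mul_le_mul h2 (E.count_le_count_h hE t)
      _ = _ := mul_assoc _ _ _
  have hmax1 : E.count E.h ≠ 0 → 1 ≤ max E.a k * E.count E.h := fun h0 => by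
    have h1 := ha1 h0
    exact Nat.mul_pos (lt_of_lt_of_le (by omega) (le_max_left _ _)) (by omega)
  -- Without processes, words are only popped and the gap is constant; the exponent l = 1 is
  -- admissible since N ≥ 1. With processes, l = num + 2.
  by_cases hn : m.num = 0
  · have h1 := hm.total
    have h2 := hm.h_le hn
    have h3 := hs0 hn
    have h4 := hD0 hn
    rw [hn] at h1
    simp only [Finset.range_zero, Finset.sum_empty] at h1
    have h5 : E.storeTime E.h ≤ E.storeTime E.b := Finset.sum_le_sum_of_subset (Finset.range_mono h2)
    rw [hn, h4] at hchain hlast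
    refine ⟨start, (0 + 1) * (0 + 2), 1, hchain, hlast, ?_, ?_, fun h0 => ⟨(ha1 h0).trans haa, ?_, le_rfl, ?_, ?_, ?_⟩⟩
    · omega
    · split at h1 <;> omega
    · have := (ha1 h0).trans haa
      omega
    · omega
    · intro h
      omega
    · have h6 := hE.h_le h0
      have h7 := hmaxk h0 E.h
      have h8 := hmax1 h0
      omega
  · obtain ⟨h0, h1, h2, h3⟩ := hm.bounds hE hn
    have h4 := hs1 hn
    have h5 := hD hn
    have h6 : m.num + 2 < B := (Nat.pow_lt_pow_iff_right (by norm_num)).mp (h2.trans_lt hB)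
    have h7 : (m.num + 1) * (m.D + 2) ≤ B * (E.b + 2) :=
      Nat.mul_le_mul (by omega) (Nat.add_le_add_right hm.D_le _)
    have h8 := hm.le_h hn
    have h9 := hE.h_le h0
    refine ⟨start, _, m.num + 2, hchain, hlast, by omega, by omega,
      fun _ => ⟨h1.trans haa, ?_, by omega, by omega, fun _ => h2, ?_⟩⟩
    · rw [h5]
      have h10 : (m.num + 1) * (24 * E.a' + 2) ≤ (m.num + 1) * (26 * E.a) :=
        Nat.mul_le_mul_left _ (by omega)
      have h11 : 26 * E.a * (m.num + 2) = (m.num + 1) * (26 * E.a) + 26 * E.a := by ring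
      omega
    · have h10 := hmaxk h0 E.b
      omega

variable {M Pa : Program} {A : EnumProblem σ} {d : Word σ → ℕ} {V : ℕ}

/-- By `MInv.complete`, an empty stack means that every output step of `M` has been treated; the
words then are the solutions, each once. -/
theorem LoopInv.solves (hP : Params M Pa A d x V E) {P : Program} {W S l K : ℕ} {c : Config}
    {ts : List (ℕ × ℕ)} (hL : LoopInv M Pa x E W S P l K c now es ts (.main m))
    (hst : m.stack = []) :
    c.words.Nodup ∧ {z | z ∈ c.words} = encode '' A x ∧ ts.length = E.count E.h := by
  have hI := hL.inv
  obtain ⟨hD, -, start, hm, -, -⟩ := hI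
  have hE := hP.setup.ok
  have hmem : ∀ u, u ∈ es.map Prod.fst ↔ E.em u = true := fun u =>
    ⟨fun h => ((hm.mem u).mp h).1, hm.complete hE hst hD u⟩
  have hwords : c.words = (es.map Prod.fst).reverse.map (wordAt M x) := by
    rw [hL.words_eq, ← List.map_reverse, List.map_map]
    rfl
  refine ⟨?_, ?_, ?_⟩
  · rw [hwords]
    refine (List.nodup_reverse.mpr hm.nodup).map_on fun u hu v hv huv => ?_
    rw [List.mem_reverse, hmem] at hu hv
    exact hP.inj u v hu hv huv
  · rw [hP.image_eq, hwords]
    ext z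
    simp only [Set.mem_ofPred_eq, List.mem_map (f := wordAt M x), List.mem_reverse, hmem]
  · have h1 : ts.length = es.length := by
      rw [← List.length_map (f := Prod.fst), hL.map_fst, List.length_map, List.length_reverse]
    rw [h1, ← List.length_map (as := es) Prod.fst, ← List.toFinset_card_of_nodup hm.nodup]
    unfold Env.count
    congr 1
    ext u
    rw [List.mem_toFinset, hmem, Finset.mem_filter, Finset.mem_range]
    exact ⟨fun h => ⟨hE.lt_h u h, h⟩, fun h => h.2⟩

theorem outputTime_eq {c : Config} {ts : List (ℕ × ℕ)} (h : ts.map Prod.snd = c.out.map Prod.snd)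
    {i : ℕ} (hi : i < ts.length) : c.outputTime (i + 1) = ts[i].2 := by
  unfold Config.outputTime
  rw [← h, Nat.add_sub_cancel, List.getD_eq_getElem _ _ (by rwa [List.length_map]), List.getElem_map]

/-- The bound for the preprocessing time. -/
def prepBound (σ V : ℕ) : ℕ :=
  24 * V * (V + 2) + 2 * V + 10 + ((σ + 1) * V + 1) * (24 * V + 2)

theorem LoopInv.times (hP : Params M Pa A d x V E) {k : ℕ} (hk : ∀ y ∈ A x, y.length ≤ k)
    {P : Program} {W S l K : ℕ} {c c' : Config} {ts : List (ℕ × ℕ)}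
    (hL : LoopInv M Pa x E W S P l K c now es ts (.main m))
    (hst : m.stack = []) (hout : c'.out = c.out) (htime : c'.time ≤ c.time + K) :
    (A x = ∅ → c'.time ≤ K * prepBound σ V) ∧
      ((A x).Nonempty → c'.outputTime 1 ≤ K * prepBound σ V ∧
        ∃ g, 2 ^ g ≤ (A x).ncard + 1 ∧ (2 ≤ (A x).ncard → 2 ^ g ≤ (A x).ncard) ∧
          (∀ i, 1 ≤ i → i < (A x).ncard →
            c'.outputTime (i + 1) ≤ c'.outputTime i + 100 * K * d x * g) ∧
          c'.time ≤ c'.outputTime (A x).ncard + 100 * K * d x * g ∧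
          c'.time ≤ c'.outputTime 1 + 100 * K * d x * (A x).ncard ∧
          c'.time ≤ 100 * K * max (d x) k * (A x).ncard) := by
  have hE := hP.setup.ok
  obtain ⟨-, -, hlen⟩ := hL.solves hP hst
  have hwl : ∀ u, E.em u = true → E.wl u ≤ k := by
    intro u hu
    have h1 : wordAt M x u ∈ encode '' A x := by
      rw [hP.image_eq]
      exact ⟨u, hu, rfl⟩
    obtain ⟨y, hy, hyu⟩ := h1
    rw [hP.setup.wl_eq, ← hyu]
    simpa [encode] using hk y hy
  obtain ⟨start, G, g, hchain, hlast, hstart, hnow, hne⟩ :=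
    hL.inv.schedule hE hP.setup.count_lt hwl
  have hQ : E.b * (E.V + 2) + 2 * E.V + 5 + ((σ + 1) * V + 1) * (E.b + 2) + 5 = prepBound σ V := by
    unfold prepBound Env.b
    rw [hP.V_eq]
    ring
  rw [hP.a_eq] at hnow hne
  rw [← hP.ncard_eq] at hnow hne hlen
  have hT := hL.time_le
  constructor
  · intro hA
    rw [hA, Set.ncard_empty] at hnow
    have h1 : K + K * now + K ≤ K * prepBound σ V := by
      have : K + K * now + K = K * (now + 2) := by ring
      rw [this]
      exact Nat.mul_le_mul_left _ (by omega)
    omega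
  · intro hA
    obtain ⟨ha, hG, hg, hg1, hg2, hst2⟩ := hne (by rw [hP.ncard_eq]; exact hP.nonempty hA)
    have hN : 1 ≤ (A x).ncard := by
      rw [hP.ncard_eq]
      exact Nat.one_le_iff_ne_zero.mpr (hP.nonempty hA)
    rw [← hL.map_fst.trans (List.map_reverse ..)] at hchain hlast
    rw [List.isChain_iff_getElem] at hchain
    have hc0 := hchain 0 (by simp; omega)
    simp only [List.getElem_cons_zero, List.getElem_cons_succ, List.getElem_map, Nat.zero_add] at hc0
    have hot : ∀ i (hi : i < ts.length), c'.outputTime (i + 1) = ts[i].2 := fun i hi =>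
      outputTime_eq (hL.map_snd.trans (by rw [hout])) hi
    have h0 : 0 < ts.length := by omega
    have hlast' : now ≤ (ts[ts.length - 1]'(by omega)).1 + G := by
      refine hlast _ ?_
      rw [List.getLast?_cons, List.getLast?_eq_getElem?, List.getElem?_map]
      simp [h0]
    have hN' : c'.outputTime (A x).ncard = (ts[ts.length - 1]'(by omega)).2 := by
      rw [← hot (ts.length - 1) (by omega), Nat.sub_add_cancel h0, hlen]
    have haN : (A x).ncard ≤ d x * (A x).ncard := Nat.le_mul_of_pos_left _ ha
    -- The gap of G ticks, plus one tick because outputs may occur anywhere in their ticks, in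
    -- machine steps.
    have hKG : K * (G + 1) ≤ 26 * K * d x * g := by
      calc _ ≤ K * (26 * d x * g) := Nat.mul_le_mul_left _ hG
        _ = _ := by ring
    have hKg : 26 * K * d x * g ≤ 100 * K * d x * g := by
      gcongr
      norm_num
    refine ⟨?_, g, hg1, hg2, ?_, ?_, ?_, ?_⟩
    · rw [hot 0 h0]
      have h1 := hL.le_first _ (List.getElem_mem h0)
      have h2 : K + K * (ts[0].1 + 1) = K * (ts[0].1 + 2) := by ring
      rw [h2] at h1
      refine h1.trans (Nat.mul_le_mul_left _ ?_)
      omega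
    · intro i hi hiN
      obtain ⟨i, rfl⟩ : ∃ j, i = j + 1 := ⟨i - 1, by omega⟩
      have hi2 : i + 1 < ts.length := by omega
      rw [hot i (by omega), hot (i + 1) hi2]
      have h1 := List.pairwise_iff_getElem.mp hL.pairwise i (i + 1) (by omega) hi2 (Nat.lt_succ_self i)
      have h2 := hchain (i + 1) (by simp; omega)
      simp only [List.getElem_cons_succ, List.getElem_map] at h2
      have h3 : K * (ts[i + 1].1 + 1) ≤ K * ts[i].1 + K * (G + 1) := by
        rw [← mul_add]
        exact Nat.mul_le_mul_left _ (by omega)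
      omega
    · have h1 := hL.time_le_add _ (List.getElem_mem (show ts.length - 1 < ts.length by omega))
      rw [hN']
      have h3 : K * now + K ≤ K * ts[ts.length - 1].1 + K * (G + 1) := by
        rw [← mul_add, ← Nat.mul_succ]
        exact Nat.mul_le_mul_left _ (by omega)
      omega
    · have h1 := hL.time_le_add _ (List.getElem_mem h0)
      rw [hot 0 h0]
      have h3 : K * now + K ≤ K * ts[0].1 + K * (100 * (d x * (A x).ncard)) := by
        rw [← mul_add, ← Nat.mul_succ]
        exact Nat.mul_le_mul_left _ (by omega)
      have h4 : K * (100 * (d x * (A x).ncard)) = 100 * K * d x * (A x).ncard := by ring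
      omega
    · have hmax : d x * (A x).ncard ≤ max (d x) k * (A x).ncard :=
        Nat.mul_le_mul_right _ (le_max_left _ _)
      have h3 : K + K * now + K ≤ K * (100 * (max (d x) k * (A x).ncard)) := by
        have : K + K * now + K = K * (now + 2) := by ring
        rw [this]
        exact Nat.mul_le_mul_left _ (by omega)
      have h4 : K * (100 * (max (d x) k * (A x).ncard)) = 100 * K * max (d x) k * (A x).ncard := by
        ring
      omega

end Final

/-! ### The machine with small delay -/

section Machine

variable {σ : ℕ} {x : Word σ} {E : Env} {M Pa : Program} {A : EnumProblem σ} {d : Word σ → ℕ} {V : ℕ}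

/-- The machine that solves the problem with small delay. -/
def amortized (M Pa : Program) (σ c e : ℕ) : Program :=
  loopProgram (Code.prologue c e (σ + 12)) (Code.body M Pa)

/-- The bound for the space of the new machine. -/
def spaceBound (σ V : ℕ) : ℕ := 32 + 24 * V * (V + 1) + ((σ + 1) * V + 5) * ((σ + 12) * V)

/-- All bounds for one instance, with a gap expressed by an integer exponent `g` instead of the
logarithm. The constant `K` depends on the programs and on σ, but not on `x`. -/
theorem amortized_spec (hP : Params M Pa A d x V E) {c e k K : ℕ} (hk : ∀ y ∈ A x, y.length ≤ k)
    (hV : V = c * (x.length + 1) ^ e) (hn : x.length + 1 ≤ V)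
    (hK₀ : (Code.prologue c e (σ + 12)).size ≤ K) (hK : (Code.body M Pa).size ≤ K) :
    (∀ t, Within (spaceBound σ V) (run (amortized M Pa σ c e) x t)) ∧
      ∃ c', HaltsWith (amortized M Pa σ c e) x c' ∧ c'.words.Nodup ∧
        {z | z ∈ c'.words} = encode '' A x ∧ (A x = ∅ → c'.time ≤ K * prepBound σ V) ∧
        ((A x).Nonempty → c'.outputTime 1 ≤ K * prepBound σ V ∧
          ∃ g, 2 ^ g ≤ (A x).ncard + 1 ∧ (2 ≤ (A x).ncard → 2 ^ g ≤ (A x).ncard) ∧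
            (∀ i, 1 ≤ i → i < (A x).ncard →
              c'.outputTime (i + 1) ≤ c'.outputTime i + 100 * K * d x * g) ∧
            c'.time ≤ c'.outputTime (A x).ncard + 100 * K * d x * g ∧
            c'.time ≤ c'.outputTime 1 + 100 * K * d x * (A x).ncard ∧
            c'.time ≤ 100 * K * max (d x) k * (A x).ncard) := by
  have hrow := row_mono (E := E) (W := (σ + 12) * V) (show 4 ≤ (σ + 1) * V + 1 + 4 by omega)
  have hV' := hP.V_eq
  have hW4 : 4 ≤ (σ + 12) * V := by nlinarith
  obtain ⟨c₁, now, es, ts, m, c', hL, hst, hr, hh⟩ := loopProgram_halts hP.setup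
    (wp_prologue (M := M) (Pa := Pa) (E := E) (w := σ + 12) (hV'.trans hV) (by omega)
      (by rw [hV']) hW4 (hrow.trans hP.setup.le_S)) hK₀ hK
  obtain ⟨t, ht, hw⟩ := Within.of_reaches hr hL.reached
  obtain ⟨-, -, -, -, -, htime, -, o, hout, ho, -⟩ := hr
  rw [List.map_eq_nil_iff] at ho
  rw [ho, List.append_nil] at hout
  obtain ⟨h1, h2, -⟩ := hL.solves hP hst
  have hwords : c'.words = c₁.words := by rw [Config.words, hout]; rfl
  refine ⟨fun u => ?_, c', ⟨t, ht, hh⟩, hwords ▸ h1, hwords ▸ h2, hL.times hP hk hst hout htime⟩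
  rcases le_total u t with hu | hu
  · exact hw u hu
  · have := run_of_halted (ht.symm ▸ hh) hu
    have h3 := hw t le_rfl
    rw [← this] at h3
    exact h3

end Machine

end EnumRAM

/-! ### The main theorem -/

open EnumRAM in
theorem mainTheorem5 (σ : ℕ)
    (A : EnumRAM.EnumProblem σ)
    (k : EnumRAM.Word σ → ℕ) (hk : ∀ x, ∀ y ∈ A x, y.length ≤ k x)
    (a : ℕ → ℕ → ℕ) (ha : EnumRAM.PolyComputable fun x : EnumRAM.Word σ => a x.length (k x))
    (M : EnumRAM.Program) (p s : Polynomial ℕ)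
    (hM : EnumRAM.SolvesByFlashlight M A p fun x => a x.length (k x))
    (hspace : EnumRAM.UsesSpace σ M s) :
    ∃ (M' : EnumRAM.Program) (q : Polynomial ℕ) (C : ℕ),
      EnumRAM.Solves M' A ∧ EnumRAM.UsesSpace σ M' q ∧
      ∀ (x : EnumRAM.Word σ) (c : EnumRAM.Config), EnumRAM.HaltsWith M' x c →
        (A x = ∅ → c.time ≤ q.eval x.length) ∧
        ((A x).Nonempty →
          -- polynomial preprocessing
          c.outputTime 1 ≤ q.eval x.length ∧
          -- delay between consecutive solutions
          (∀ i, 1 ≤ i → i < (A x).ncard →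
            (c.outputTime (i + 1) : ℝ) ≤
              c.outputTime i + C * a x.length (k x) * Real.logb 2 (A x).ncard) ∧
          -- time between the last solution and the end
          (c.time : ℝ) ≤ c.outputTime (A x).ncard +
            C * a x.length (k x) * Real.logb 2 ((A x).ncard + 1) ∧
          -- average delay after the preprocessing, and average delay of the whole computation
          c.time ≤ c.outputTime 1 + C * a x.length (k x) * (A x).ncard ∧
          c.time ≤ C * max (a x.length (k x)) (k x) * (A x).ncard) := by
  obtain ⟨Pa, qa, hspace', hPa⟩ := ha
  -- One polynomial dominating path time, space, the computation of a and both program counters. The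
  -- constant 1 makes its coefficient `b` positive, and the exponent e + 1 used below ensures n + 1
  -- ≤ V.
  obtain ⟨e, he⟩ := exists_monomial_bound
    (p + s + qa + Polynomial.C (pcBound M + pcBound Pa + 1))
  obtain ⟨b, hb⟩ : ∃ b, b = Polynomial.eval 1
    (p + s + qa + Polynomial.C (pcBound M + pcBound Pa + 1)) := ⟨_, rfl⟩
  simp only [← hb, Polynomial.eval_add, Polynomial.eval_C] at he
  simp only [Polynomial.eval_add, Polynomial.eval_C] at hb
  have hV : ∀ n : ℕ, b * (n + 1) ^ e ≤ b * (n + 1) ^ (e + 1) := fun n =>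
    Nat.mul_le_mul_left _ (Nat.pow_le_pow_right (Nat.succ_pos n) (Nat.le_succ e))
  have hn : ∀ n : ℕ, n + 1 ≤ b * (n + 1) ^ (e + 1) := fun n =>
    (Nat.le_self_pow (Nat.succ_ne_zero e) _).trans (Nat.le_mul_of_pos_left _ (by omega))
  obtain ⟨K, hK⟩ : ∃ K, K = (Code.prologue b (e + 1) (σ + 12)).size + (Code.body M Pa).size :=
    ⟨_, rfl⟩
  have hE : ∀ x, ∃ E, Params M Pa A (fun x => a x.length (k x)) x
      (b * (x.length + 1) ^ (e + 1)) E := fun x => by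
    have h1 := he x.length
    have h2 := hV x.length
    obtain ⟨cPa, hc1, hc2, hc3⟩ := hPa x
    exact exists_params hM hspace hspace' hc1 hc2 hc3
      (by omega) (by omega) (by omega) (by omega) (by omega) (by omega)
  have key := fun x => amortized_spec (hE x).choose_spec (hk x) rfl (hn x.length)
    (show _ ≤ K by omega) (by omega)
  let Vp : Polynomial ℕ := Polynomial.C b * (Polynomial.X + 1) ^ (e + 1)
  let Sp : Polynomial ℕ := Polynomial.C 32 + Polynomial.C 24 * Vp * (Vp + 1) +
    (Polynomial.C (σ + 1) * Vp + Polynomial.C 5) * (Polynomial.C (σ + 12) * Vp)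
  let Qp : Polynomial ℕ := Polynomial.C 24 * Vp * (Vp + Polynomial.C 2) + Polynomial.C 2 * Vp +
    Polynomial.C 10 + (Polynomial.C (σ + 1) * Vp + 1) * (Polynomial.C 24 * Vp + Polynomial.C 2)
  have hSp : ∀ n : ℕ, Sp.eval n = spaceBound σ (b * (n + 1) ^ (e + 1)) := fun n => by
    simp [Sp, Vp, spaceBound]
  have hQp : ∀ n : ℕ, Qp.eval n = prepBound σ (b * (n + 1) ^ (e + 1)) := fun n => by
    simp [Qp, Vp, prepBound]
  -- A single polynomial for everything: the square bounds the space in bits, `Sp` the register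
  -- contents, and K times `Qp` the preprocessing.
  have hq : ∀ n : ℕ, (Sp * Sp + Sp + Polynomial.C K * Qp).eval n = Sp.eval n * Sp.eval n +
      Sp.eval n + K * Qp.eval n := fun n => by simp
  refine ⟨amortized M Pa σ b (e + 1), Sp * Sp + Sp + Polynomial.C K * Qp, 100 * K, fun x => ?_,
    fun x t => ?_, fun x c hc => ?_⟩
  · obtain ⟨-, c, h1, h2, h3, -⟩ := key x
    exact ⟨c, h1, h2, h3⟩
  · have h1 := (key x).1 t
    have h2 := h1.space_le (by unfold spaceBound; omega)
    rw [hq, hSp]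
    exact ⟨by omega, fun i => (h1.2 i).trans (by omega)⟩
  · obtain ⟨-, c', h1, -, -, h2, h3⟩ := key x
    obtain rfl := hc.unique h1
    rw [hq, hQp]
    refine ⟨fun hA => (h2 hA).trans (Nat.le_add_left _ _), fun hA => ?_⟩
    obtain ⟨h4, g, hg1, hg2, h5, h6, h7, h8⟩ := h3 hA
    -- Between solutions N ≥ 2, so 2^g ≤ N is available. After the last one N = 1 may occur, and
    -- only 2^g ≤ N + 1 holds; hence the two different logarithms.
    have hlog : ∀ N : ℕ, 2 ^ g ≤ N → (g : ℝ) ≤ Real.logb 2 N := fun N hN => by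
      rw [Real.le_logb_iff_rpow_le (by norm_num)
        (by exact_mod_cast lt_of_lt_of_le (by positivity) hN), Real.rpow_natCast]
      exact_mod_cast hN
    refine ⟨h4.trans (Nat.le_add_left _ _), fun i hi hiN => ?_, ?_, h7, h8⟩
    · have h9 : (c.outputTime (i + 1) : ℝ) ≤
          c.outputTime i + (100 * K : ℕ) * a x.length (k x) * g := by exact_mod_cast h5 i hi hiN
      refine h9.trans ?_
      gcongr
      exact hlog _ (hg2 (by omega))
    · have h9 : (c.time : ℝ) ≤ c.outputTime (A x).ncard + (100 * K : ℕ) * a x.length (k x) * g := by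
        exact_mod_cast h6
      refine h9.trans ?_
      have := hlog _ hg1
      push_cast at this ⊢
      gcongr
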